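/- **Setting.** Let $X$ be a smooth $n$-dimensional manifold (Hausdorff, second countable, without boundary), let $T\in(0,+\infty]$, and let $(g_t)_{t\in[0,T)}$ be Riemannian metrics on $X$ depending smoothly on $(t,\varphi)\in[0,T)\times X$, with volume measures $m_{g_t}$, Laplace–Beltrami operators $\Delta_{g_t}$, gradients $\nabla_{g_t}$, covariant Hessians $\operatorname{Hess}_{g_t}$ and Ricci tensors $\operatorname{Ric}_{g_t}$; a dot denotes $\partial_t$, and $(\nabla_g f)_g^2=g^{ij}\partial_if\,\partial_jf$. Let $\mathsf Z_t>0$ and $V_t$ be smooth functions of $(t,\varphi)\in[0,T)\times X$ such that $$\partial_t\big(\mathsf Z_t\,dm_{g_t}\big)=-\tfrac12(\Delta_{g_t}\mathsf Z_t)\,dm_{g_t},\qquad \partial_tV_t=\tfrac12\Delta_{g_t}V_t-\tfrac12(\nabla_{g_t}V_t)^2_{g_t},$$ and such that $e^{-V_t}\mathsf Z_t\,dm_{g_t}$ has finite mass; let $\nu_t\propto e^{-V_t}\mathsf Z_t\,dm_{g_t}$ be the normalised measure. Call a smooth function $F:X\to\mathbb R$ that is constant outside a compact set a test function. For test functions $F$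 let $F_t=\boldsymbol P_{0,t}F$ be a smooth solution on $[0,T)\times X$ of $$\partial_tF_t=\boldsymbol L_tF_t:=\tfrac12\Delta_{g_t}F_t-(\nabla_{g_t}V_t,\nabla_{g_t}F_t)_{g_t},\qquad F_0=F.$$ If $X$ is not compact, assume in addition that for every $t_1<T$ the following regularity at infinity holds on $[0,t_1]$ (all of it is automatic if $X$ is compact): (i) there is a smooth proper function $\rho:X\to\mathbb R$, $\rho\to+\infty$ at infinity, with $\sup_{t\le t_1,\,\varphi\in X}(\nabla_{g_t}\rho)^2_{g_t}<\infty$ (uniform completeness); (ii) $\int_0^{t_1}\!\int_X|\nabla_{g_t}(\log \mathsf Z_t+V_t)|_{g_t}\,e^{-V_t}\mathsf Z_t\,dm_{g_t}\,dt<\infty$; (iii) for every test function $F$, $|F_t|$ and $(\nabla_{g_t}F_t)^2_{g_t}$ are bounded on $[0,t_1]\times X$. **Theorem (multiscale Bakry–Émery criterion with varying metric).** Assume the continuity assumption: for all test functions $F$ and all bounded smooth $h:\mathbb R\to\mathbb R$, $$\mathbb E_{\nu_t}[h(\boldsymbol P_{0,t}F)]\to h(\mathbb E_{\nu_0}[F])\qquad(t\to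 T).$$ Suppose there are real numbers $\dot\lambda_t$ (allowed to be negative), integrable in $t$ on $[0,t_1]$ for every $t_1<T$, such that for all $\varphi\in X$ and $t\in(0,T)$, as quadratic forms on $T_\varphi X$, $$\operatorname{Hess}_{g_t}V_t+\tfrac12\operatorname{Ric}_{g_t}+\tfrac12\dot g_t\ \ge\ \dot\lambda_t\,g_t ,$$ and let $$\lambda_t=\int_0^t\dot\lambda_s\,ds,\qquad \frac1\gamma=\int_0^Te^{-2\lambda_t}\,dt,$$ where the last integral is assumed to be finite. Then $\nu_0$ satisfies the log-Sobolev inequality $$\operatorname{Ent}_{\nu_0}(F)\le\frac2\gamma\,\mathbb E_{\nu_0}\big[(\nabla_{g_0}\sqrt F)^2_{g_0}\big]$$ for all bounded smooth $F:X\to[0,\infty)$, where $\operatorname{Ent}_\nu(F)=\mathbb E_\nu[F\log F]-\mathbb E_\nu[F]\log\mathbb E_\nu[F]$ and the right-hand side may be $+\infty$. -/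

import Mathlib

open Set Filter Topology MeasureTheory Matrix
open scoped Manifold ContDiff ENNReal

noncomputable section

namespace MultiscaleLSI

/-- The model space of an `n`-dimensional manifold. -/
abbrev Model (n : ℕ) : Type := EuclideanSpace ℝ (Fin n)

/-- Smooth Riemannian metrics on the `n`-dimensional smooth manifold `X`. -/
abbrev RMetric (n : ℕ) (X : Type*) [TopologicalSpace X] [ChartedSpace (Model n) X]
    [IsManifold (𝓡 n) ∞ X] : Type _ :=
  Bundle.ContMDiffRiemannianMetric (𝓡 n) ∞ (Model n) (fun x : X => TangentSpace (𝓡 n) x)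

section Geometry

variable {n : ℕ} {X : Type*} [TopologicalSpace X] [ChartedSpace (Model n) X]

/-- The partial derivative `∂_i f (y)`. -/
def pd (i : Fin n) (f : Model n → ℝ) (y : Model n) : ℝ :=
  fderiv ℝ f y (EuclideanSpace.single i 1)

/-- The function `f` read in the chart around `x₀`. -/
def inChart (x₀ : X) (f : X → ℝ) : Model n → ℝ :=
  fun y => f ((extChartAt (𝓡 n) x₀).symm y)

/-- The coordinate vector field `∂_i` of the chart around `x₀`, at the point with coordinates `y`. -/
def coordVec (x₀ : X) (i : Fin n) (y : Model n) :
    TangentSpace (𝓡 n) ((extChartAt (𝓡 n) x₀).symm y) :=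
  mfderiv (𝓡 n) (𝓡 n) (extChartAt (𝓡 n) x₀).symm y (EuclideanSpace.single i (1 : ℝ) : Model n)

variable [IsManifold (𝓡 n) ∞ X]

/-- The components `g_{ij}` of the metric in the chart around `x₀`, at the coordinates `y`. -/
def metricMat (g : RMetric n X) (x₀ : X) (y : Model n) : Matrix (Fin n) (Fin n) ℝ :=
  Matrix.of fun i j => g.inner ((extChartAt (𝓡 n) x₀).symm y) (coordVec x₀ i y) (coordVec x₀ j y)

/-- The density `√|g|` in the chart around `x₀`. -/
def volDensity (g : RMetric n X) (x₀ : X) (y : Model n) : ℝ :=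
  Real.sqrt |(metricMat g x₀ y).det|

/-- The Christoffel symbols `Γ^k_{ij}` in the chart around `x₀`. -/
def christoffel (g : RMetric n X) (x₀ : X) (k i j : Fin n) (y : Model n) : ℝ :=
  (1 / 2) * ∑ l, (metricMat g x₀ y)⁻¹ k l *
    (pd i (fun z => metricMat g x₀ z j l) y + pd j (fun z => metricMat g x₀ z i l) y
      - pd l (fun z => metricMat g x₀ z i j) y)

/-- The components `Ric_{ij}` of the Ricci tensor in the chart around `x₀`. -/
def ricciMat (g : RMetric n X) (x₀ : X) (y : Model n) : Matrix (Fin n) (Fin n) ℝ :=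
  Matrix.of fun i j =>
    ∑ k, (pd k (christoffel g x₀ k i j) y - pd j (christoffel g x₀ k i k) y
      + ∑ l, (christoffel g x₀ k k l y * christoffel g x₀ l i j y
        - christoffel g x₀ k j l y * christoffel g x₀ l i k y))

/-- The components `∂_i ∂_j f - Γ^k_{ij} ∂_k f` of the covariant Hessian in the chart
around `x₀`. -/
def hessMat (g : RMetric n X) (f : X → ℝ) (x₀ : X) (y : Model n) : Matrix (Fin n) (Fin n) ℝ :=
  Matrix.of fun i j =>
    pd i (pd j (inChart x₀ f)) y - ∑ k, christoffel g x₀ k i j y * pd k (inChart x₀ f) y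

/-- The scalar product `(∇_g a, ∇_g b)_g = g^{ij} ∂_i a ∂_j b` at `x`. -/
def gradInner (g : RMetric n X) (a b : X → ℝ) (x : X) : ℝ :=
  ∑ i, ∑ j, (metricMat g x (extChartAt (𝓡 n) x x))⁻¹ i j
    * pd i (inChart x a) (extChartAt (𝓡 n) x x) * pd j (inChart x b) (extChartAt (𝓡 n) x x)

/-- The squared gradient `(∇_g f)²_g` at `x`. -/
def gradSq (g : RMetric n X) (f : X → ℝ) (x : X) : ℝ := gradInner g f f x

/-- The Laplace–Beltrami operator `Δ_g f = |g|^{-1/2} ∂_i (|g|^{1/2} g^{ij} ∂_j f)` at `x`. -/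
def laplaceBeltrami (g : RMetric n X) (f : X → ℝ) (x : X) : ℝ :=
  (volDensity g x (extChartAt (𝓡 n) x x))⁻¹ *
    ∑ i, pd i (fun y => ∑ j, volDensity g x y * (metricMat g x y)⁻¹ i j * pd j (inChart x f) y)
      (extChartAt (𝓡 n) x x)

/-- The part of the Riemannian volume that lives in the domain of the chart around `x₀`:
the push-forward of `√|g| dy` under the inverse chart. -/
def chartVolume [MeasurableSpace X] (g : RMetric n X) (x₀ : X) : Measure X :=
  Measure.map (extChartAt (𝓡 n) x₀).symm
    ((volume.restrict (extChartAt (𝓡 n) x₀).target).withDensity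
      (fun y => ENNReal.ofReal (volDensity g x₀ y)))

/-- The Riemannian volume measure `m_g`: the least measure that dominates `√|g| dy` in every
chart. By the change of variables formula the chart measures are the restrictions of one measure
to the chart domains, so the supremum is that measure. -/
def riemVolume [MeasurableSpace X] (g : RMetric n X) : Measure X :=
  ⨆ x₀ : X, chartVolume g x₀

end Geometry

/-- The time interval `[0, T)`, with `T ∈ (0, ∞]`. -/
def timeSet (T : EReal) : Set ℝ := {t | 0 ≤ t ∧ (t : EReal) < T}

section Flow

variable {n : ℕ} {X : Type*} [TopologicalSpace X] [ChartedSpace (Model n) X]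

/-- A function on `[0,T) × X` that is smooth, up to and including time `0`. -/
def SmoothInTime (n : ℕ) {X : Type*} [TopologicalSpace X] [ChartedSpace (Model n) X]
    (T : EReal) (f : ℝ → X → ℝ) : Prop :=
  ContMDiffOn (𝓘(ℝ, ℝ).prod (𝓡 n)) 𝓘(ℝ, ℝ) ∞ (fun p : ℝ × X => f p.1 p.2)
    (timeSet T ×ˢ (univ : Set X))

/-- Smooth functions that are constant outside a compact set (all smooth functions,
if `X` is compact). -/
def IsTestFunction (n : ℕ) {X : Type*} [TopologicalSpace X] [ChartedSpace (Model n) X]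
    (F : X → ℝ) : Prop :=
  ContMDiff (𝓡 n) 𝓘(ℝ, ℝ) ∞ F ∧ ∃ c : ℝ, HasCompactSupport (fun x => F x - c)

variable [IsManifold (𝓡 n) ∞ X]

/-- The time-dependent metric `g_t` depends smoothly on `(t, x) ∈ [0,T) × X`: so do its components
in every chart. -/
def SmoothMetricFlow (T : EReal) (g : ℝ → RMetric n X) : Prop :=
  ∀ (x₀ : X) (i j : Fin n),
    ContDiffOn ℝ ∞ (fun p : ℝ × Model n => metricMat (g p.1) x₀ p.2 i j)
      (timeSet T ×ˢ (extChartAt (𝓡 n) x₀).target)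

/-- The generator `L f = ½ Δ_g f - (∇_g V, ∇_g f)_g`. -/
def generator (g : RMetric n X) (V f : X → ℝ) (x : X) : ℝ :=
  (1 / 2) * laplaceBeltrami g f x - gradInner g V f x

/-- The components of `ġ_t` at `x`, in the chart around `x`. -/
def metricDot (g : ℝ → RMetric n X) (t : ℝ) (x : X) : Matrix (Fin n) (Fin n) ℝ :=
  Matrix.of fun i j => deriv (fun s => metricMat (g s) x (extChartAt (𝓡 n) x x) i j) t

/-- The measure `e^{-V} Z dm_g`. -/
def weightedMeasure [MeasurableSpace X] (g : RMetric n X) (Z V : X → ℝ) : Measure X :=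
  (riemVolume g).withDensity (fun x => ENNReal.ofReal (Real.exp (-V x) * Z x))

/-- The measure `ν ∝ e^{-V} Z dm_g`, normalised. -/
def renormMeasure [MeasurableSpace X] (g : RMetric n X) (Z V : X → ℝ) : Measure X :=
  (weightedMeasure g Z V univ)⁻¹ • weightedMeasure g Z V

/-- The setting: a smooth time-dependent metric `g_t`, a positive solution `Z_t dm_{g_t}` of the
backward heat equation `∂_t (Z_t dm_{g_t}) = -½ (Δ_{g_t} Z_t) dm_{g_t}`, a solution `V_t` of the
Polchinski equation `∂_t V_t = ½ Δ_{g_t} V_t - ½ (∇_{g_t} V_t)²_{g_t}`, and `e^{-V_t} Z_t dm_{g_t}`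
of finite mass. -/
structure IsRenormFlow [MeasurableSpace X] (T : EReal) (g : ℝ → RMetric n X) (Z V : ℝ → X → ℝ) :
    Prop where
  smooth_metric : SmoothMetricFlow T g
  smooth_Z : SmoothInTime n T Z
  smooth_V : SmoothInTime n T V
  Z_pos : ∀ t ∈ timeSet T, ∀ x, 0 < Z t x
  backward_heat : ∀ t ∈ timeSet T, 0 < t → ∀ x,
    deriv (fun s => Z s x * volDensity (g s) x (extChartAt (𝓡 n) x x)) t
      = -(1 / 2) * laplaceBeltrami (g t) (Z t) x * volDensity (g t) x (extChartAt (𝓡 n) x x)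
  polchinski : ∀ t ∈ timeSet T, 0 < t → ∀ x,
    deriv (fun s => V s x) t
      = (1 / 2) * laplaceBeltrami (g t) (V t) x - (1 / 2) * gradSq (g t) (V t) x
  finite_mass : ∀ t ∈ timeSet T, weightedMeasure (g t) (Z t) (V t) univ ≠ ⊤

/-- Regularity at infinity, locally uniformly in `t ∈ [0,T)`; automatic if `X` is compact.
* The metrics are complete, in the form: there is a proper function with bounded gradients
  (for a single metric this is equivalent to completeness).
* The probability current `½ e^{-V_t} Z_t ∇_{g_t} (log Z_t + V_t)` of
  `e^{-V_t} Z_t dm_{g_t}` is integrable. -/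
structure IsTameAtInfinity [MeasurableSpace X] (T : EReal) (g : ℝ → RMetric n X)
    (Z V : ℝ → X → ℝ) : Prop where
  complete : ∀ t₁ ∈ timeSet T, ∃ ρ : X → ℝ, ContMDiff (𝓡 n) 𝓘(ℝ, ℝ) ∞ ρ ∧
    Tendsto ρ (cocompact X) atTop ∧
      ∃ C : ℝ, ∀ t ∈ Icc 0 t₁, ∀ x, gradSq (g t) ρ x ≤ C
  integrable_current : ∀ t₁ ∈ timeSet T,
    ∫⁻ t in Icc 0 t₁, ∫⁻ x, ENNReal.ofReal
      (Real.sqrt (gradSq (g t) (fun y => Real.log (Z t y) + V t y) x))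
        ∂(weightedMeasure (g t) (Z t) (V t)) ≠ ⊤

/-- `P t F` is `F_t = P_{0,t} F`: for each test function `F` it is a smooth solution of
`∂_t F_t = L_t F_t` with `F_0 = F` which is bounded with bounded gradient, locally uniformly in
`t ∈ [0,T)` (the bounds are automatic if `X` is compact). -/
structure IsPolchinskiSemigroup (T : EReal) (g : ℝ → RMetric n X) (V : ℝ → X → ℝ)
    (P : ℝ → (X → ℝ) → X → ℝ) : Prop where
  initial : ∀ F, IsTestFunction n F → P 0 F = F
  smooth : ∀ F, IsTestFunction n F → SmoothInTime n T (fun t => P t F)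
  evolution : ∀ F, IsTestFunction n F → ∀ t ∈ timeSet T, 0 < t → ∀ x,
    deriv (fun s => P s F x) t = generator (g t) (V t) (P t F) x
  bounded : ∀ F, IsTestFunction n F → ∀ t₁ ∈ timeSet T, ∃ C : ℝ, ∀ t ∈ Icc 0 t₁, ∀ x,
    |P t F x| ≤ C ∧ gradSq (g t) (P t F) x ≤ C

/-- The continuity assumption `E_{ν_t}[h(P_{0,t} F)] → h(E_{ν_0}[F])` as `t → T`, for bounded
smooth `h : ℝ → ℝ` and test functions `F`. -/
def ContinuityAssumption [MeasurableSpace X] (T : EReal) (g : ℝ → RMetric n X) (Z V : ℝ → X → ℝ)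
    (P : ℝ → (X → ℝ) → X → ℝ) : Prop :=
  ∀ F : X → ℝ, IsTestFunction n F → ∀ h : ℝ → ℝ, ContDiff ℝ ∞ h → (∃ C : ℝ, ∀ r, |h r| ≤ C) →
    Tendsto (fun t => ∫ x, h (P t F x) ∂(renormMeasure (g t) (Z t) (V t)))
      (comap ((↑) : ℝ → EReal) (𝓝[<] T))
      (𝓝 (h (∫ x, F x ∂(renormMeasure (g 0) (Z 0) (V 0)))))

/-- The multiscale Bakry–Émery condition `Hess V_t + ½ Ric + ½ ġ_t ≥ λ̇_t g_t`, as quadratic forms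
on the tangent spaces. -/
def MultiscaleCondition (T : EReal) (g : ℝ → RMetric n X) (V : ℝ → X → ℝ) (lamDot : ℝ → ℝ) :
    Prop :=
  ∀ t ∈ timeSet T, 0 < t → ∀ (x : X) (v : Fin n → ℝ),
    lamDot t * (v ⬝ᵥ (metricMat (g t) x (extChartAt (𝓡 n) x x) *ᵥ v)) ≤
      v ⬝ᵥ ((hessMat (g t) (V t) x (extChartAt (𝓡 n) x x)
        + (1 / 2 : ℝ) • ricciMat (g t) x (extChartAt (𝓡 n) x x)
        + (1 / 2 : ℝ) • metricDot g t x) *ᵥ v)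

end Flow

/-- The entropy `Ent_ν(F) = E_ν[F log F] - E_ν[F] log E_ν[F]`. -/
def entropy {X : Type*} [MeasurableSpace X] (ν : Measure X) (F : X → ℝ) : ℝ :=
  ∫ x, F x * Real.log (F x) ∂ν - (∫ x, F x ∂ν) * Real.log (∫ x, F x ∂ν)

/-- The log-Sobolev inequality `Ent_ν(F) ≤ (2/γ) E_ν[(∇√F)²_g]`, for all bounded smooth `F ≥ 0`.
The right-hand side may be infinite. (At a zero of `F` the derivative of `√F` is either `0` or,
where it does not exist, read as `0`.) -/
def LogSobolev {n : ℕ} {X : Type*} [TopologicalSpace X] [ChartedSpace (Model n) X]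
    [IsManifold (𝓡 n) ∞ X] [MeasurableSpace X] (g : RMetric n X) (ν : Measure X) (γ : ℝ) : Prop :=
  ∀ F : X → ℝ, ContMDiff (𝓡 n) 𝓘(ℝ, ℝ) ∞ F → (∀ x, 0 ≤ F x) → (∃ C : ℝ, ∀ x, F x ≤ C) →
    ENNReal.ofReal (entropy ν F) ≤ ENNReal.ofReal (2 / γ) *
      ∫⁻ x, ENNReal.ofReal (gradSq g (fun y => Real.sqrt (F y)) x) ∂ν

end MultiscaleLSI

end

/-! Write `μ_t = e^{-V_t} Z_t dm_{g_t}` and `F_t = P_{0,t} F`. The equation for `V` is the Hopf–Cole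
form of the heat equation for `e^{-V}`, and `Z dm_g` solves the backward heat equation, so `∂_t μ_t
= -½ div(e^{-V} Z ∇(log Z + V)) dm_g`. Integrating by parts, this is exactly what is needed to get,
for smooth `h`, `d/dt ∫ h(F_t) dμ_t = -½ ∫ h''(F_t) (∇F_t)² dμ_t`. With `h` constant the mass is
conserved; with `h(r) = r log r` the entropy decreases at rate `½ I_t`, where `I_t = ∫ F_t (∇ log
F_t)² dμ_t` is the Fisher information.

The decay of `I_t` is the Bakry–Émery argument. The function `u = log F_t` solves `∂_t u = L u + ½
(∇u)²`, and Bochner's formula gives `(∂_t - L)(∇u)² = -|Hess u|² - 2 (Hess V + ½ Ric + ½ ġ)(∇u, ∇u)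
+ (∇u, ∇(∇u)²)`, the term in `ġ` coming from the derivative of the inverse metric. After
multiplication by `F` the last term is cancelled by the product rule for `L`, and the curvature
condition leaves `(∂_t - L)(F (∇u)²) ≤ -F |Hess u|² - 2 λ̇ F (∇u)²`. Hence `I_t ≤ e^{-2 λ_t} I_0`,
the total loss of entropy is at most `I_0 / (2γ)`, and `(∇F)² / F = 4 (∇√F)²` yields the constant
`2/γ`. The continuity assumption identifies the limit of `E_{ν_t}[F_t log F_t]` as `E[F] log E[F]`.

On a noncompact manifold every identity is tested against the squares `χ_k²` of cutoffs with
gradients `O(1/k)`. The errors vanish because `F_t` and `∇F_t` are bounded and the current is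
integrable. No bound on second derivatives of `F_t` is available; where `∇(∇u)²` meets `∇χ_k`, the
good term `-F |Hess u|²` absorbs it. Dividing by `F_t` requires the lower bound of `F` to persist,
which is a maximum principle obtained from high moments. General bounded `F ≥ 0` are reached at the
end through `√F`.

The geometry is computed in coordinates, as are the definitions. Gradient products transform as
scalars; the Laplacian is shown to be independent of the chart through its weak form. Hessian and
Ricci tensor are only needed at `x` in the chart around `x`, so their transformation laws never
enter.

The argument is carried by `IsMetricOn.bochner`, `IsMetricOn.evolution_gradSq_le`,
`IsSmoothMetric.green`, `IsSmoothMetric.integral_weighted_by_parts`,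
`IsSolution.weakRate_fisher_le`, `IsRenormFlow.exp_mul_integral_le`, `IsSolution.abs_sub_le`,
`IsSolution.integral_mul_log_sub_le` and `logSobolev_of_isTestFunction`. -/

set_option linter.unusedSectionVars false

noncomputable section

namespace MultiscaleLSI

/-! ### Rules for partial derivatives on open sets of coordinates. -/

section PartialDerivatives

variable {n : ℕ} {Ω : Set (Model n)} {f h : Model n → ℝ} {y : Model n}

theorem pd_congr (hΩ : IsOpen Ω) (hy : y ∈ Ω) (i : Fin n) (hfh : ∀ z ∈ Ω, f z = h z) :
    pd i f y = pd i h y := by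
  have : f =ᶠ[𝓝 y] h := by
    filter_upwards [hΩ.mem_nhds hy] with z hz using hfh z hz
  simp only [pd, this.fderiv_eq]

theorem differentiableAt_of_contDiffOn (hΩ : IsOpen Ω) (hf : ContDiffOn ℝ ∞ f Ω) (hy : y ∈ Ω) :
    DifferentiableAt ℝ f y :=
  (hf.contDiffAt (hΩ.mem_nhds hy)).differentiableAt (by simp)

theorem contDiffOn_pd (hΩ : IsOpen Ω) (hf : ContDiffOn ℝ ∞ f Ω) (i : Fin n) :
    ContDiffOn ℝ ∞ (pd i f) Ω :=
  (hf.fderiv_of_isOpen hΩ (by simp)).clm_apply contDiffOn_const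

theorem pd_const (i : Fin n) (c : ℝ) : pd i (fun _ => c) y = 0 := by
  simp [pd]

theorem pd_add (i : Fin n) (hf : DifferentiableAt ℝ f y) (hh : DifferentiableAt ℝ h y) :
    pd i (fun z => f z + h z) y = pd i f y + pd i h y := by
  simp only [pd]; rw [fderiv_fun_add hf hh]; rfl

theorem pd_sub (i : Fin n) (hf : DifferentiableAt ℝ f y) (hh : DifferentiableAt ℝ h y) :
    pd i (fun z => f z - h z) y = pd i f y - pd i h y := by
  simp only [pd]; rw [fderiv_fun_sub hf hh]; rfl

theorem pd_mul (i : Fin n) (hf : DifferentiableAt ℝ f y) (hh : DifferentiableAt ℝ h y) :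
    pd i (fun z => f z * h z) y = pd i f y * h y + f y * pd i h y := by
  simp only [pd]; rw [fderiv_fun_mul hf hh]
  simp only [_root_.add_apply, _root_.smul_apply, smul_eq_mul]
  ring

theorem pd_const_mul (i : Fin n) (c : ℝ) (hf : DifferentiableAt ℝ f y) :
    pd i (fun z => c * f z) y = c * pd i f y := by
  rw [pd_mul i (differentiableAt_const c) hf, pd_const]; ring

theorem pd_sum {ι : Type*} (s : Finset ι) (F : ι → Model n → ℝ) (i : Fin n)
    (hF : ∀ k ∈ s, DifferentiableAt ℝ (F k) y) :
    pd i (fun z => ∑ k ∈ s, F k z) y = ∑ k ∈ s, pd i (F k) y := by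
  simp only [pd]; rw [fderiv_fun_sum hF]
  simp

theorem pd_comp (i : Fin n) {φ : ℝ → ℝ} (hφ : DifferentiableAt ℝ φ (f y))
    (hf : DifferentiableAt ℝ f y) :
    pd i (fun z => φ (f z)) y = deriv φ (f y) * pd i f y := by
  have := (hφ.hasDerivAt.comp_hasFDerivAt y hf.hasFDerivAt).fderiv
  simp only [pd]
  rw [show (fun z => φ (f z)) = φ ∘ f from rfl, this]
  simp

theorem pd_comm (hΩ : IsOpen Ω) (hf : ContDiffOn ℝ ∞ f Ω) (hy : y ∈ Ω) (i j : Fin n) :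
    pd i (pd j f) y = pd j (pd i f) y := by
  have hc : ContDiffAt ℝ ∞ f y := hf.contDiffAt (hΩ.mem_nhds hy)
  have hs : IsSymmSndFDerivAt ℝ f y :=
    hc.isSymmSndFDerivAt (by rw [minSmoothness_of_isRCLikeNormedField]; exact WithTop.coe_le_coe.2 le_top)
  have hd : DifferentiableAt ℝ (fderiv ℝ f) y :=
    (hc.fderiv_right (m := ∞) (by simp)).differentiableAt (by simp)
  have key : ∀ a b : Model n, fderiv ℝ (fun z => fderiv ℝ f z a) y b
      = fderiv ℝ (fderiv ℝ f) y b a := by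
    intro a b
    rw [fderiv_clm_apply hd (differentiableAt_const a)]
    simp
  change fderiv ℝ (fun z => fderiv ℝ f z _) y _ = fderiv ℝ (fun z => fderiv ℝ f z _) y _
  rw [key, key]
  exact hs.eq _ _

end PartialDerivatives

/-! ### Jacobi's formula for the derivative of a determinant. -/

section DetDerivative

/-- The determinant is multilinear in the rows, so its derivative is a sum of determinants with one
row replaced by its derivative; Cramer's rule turns each of them into a pairing with the adjugate.
Nothing needs to be invertible. -/
theorem hasFDerivAt_det {n : ℕ} {E : Type*} [NormedAddCommGroup E] [NormedSpace ℝ E]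
    {G : E → Matrix (Fin n) (Fin n) ℝ} {y : E}
    (hG : ∀ i j, DifferentiableAt ℝ (fun z => G z i j) y) (v : E) :
    DifferentiableAt ℝ (fun z => (G z).det) y ∧
    fderiv ℝ (fun z => (G z).det) y v
      = ∑ i, ∑ j, (G y).adjugate j i * fderiv ℝ (fun z => G z i j) y v := by
  let D : ContinuousMultilinearMap ℝ (fun _ : Fin n => Fin n → ℝ) ℝ :=
    ⟨(Matrix.detRowAlternating (n := Fin n) (R := ℝ)).toMultilinearMap, by
      change Continuous fun M : Matrix (Fin n) (Fin n) ℝ => M.det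
      exact continuous_id.matrix_det⟩
  have hG' : HasFDerivAt (fun z => (fun i => G z i : Fin n → Fin n → ℝ))
      (ContinuousLinearMap.pi fun i => ContinuousLinearMap.pi fun j =>
        fderiv ℝ (fun z => G z i j) y) y := by
    rw [hasFDerivAt_pi]
    intro i
    rw [hasFDerivAt_pi]
    exact fun j => (hG i j).hasFDerivAt
  have hD := (D.hasFDerivAt (fun i => G y i)).comp y hG'
  have hD' : HasFDerivAt (fun z => (G z).det) _ y := hD
  refine ⟨hD'.differentiableAt, ?_⟩
  rw [hD'.fderiv]
  simp only [ContinuousLinearMap.comp_apply, ContinuousMultilinearMap.linearDeriv_apply]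
  refine Finset.sum_congr rfl fun i _ => ?_
  change ((G y).updateRow i (fun j => fderiv ℝ (fun z => G z i j) y v)).det = _
  rw [← Matrix.cramer_transpose_apply, Matrix.cramer_eq_adjugate_mulVec,
    ← Matrix.adjugate_transpose]
  simp [Matrix.mulVec, dotProduct]

end DetDerivative

/-! ### Tensor calculus of a metric given in coordinates. -/

section Coordinates

variable {n : ℕ}

/-- The scalar product of the gradients of `a` and `b` for the metric `G` on an open set of
coordinates. -/
def coordGrad (G : Model n → Matrix (Fin n) (Fin n) ℝ) (a b : Model n → ℝ) (y : Model n) : ℝ :=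
  ∑ i, ∑ j, (G y)⁻¹ i j * pd i a y * pd j b y

/-- The volume density of the metric `G`. -/
def coordDens (G : Model n → Matrix (Fin n) (Fin n) ℝ) (y : Model n) : ℝ :=
  Real.sqrt |(G y).det|

/-- The Laplace–Beltrami operator of the metric `G`. -/
def coordLap (G : Model n → Matrix (Fin n) (Fin n) ℝ) (f : Model n → ℝ) (y : Model n) : ℝ :=
  (coordDens G y)⁻¹ * ∑ i, pd i (fun z => ∑ j, coordDens G z * (G z)⁻¹ i j * pd j f z) y

/-- The Christoffel symbols of the metric `G`. -/
def coordChris (G : Model n → Matrix (Fin n) (Fin n) ℝ) (k i j : Fin n) (y : Model n) : ℝ :=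
  (1 / 2) * ∑ l, (G y)⁻¹ k l *
    (pd i (fun z => G z j l) y + pd j (fun z => G z i l) y - pd l (fun z => G z i j) y)

/-- The Ricci tensor of the metric `G`. -/
def coordRic (G : Model n → Matrix (Fin n) (Fin n) ℝ) (i j : Fin n) (y : Model n) : ℝ :=
  ∑ k, (pd k (coordChris G k i j) y - pd j (coordChris G k i k) y
    + ∑ l, (coordChris G k k l y * coordChris G l i j y
      - coordChris G k j l y * coordChris G l i k y))

/-- The covariant Hessian of `f` for the metric `G`. -/
def coordHess (G : Model n → Matrix (Fin n) (Fin n) ℝ) (f : Model n → ℝ) (i j : Fin n)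
    (y : Model n) : ℝ :=
  pd i (pd j f) y - ∑ k, coordChris G k i j y * pd k f y

/-- The components of the gradient of `f` for the metric `G`. -/
def gradVec (G : Model n → Matrix (Fin n) (Fin n) ℝ) (f : Model n → ℝ) (i : Fin n)
    (y : Model n) : ℝ :=
  ∑ j, (G y)⁻¹ i j * pd j f y

/-- `G` is a smooth Riemannian metric on the open set `Ω`. -/
structure IsMetricOn (G : Model n → Matrix (Fin n) (Fin n) ℝ) (Ω : Set (Model n)) : Prop where
  isOpen : IsOpen Ω
  smooth : ∀ i j, ContDiffOn ℝ ∞ (fun z => G z i j) Ω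
  posDef : ∀ y ∈ Ω, (G y).PosDef

namespace IsMetricOn

variable {G : Model n → Matrix (Fin n) (Fin n) ℝ} {Ω : Set (Model n)}
  {y : Model n} {f h u V : Model n → ℝ}

theorem diff (hG : IsMetricOn G Ω) (hf : ContDiffOn ℝ ∞ f Ω) (hy : y ∈ Ω) : DifferentiableAt ℝ f y :=
  differentiableAt_of_contDiffOn hG.isOpen hf hy

theorem symm (hG : IsMetricOn G Ω) (hy : y ∈ Ω) (i j : Fin n) : G y i j = G y j i := by
  simpa using (hG.posDef y hy).isHermitian.apply j i

theorem inv_symm (hG : IsMetricOn G Ω) (hy : y ∈ Ω) (i j : Fin n) : (G y)⁻¹ i j = (G y)⁻¹ j i := by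
  simpa using (hG.posDef y hy).inv.isHermitian.apply j i

theorem det_pos (hG : IsMetricOn G Ω) (hy : y ∈ Ω) : 0 < (G y).det := (hG.posDef y hy).det_pos

theorem inv_mul (hG : IsMetricOn G Ω) (hy : y ∈ Ω) : (G y)⁻¹ * G y = 1 :=
  Matrix.nonsing_inv_mul _ (hG.det_pos hy).ne'.isUnit

theorem mul_inv (hG : IsMetricOn G Ω) (hy : y ∈ Ω) : G y * (G y)⁻¹ = 1 :=
  Matrix.mul_nonsing_inv _ (hG.det_pos hy).ne'.isUnit

theorem contDiffOn_det (hG : IsMetricOn G Ω) : ContDiffOn ℝ ∞ (fun z => (G z).det) Ω := by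
  simp only [Matrix.det_apply]
  exact ContDiffOn.sum fun σ _ => (contDiffOn_prod fun i _ => hG.smooth _ _).const_smul _

/-- The inverse is the adjugate divided by the determinant, both polynomial in the entries. -/
theorem contDiffOn_inv (hG : IsMetricOn G Ω) (i j : Fin n) : ContDiffOn ℝ ∞ (fun z => (G z)⁻¹ i j) Ω := by
  have h1 : ContDiffOn ℝ ∞ (fun z => (G z).adjugate i j) Ω := by
    simp only [Matrix.adjugate_apply, Matrix.det_apply]
    refine ContDiffOn.sum fun σ _ => (contDiffOn_prod fun k _ => ?_).const_smul _
    simp only [Matrix.updateRow_apply]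
    split_ifs
    · exact contDiffOn_const
    · exact hG.smooth _ _
  have h2 : ContDiffOn ℝ ∞ (fun z => ((G z).det)⁻¹ * (G z).adjugate i j) Ω :=
    (hG.contDiffOn_det.inv fun z hz => (hG.det_pos hz).ne').mul h1
  refine h2.congr fun z hz => ?_
  rw [Matrix.inv_def]
  simp [Ring.inverse_eq_inv]

theorem coordDens_eq (hG : IsMetricOn G Ω) (hy : y ∈ Ω) : coordDens G y = Real.sqrt (G y).det := by
  rw [coordDens, abs_of_pos (hG.det_pos hy)]

theorem coordDens_pos (hG : IsMetricOn G Ω) (hy : y ∈ Ω) : 0 < coordDens G y := by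
  rw [hG.coordDens_eq hy]; exact Real.sqrt_pos.2 (hG.det_pos hy)

theorem contDiffOn_coordDens (hG : IsMetricOn G Ω) : ContDiffOn ℝ ∞ (coordDens G) Ω :=
  (hG.contDiffOn_det.sqrt fun _ hz => (hG.det_pos hz).ne').congr fun _ hz => hG.coordDens_eq hz

theorem contDiffOn_chris (hG : IsMetricOn G Ω) (k i j : Fin n) : ContDiffOn ℝ ∞ (coordChris G k i j) Ω := by
  have hp := fun a b c => contDiffOn_pd hG.isOpen (hG.smooth a b) c
  exact contDiffOn_const.mul (ContDiffOn.sum fun l _ => (hG.contDiffOn_inv k l).mul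
    (((hp _ _ _).add (hp _ _ _)).sub (hp _ _ _)))

theorem contDiffOn_gradVec (hG : IsMetricOn G Ω) (hf : ContDiffOn ℝ ∞ f Ω) (i : Fin n) :
    ContDiffOn ℝ ∞ (gradVec G f i) Ω :=
  ContDiffOn.sum fun j _ => (hG.contDiffOn_inv i j).mul (contDiffOn_pd hG.isOpen hf j)

theorem contDiffOn_hess (hG : IsMetricOn G Ω) (hf : ContDiffOn ℝ ∞ f Ω) (i j : Fin n) :
    ContDiffOn ℝ ∞ (coordHess G f i j) Ω :=
  (contDiffOn_pd hG.isOpen (contDiffOn_pd hG.isOpen hf j) i).sub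
    (ContDiffOn.sum fun k _ => (hG.contDiffOn_chris k i j).mul (contDiffOn_pd hG.isOpen hf k))

theorem contDiffOn_coordGrad (hG : IsMetricOn G Ω) (hf : ContDiffOn ℝ ∞ f Ω) (hh : ContDiffOn ℝ ∞ h Ω) :
    ContDiffOn ℝ ∞ (coordGrad G f h) Ω :=
  ContDiffOn.sum fun i _ => ContDiffOn.sum fun j _ =>
    ((hG.contDiffOn_inv i j).mul (contDiffOn_pd hG.isOpen hf i)).mul
      (contDiffOn_pd hG.isOpen hh j)

theorem contDiffOn_coordLap (hG : IsMetricOn G Ω) (hf : ContDiffOn ℝ ∞ f Ω) : ContDiffOn ℝ ∞ (coordLap G f) Ω :=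
  (hG.contDiffOn_coordDens.inv fun _ hz => (hG.coordDens_pos hz).ne').mul
    (ContDiffOn.sum fun i _ => contDiffOn_pd hG.isOpen (ContDiffOn.sum fun j _ =>
      (hG.contDiffOn_coordDens.mul (hG.contDiffOn_inv i j)).mul (contDiffOn_pd hG.isOpen hf j)) i)

theorem chris_symm (hG : IsMetricOn G Ω) (hy : y ∈ Ω) (k i j : Fin n) : coordChris G k i j y = coordChris G k j i y := by
  simp only [coordChris]
  congr 1
  refine Finset.sum_congr rfl fun l _ => ?_
  rw [pd_congr hG.isOpen hy l (fun z hz => hG.symm hz i j)]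
  ring

theorem hess_symm (hG : IsMetricOn G Ω) (hf : ContDiffOn ℝ ∞ f Ω) (hy : y ∈ Ω) (i j : Fin n) :
    coordHess G f i j y = coordHess G f j i y := by
  simp only [coordHess]
  rw [pd_comm hG.isOpen hf hy i j]
  simp only [hG.chris_symm hy _ i j]

theorem sum_mul_inv (hG : IsMetricOn G Ω) (hy : y ∈ Ω) (i j : Fin n) :
    ∑ l, G y i l * (G y)⁻¹ l j = if i = j then 1 else 0 := by
  have := congrFun (congrFun (hG.mul_inv hy) i) j
  rwa [Matrix.mul_apply, Matrix.one_apply] at this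

theorem sum_inv_mul (hG : IsMetricOn G Ω) (hy : y ∈ Ω) (i j : Fin n) :
    ∑ l, (G y)⁻¹ i l * G y l j = if i = j then 1 else 0 := by
  have := congrFun (congrFun (hG.inv_mul hy) i) j
  rwa [Matrix.mul_apply, Matrix.one_apply] at this

/-- Lowering the upper index of the Christoffel symbols. -/
theorem sum_metric_mul_chris (hG : IsMetricOn G Ω) (hy : y ∈ Ω) (m i j : Fin n) :
    ∑ k, G y m k * coordChris G k i j y
      = (1 / 2) * (pd i (fun z => G z j m) y + pd j (fun z => G z i m) y
        - pd m (fun z => G z i j) y) := by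
  simp only [coordChris, Finset.mul_sum]
  rw [Finset.sum_comm]
  set X := fun l => pd i (fun z => G z j l) y + pd j (fun z => G z i l) y
        - pd l (fun z => G z i j) y with hX
  have : ∀ l, ∑ k, G y m k * (1 / 2 * ((G y)⁻¹ k l * X l))
      = (if m = l then 1 else 0) * ((1 / 2) * X l) := by
    intro l
    rw [← hG.sum_mul_inv hy, Finset.sum_mul]
    exact Finset.sum_congr rfl fun k _ => by ring
  rw [Finset.sum_congr rfl fun l _ => this l]
  simp [hX]

/-- The Levi-Civita connection is compatible with the metric. -/
theorem pd_metric (hG : IsMetricOn G Ω) (hy : y ∈ Ω) (k i j : Fin n) :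
    pd k (fun z => G z i j) y
      = ∑ l, G y j l * coordChris G l k i y + ∑ l, G y i l * coordChris G l k j y := by
  rw [hG.sum_metric_mul_chris hy, hG.sum_metric_mul_chris hy]
  rw [pd_congr hG.isOpen hy j (fun z hz => hG.symm hz k i),
    pd_congr hG.isOpen hy k (fun z hz => hG.symm hz j i)]
  ring

/-- Differentiate `G⁻¹ G = 1` and multiply by `G⁻¹` from the right. -/
theorem pd_inv_eq (hG : IsMetricOn G Ω) (hy : y ∈ Ω) (k i j : Fin n) :
    pd k (fun z => (G z)⁻¹ i j) y
      = -∑ a, ∑ b, (G y)⁻¹ i a * pd k (fun z => G z a b) y * (G y)⁻¹ b j := by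
  have hd := fun a b => hG.diff (hG.contDiffOn_inv a b) hy
  have hd' := fun a b => hG.diff (hG.smooth a b) hy
  let D : Matrix (Fin n) (Fin n) ℝ := Matrix.of fun a b => pd k (fun z => (G z)⁻¹ a b) y
  let D' : Matrix (Fin n) (Fin n) ℝ := Matrix.of fun a b => pd k (fun z => G z a b) y
  have h0 : D * G y + (G y)⁻¹ * D' = 0 := by
    ext a b
    have h1 : pd k (fun z => ∑ l, (G z)⁻¹ a l * G z l b) y = 0 := by
      rw [pd_congr hG.isOpen hy k (fun z hz => hG.sum_inv_mul hz a b), pd_const]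
    rw [pd_sum _ _ _ fun l _ => (hd a l).fun_mul (hd' l b)] at h1
    simp only [pd_mul k (hd a _) (hd' _ b)] at h1
    rw [Finset.sum_add_distrib] at h1
    simpa [Matrix.mul_apply, D, D'] using h1
  have h1 : D = -((G y)⁻¹ * D' * (G y)⁻¹) := by
    have := congrArg (· * (G y)⁻¹) (eq_neg_of_add_eq_zero_left h0)
    simpa [Matrix.mul_assoc, hG.mul_inv hy] using this
  have h2 := congrFun (congrFun h1 i) j
  simp only [D, Matrix.of_apply] at h2
  rw [h2]
  simp only [Matrix.neg_apply, Matrix.mul_apply, Finset.sum_mul, D', Matrix.of_apply]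
  rw [Finset.sum_comm]

/-- Compatibility of the connection with the inverse metric: insert `pd_metric` into `pd_inv_eq` and
contract each `G` against a `G⁻¹`. -/
theorem pd_inv (hG : IsMetricOn G Ω) (hy : y ∈ Ω) (k i j : Fin n) :
    pd k (fun z => (G z)⁻¹ i j) y
      = -∑ l, coordChris G i k l y * (G y)⁻¹ l j - ∑ l, coordChris G j k l y * (G y)⁻¹ l i := by
  rw [hG.pd_inv_eq hy]
  have e1 : ∀ a b, (G y)⁻¹ i a * pd k (fun z => G z a b) y * (G y)⁻¹ b j
      = (∑ l, (G y)⁻¹ i a * coordChris G l k a y * (G y b l * (G y)⁻¹ b j))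
        + ∑ l, ((G y)⁻¹ i a * G y a l) * coordChris G l k b y * (G y)⁻¹ b j := by
    intro a b
    rw [hG.pd_metric hy, mul_add, add_mul, Finset.mul_sum, Finset.mul_sum, Finset.sum_mul,
      Finset.sum_mul]
    congr 1 <;> exact Finset.sum_congr rfl fun l _ => by ring
  simp only [e1, Finset.sum_add_distrib]
  have e2 : ∑ a, ∑ b, ∑ l, (G y)⁻¹ i a * coordChris G l k a y * (G y b l * (G y)⁻¹ b j)
      = ∑ l, coordChris G j k l y * (G y)⁻¹ l i := by
    refine Finset.sum_congr rfl fun a _ => ?_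
    rw [Finset.sum_comm]
    have : ∀ l, ∑ b, (G y)⁻¹ i a * coordChris G l k a y * (G y b l * (G y)⁻¹ b j)
        = (G y)⁻¹ i a * coordChris G l k a y * (if l = j then 1 else 0) := by
      intro l
      rw [← hG.sum_mul_inv hy, Finset.mul_sum]
      exact Finset.sum_congr rfl fun b _ => by rw [hG.symm hy b l]
    rw [Finset.sum_congr rfl fun l _ => this l]
    simp [hG.inv_symm hy i a, mul_comm]
  have e3 : ∑ a, ∑ b, ∑ l, ((G y)⁻¹ i a * G y a l) * coordChris G l k b y * (G y)⁻¹ b j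
      = ∑ l, coordChris G i k l y * (G y)⁻¹ l j := by
    rw [Finset.sum_comm]
    refine Finset.sum_congr rfl fun b _ => ?_
    rw [Finset.sum_comm]
    have : ∀ l, ∑ a, (G y)⁻¹ i a * G y a l * coordChris G l k b y * (G y)⁻¹ b j
        = (if i = l then 1 else 0) * (coordChris G l k b y * (G y)⁻¹ b j) := by
      intro l
      rw [← hG.sum_inv_mul hy, Finset.sum_mul]
      exact Finset.sum_congr rfl fun b _ => by ring
    rw [Finset.sum_congr rfl fun l _ => this l]
    simp
  rw [e2, e3]; ring

/-- By Jacobi's formula and metric compatibility the logarithmic derivative of `det G` is twice the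
contracted Christoffel symbol; the square root removes the factor two. This is what makes the
divergence form of the Laplacian covariant. -/
theorem pd_coordDens (hG : IsMetricOn G Ω) (hy : y ∈ Ω) (i : Fin n) :
    pd i (coordDens G) y = coordDens G y * ∑ j, coordChris G j i j y := by
  have hd' := fun a b => hG.diff (hG.smooth a b) hy
  have hdet := hasFDerivAt_det hd' (EuclideanSpace.single i 1)
  have h1 : pd i (fun z => (G z).det) y = (G y).det * (2 * ∑ j, coordChris G j i j y) := by
    change fderiv ℝ _ y _ = _
    rw [hdet.2]
    have hadj : ∀ a b, (G y).adjugate b a = (G y).det * (G y)⁻¹ b a := by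
      intro a b
      rw [Matrix.inv_def]
      simp [Ring.inverse_eq_inv, (hG.det_pos hy).ne']
    have hpd : ∀ a b, fderiv ℝ (fun z => G z a b) y (EuclideanSpace.single i 1)
      = pd i (fun z => G z a b) y := fun a b => rfl
    simp only [hadj, hpd, hG.pd_metric hy, mul_assoc, ← Finset.mul_sum]
    congr 1
    simp only [mul_add, Finset.sum_add_distrib, Finset.mul_sum]
    have e1 : ∑ a, ∑ b, ∑ l, (G y)⁻¹ b a * (G y b l * coordChris G l i a y)
        = ∑ j, coordChris G j i j y := by
      refine Finset.sum_congr rfl fun a _ => ?_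
      rw [Finset.sum_comm]
      have : ∀ l, ∑ b, (G y)⁻¹ b a * (G y b l * coordChris G l i a y)
          = (if a = l then 1 else 0) * coordChris G l i a y := by
        intro l
        rw [← hG.sum_inv_mul hy, Finset.sum_mul]
        exact Finset.sum_congr rfl fun b _ => by rw [hG.inv_symm hy b a]; ring
      rw [Finset.sum_congr rfl fun l _ => this l]
      simp
    have e2 : ∑ a, ∑ b, ∑ l, (G y)⁻¹ b a * (G y a l * coordChris G l i b y)
        = ∑ j, coordChris G j i j y := by
      rw [Finset.sum_comm, ← e1]
      refine Finset.sum_congr rfl fun a _ => Finset.sum_congr rfl fun b _ =>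
        Finset.sum_congr rfl fun l _ => by rw [hG.inv_symm hy b a]
    rw [e1, e2, ← Finset.mul_sum]; ring
  rw [pd_congr hG.isOpen hy i (fun z hz => hG.coordDens_eq hz), pd_comp i
    (Real.hasDerivAt_sqrt (hG.det_pos hy).ne').differentiableAt hdet.1, h1,
    (Real.hasDerivAt_sqrt (hG.det_pos hy).ne').deriv, hG.coordDens_eq hy]
  have hs := Real.sqrt_pos.2 (hG.det_pos hy)
  have hs2 := Real.mul_self_sqrt (hG.det_pos hy).le
  field_simp
  rw [show √(G y).det ^ 2 = √(G y).det * √(G y).det from sq _, hs2]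

/-- The Laplacian as the divergence of the gradient. -/
theorem coordLap_eq (hG : IsMetricOn G Ω) (hf : ContDiffOn ℝ ∞ f Ω) (hy : y ∈ Ω) :
    coordLap G f y = ∑ i, pd i (gradVec G f i) y
      + ∑ i, (∑ j, coordChris G j i j y) * gradVec G f i y := by
  have hs := hG.coordDens_pos hy
  have h1 : ∀ i, pd i (fun z => ∑ j, coordDens G z * (G z)⁻¹ i j * pd j f z) y
      = coordDens G y * (pd i (gradVec G f i) y
        + (∑ j, coordChris G j i j y) * gradVec G f i y) := by
    intro i
    have : (fun z => ∑ j, coordDens G z * (G z)⁻¹ i j * pd j f z)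
        = fun z => coordDens G z * gradVec G f i z := by
      funext z; simp only [gradVec, Finset.mul_sum, mul_assoc]
    rw [this, pd_mul i (hG.diff hG.contDiffOn_coordDens hy)
      (hG.diff (hG.contDiffOn_gradVec hf i) hy), hG.pd_coordDens hy]
    ring
  rw [coordLap, Finset.sum_congr rfl fun i _ => h1 i, ← Finset.mul_sum, ← mul_assoc,
    inv_mul_cancel₀ hs.ne', one_mul, Finset.sum_add_distrib]

/-- The covariant derivative of the gradient is the Hessian with one index raised. -/
theorem pd_gradVec (hG : IsMetricOn G Ω) (hf : ContDiffOn ℝ ∞ f Ω) (hy : y ∈ Ω) (i j : Fin n) :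
    pd j (gradVec G f i) y + ∑ k, coordChris G i j k y * gradVec G f k y
      = ∑ l, (G y)⁻¹ i l * coordHess G f l j y := by
  have hd := fun a => hG.diff (contDiffOn_pd hG.isOpen hf a) hy
  have hdi := fun a b => hG.diff (hG.contDiffOn_inv a b) hy
  have h1 : pd j (gradVec G f i) y
      = ∑ l, (pd j (fun z => (G z)⁻¹ i l) y * pd l f y + (G y)⁻¹ i l * pd j (pd l f) y) := by
    change pd j (fun z => ∑ l, (G z)⁻¹ i l * pd l f z) y = _
    rw [pd_sum _ _ _ fun l _ => (hdi i l).fun_mul (hd l)]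
    exact Finset.sum_congr rfl fun l _ => pd_mul j (hdi i l) (hd l)
  rw [h1, Finset.sum_add_distrib]
  simp only [hG.pd_inv hy, coordHess, mul_sub, Finset.sum_sub_distrib, sub_mul, neg_mul,
    Finset.sum_neg_distrib, Finset.sum_mul, Finset.mul_sum, gradVec]
  have e1 : ∑ l, ∑ m, coordChris G i j m y * (G y)⁻¹ m l * pd l f y
      = ∑ k, ∑ l, coordChris G i j k y * ((G y)⁻¹ k l * pd l f y) := by
    rw [Finset.sum_comm]
    simp only [mul_assoc]
  have e2 : ∑ l, ∑ m, coordChris G l j m y * (G y)⁻¹ m i * pd l f y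
      = ∑ l, ∑ k, (G y)⁻¹ i l * (coordChris G k l j y * pd k f y) := by
    rw [Finset.sum_comm]
    refine Finset.sum_congr rfl fun a _ => Finset.sum_congr rfl fun b _ => ?_
    rw [hG.chris_symm hy b a j, hG.inv_symm hy i a]; ring
  rw [e1, e2]
  simp only [pd_comm hG.isOpen hf hy j]
  ring

theorem coordGrad_eq (hG : IsMetricOn G Ω) (hy : y ∈ Ω) : coordGrad G f h y = ∑ i, gradVec G f i y * pd i h y := by
  simp only [coordGrad, gradVec, Finset.sum_mul]
  rw [Finset.sum_comm]
  refine Finset.sum_congr rfl fun i _ => Finset.sum_congr rfl fun j _ => ?_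
  rw [hG.inv_symm hy j i]

theorem coordGrad_comm (hG : IsMetricOn G Ω) (hy : y ∈ Ω) : coordGrad G f h y = coordGrad G h f y := by
  simp only [coordGrad]
  rw [Finset.sum_comm]
  refine Finset.sum_congr rfl fun i _ => Finset.sum_congr rfl fun j _ => ?_
  rw [hG.inv_symm hy j i]; ring

/-- The product rule for a metric connection. One factor is differentiated as a vector, the other as
a covector, and their Christoffel terms cancel (`e1` below). -/
theorem pd_coordGrad (hG : IsMetricOn G Ω) (hf : ContDiffOn ℝ ∞ f Ω) (hh : ContDiffOn ℝ ∞ h Ω) (hy : y ∈ Ω)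
    (j : Fin n) :
    pd j (coordGrad G f h) y
      = ∑ i, coordHess G f i j y * gradVec G h i y + ∑ i, coordHess G h i j y * gradVec G f i y := by
  have hd := fun a => hG.diff (contDiffOn_pd hG.isOpen hh a) hy
  have hg := fun a => hG.diff (hG.contDiffOn_gradVec hf a) hy
  rw [pd_congr hG.isOpen hy j fun z hz => hG.coordGrad_eq hz,
    pd_sum _ _ _ fun l _ => (hg l).fun_mul (hd l)]
  have h1 : ∀ i, pd j (fun z => gradVec G f i z * pd i h z) y
      = (∑ l, (G y)⁻¹ i l * coordHess G f l j y) * pd i h y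
        + gradVec G f i y * coordHess G h j i y
        + (gradVec G f i y * (∑ k, coordChris G k j i y * pd k h y)
          - (∑ k, coordChris G i j k y * gradVec G f k y) * pd i h y) := by
    intro i
    rw [pd_mul j (hg i) (hd i), ← hG.pd_gradVec hf hy i j, coordHess]
    ring
  rw [Finset.sum_congr rfl fun i _ => h1 i]
  simp only [Finset.sum_add_distrib, Finset.sum_sub_distrib]
  have e1 : ∑ i, gradVec G f i y * (∑ k, coordChris G k j i y * pd k h y)
      = ∑ i, (∑ k, coordChris G i j k y * gradVec G f k y) * pd i h y := by
    simp only [Finset.sum_mul, Finset.mul_sum]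
    rw [Finset.sum_comm]
    exact Finset.sum_congr rfl fun a _ => Finset.sum_congr rfl fun b _ => by ring
  have e2 : ∑ i, (∑ l, (G y)⁻¹ i l * coordHess G f l j y) * pd i h y
      = ∑ i, coordHess G f i j y * gradVec G h i y := by
    simp only [gradVec, Finset.sum_mul, Finset.mul_sum]
    rw [Finset.sum_comm]
    refine Finset.sum_congr rfl fun a _ => Finset.sum_congr rfl fun b _ => ?_
    rw [hG.inv_symm hy b a]; ring
  rw [e1, e2, sub_self, add_zero]
  congr 1
  exact Finset.sum_congr rfl fun i _ => by rw [hG.hess_symm hh hy j i]; ring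

end IsMetricOn

end Coordinates

/-! ### Linear algebra: Cauchy–Schwarz and the Hilbert–Schmidt norm for a positive definite form. -/

section QuadraticForms

variable {n : ℕ}

open scoped MatrixOrder in
-- Passing to `P v` reduces statements about the form `H` to the standard scalar product.
theorem PosDef.exists_transpose_mul {H : Matrix (Fin n) (Fin n) ℝ} (hH : H.PosDef) :
    ∃ P : Matrix (Fin n) (Fin n) ℝ, H = Pᵀ * P := by
  obtain ⟨P, hP⟩ := CStarAlgebra.nonneg_iff_eq_star_mul_self.mp hH.posSemidef.nonneg
  exact ⟨P, by simpa [Matrix.star_eq_conjTranspose] using hP⟩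

theorem dotProduct_sq_le (v w : Fin n → ℝ) : (v ⬝ᵥ w) ^ 2 ≤ (v ⬝ᵥ v) * (w ⬝ᵥ w) := by
  simpa [dotProduct, sq] using Finset.sum_mul_sq_le_sq_mul_sq Finset.univ v w

theorem PosDef.dotProduct_mulVec_sq_le {H : Matrix (Fin n) (Fin n) ℝ} (hH : H.PosDef)
    (v w : Fin n → ℝ) :
    (v ⬝ᵥ (H *ᵥ w)) ^ 2 ≤ (v ⬝ᵥ (H *ᵥ v)) * (w ⬝ᵥ (H *ᵥ w)) := by
  obtain ⟨P, rfl⟩ := PosDef.exists_transpose_mul hH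
  have key : ∀ a b : Fin n → ℝ, a ⬝ᵥ ((Pᵀ * P) *ᵥ b) = (P *ᵥ a) ⬝ᵥ (P *ᵥ b) := by
    intro a b
    rw [← Matrix.mulVec_mulVec, Matrix.dotProduct_mulVec, Matrix.vecMul_transpose]
  simp only [key]
  exact dotProduct_sq_le _ _

/-- The Hilbert–Schmidt norm of a symmetric form `S` for the scalar product dual to `H` dominates
its operator norm. -/
theorem PosDef.form_sq_le_trace_mul {H S : Matrix (Fin n) (Fin n) ℝ} (hH : H.PosDef)
    (hS : Sᵀ = S) :
    0 ≤ (H * S * (H * S)).trace ∧ ∀ v w : Fin n → ℝ,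
      ((H *ᵥ v) ⬝ᵥ (S *ᵥ (H *ᵥ w))) ^ 2
        ≤ (H * S * (H * S)).trace * ((v ⬝ᵥ (H *ᵥ v)) * (w ⬝ᵥ (H *ᵥ w))) := by
  obtain ⟨P, rfl⟩ := PosDef.exists_transpose_mul hH
  -- `M` is the form `S` in an orthonormal frame. It is symmetric, so the trace is the sum of the
  -- squares of its entries, and the claim is Cauchy–Schwarz applied twice.
  set M := P * S * Pᵀ with hM
  have hMs : Mᵀ = M := by simp [hM, Matrix.transpose_mul, hS, Matrix.mul_assoc]
  have htr : (Pᵀ * P * S * (Pᵀ * P * S)).trace = ∑ i, ∑ j, M i j ^ 2 := by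
    have h1 : Pᵀ * P * S * (Pᵀ * P * S) = Pᵀ * (M * (P * S)) := by
      simp only [hM, Matrix.mul_assoc]
    rw [h1, Matrix.trace_mul_comm, show M * (P * S) * Pᵀ = M * M by simp only [hM, Matrix.mul_assoc]]
    rw [Matrix.trace]
    refine Finset.sum_congr rfl fun i _ => ?_
    rw [Matrix.diag_apply, Matrix.mul_apply]
    refine Finset.sum_congr rfl fun j _ => ?_
    rw [show M j i = M i j from congrFun (congrFun hMs i) j, sq]
  have key : ∀ a b : Fin n → ℝ, a ⬝ᵥ ((Pᵀ * P) *ᵥ b) = (P *ᵥ a) ⬝ᵥ (P *ᵥ b) := by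
    intro a b
    rw [← Matrix.mulVec_mulVec, Matrix.dotProduct_mulVec, Matrix.vecMul_transpose]
  rw [htr]
  refine ⟨Finset.sum_nonneg fun i _ => Finset.sum_nonneg fun j _ => sq_nonneg _, fun v w => ?_⟩
  have h2 : ((Pᵀ * P) *ᵥ v) ⬝ᵥ (S *ᵥ ((Pᵀ * P) *ᵥ w)) = (P *ᵥ v) ⬝ᵥ (M *ᵥ (P *ᵥ w)) := by
    simp only [hM, ← Matrix.mulVec_mulVec]
    rw [Matrix.mulVec_transpose, ← Matrix.dotProduct_mulVec]
  rw [h2, key, key]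
  set a := P *ᵥ v
  set b := P *ᵥ w
  have h3 : (M *ᵥ b) ⬝ᵥ (M *ᵥ b) ≤ (∑ i, ∑ j, M i j ^ 2) * (b ⬝ᵥ b) := by
    rw [dotProduct, Finset.sum_mul]
    refine Finset.sum_le_sum fun i _ => ?_
    have := dotProduct_sq_le (M i) b
    simpa [Matrix.mulVec, dotProduct, sq] using this
  calc (a ⬝ᵥ (M *ᵥ b)) ^ 2 ≤ (a ⬝ᵥ a) * ((M *ᵥ b) ⬝ᵥ (M *ᵥ b)) := dotProduct_sq_le _ _
    _ ≤ (a ⬝ᵥ a) * ((∑ i, ∑ j, M i j ^ 2) * (b ⬝ᵥ b)) := by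
        refine mul_le_mul_of_nonneg_left h3 ?_
        exact Finset.sum_nonneg fun i _ => mul_self_nonneg _
    _ = _ := by ring

end QuadraticForms

/-! ### Chain rules for gradient and Laplacian, and Bochner's formula. -/

namespace IsMetricOn

variable {n : ℕ} {G : Model n → Matrix (Fin n) (Fin n) ℝ} {Ω : Set (Model n)}
  {y : Model n} {f h : Model n → ℝ}

theorem gradVec_mul (hG : IsMetricOn G Ω) (hf : ContDiffOn ℝ ∞ f Ω) (hh : ContDiffOn ℝ ∞ h Ω)
    (hy : y ∈ Ω) (i : Fin n) :
    gradVec G (fun z => f z * h z) i y = h y * gradVec G f i y + f y * gradVec G h i y := by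
  simp only [gradVec, pd_mul _ (hG.diff hf hy) (hG.diff hh hy), Finset.mul_sum,
    ← Finset.sum_add_distrib]
  exact Finset.sum_congr rfl fun j _ => by ring

theorem gradVec_comp (hG : IsMetricOn G Ω) {φ : ℝ → ℝ} (hφ : DifferentiableAt ℝ φ (f y))
    (hf : ContDiffOn ℝ ∞ f Ω) (hy : y ∈ Ω) (i : Fin n) :
    gradVec G (fun z => φ (f z)) i y = deriv φ (f y) * gradVec G f i y := by
  simp only [gradVec, pd_comp _ hφ (hG.diff hf hy), Finset.mul_sum]
  exact Finset.sum_congr rfl fun j _ => by ring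

theorem coordLap_mul (hG : IsMetricOn G Ω) (hf : ContDiffOn ℝ ∞ f Ω) (hh : ContDiffOn ℝ ∞ h Ω)
    (hy : y ∈ Ω) :
    coordLap G (fun z => f z * h z) y
      = f y * coordLap G h y + h y * coordLap G f y + 2 * coordGrad G f h y := by
  have hdf := hG.diff hf hy
  have hdh := hG.diff hh hy
  have hgf := fun i => hG.diff (hG.contDiffOn_gradVec hf i) hy
  have hgh := fun i => hG.diff (hG.contDiffOn_gradVec hh i) hy
  rw [hG.coordLap_eq (hf.mul hh) hy, hG.coordLap_eq hf hy, hG.coordLap_eq hh hy, two_mul]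
  nth_rw 2 [hG.coordGrad_comm hy]
  rw [hG.coordGrad_eq hy, hG.coordGrad_eq hy]
  have h1 : ∀ i, pd i (gradVec G (fun z => f z * h z) i) y
      = pd i h y * gradVec G f i y + h y * pd i (gradVec G f i) y
        + (pd i f y * gradVec G h i y + f y * pd i (gradVec G h i) y) := by
    intro i
    rw [pd_congr hG.isOpen hy i fun z hz => hG.gradVec_mul hf hh hz i,
      pd_add i (hdh.fun_mul (hgf i)) (hdf.fun_mul (hgh i)), pd_mul i hdh (hgf i),
      pd_mul i hdf (hgh i)]
  simp only [h1, hG.gradVec_mul hf hh hy, mul_add, Finset.mul_sum, ← Finset.sum_add_distrib]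
  exact Finset.sum_congr rfl fun i _ => by ring

/-- Smoothness of `φ` is only asked on an open set containing the values of `f`, which admits `log`
and `r log r` for positive `f`. -/
theorem coordLap_comp (hG : IsMetricOn G Ω) {φ : ℝ → ℝ} {U : Set ℝ} (hU : IsOpen U)
    (hφ : ContDiffOn ℝ ∞ φ U) (hf : ContDiffOn ℝ ∞ f Ω) (hfU : ∀ z ∈ Ω, f z ∈ U) (hy : y ∈ Ω) :
    coordLap G (fun z => φ (f z)) y
      = deriv φ (f y) * coordLap G f y + deriv (deriv φ) (f y) * coordGrad G f f y := by
  have hdf := hG.diff hf hy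
  have hgf := fun i => hG.diff (hG.contDiffOn_gradVec hf i) hy
  have hd : ∀ z ∈ Ω, DifferentiableAt ℝ φ (f z) := fun z hz =>
    (hφ.contDiffAt (hU.mem_nhds (hfU z hz))).differentiableAt (by simp)
  have hφ' : ContDiffOn ℝ ∞ (deriv φ) U := hφ.deriv_of_isOpen hU (by simp)
  have hd' : DifferentiableAt ℝ (deriv φ) (f y) :=
    (hφ'.contDiffAt (hU.mem_nhds (hfU y hy))).differentiableAt (by simp)
  have hφf' : DifferentiableAt ℝ (fun z => deriv φ (f z)) y := hd'.comp y hdf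
  have hc : ContDiffOn ℝ ∞ (fun z => φ (f z)) Ω := hφ.comp hf hfU
  rw [hG.coordLap_eq hc hy, hG.coordLap_eq hf hy, hG.coordGrad_eq hy]
  have h1 : ∀ i, pd i (gradVec G (fun z => φ (f z)) i) y
      = deriv (deriv φ) (f y) * pd i f y * gradVec G f i y
        + deriv φ (f y) * pd i (gradVec G f i) y := by
    intro i
    rw [pd_congr hG.isOpen hy i fun z hz => hG.gradVec_comp (hd z hz) hf hz i,
      pd_mul i hφf' (hgf i), pd_comp i hd' hdf]
  have h2 : ∀ i, gradVec G (fun z => φ (f z)) i y = deriv φ (f y) * gradVec G f i y :=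
    fun i => hG.gradVec_comp (hd y hy) hf hy i
  simp only [h1, h2, mul_add, Finset.mul_sum, ← Finset.sum_add_distrib]
  exact Finset.sum_congr rfl fun i _ => by ring

theorem coordGrad_eq_dotProduct (G : Model n → Matrix (Fin n) (Fin n) ℝ) (f h : Model n → ℝ)
    (y : Model n) :
    coordGrad G f h y = (fun i => pd i f y) ⬝ᵥ ((G y)⁻¹ *ᵥ fun i => pd i h y) := by
  simp only [coordGrad, dotProduct, Matrix.mulVec, Finset.mul_sum]
  exact Finset.sum_congr rfl fun i _ => Finset.sum_congr rfl fun j _ => by ring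

theorem coordGrad_sq_le (hG : IsMetricOn G Ω) (hy : y ∈ Ω) (f h : Model n → ℝ) :
    coordGrad G f h y ^ 2 ≤ coordGrad G f f y * coordGrad G h h y := by
  simp only [coordGrad_eq_dotProduct]
  exact PosDef.dotProduct_mulVec_sq_le (hG.posDef y hy).inv _ _

theorem coordGrad_self_nonneg (hG : IsMetricOn G Ω) (hy : y ∈ Ω) (f : Model n → ℝ) :
    0 ≤ coordGrad G f f y := by
  rw [coordGrad_eq_dotProduct]
  simpa using (hG.posDef y hy).inv.posSemidef.dotProduct_mulVec_nonneg (fun i => pd i f y)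

/-- The trace of the square of the Hessian, that is, its squared Hilbert–Schmidt norm. -/
def hessNormSq (G : Model n → Matrix (Fin n) (Fin n) ℝ) (f : Model n → ℝ) (y : Model n) : ℝ :=
  ∑ i, ∑ k, (∑ l, (G y)⁻¹ i l * coordHess G f l k y) * (∑ l, (G y)⁻¹ k l * coordHess G f l i y)

theorem hessNormSq_eq_trace (G : Model n → Matrix (Fin n) (Fin n) ℝ) (f : Model n → ℝ)
    (y : Model n) :
    hessNormSq G f y = ((G y)⁻¹ * (Matrix.of fun i j => coordHess G f i j y) *
      ((G y)⁻¹ * (Matrix.of fun i j => coordHess G f i j y))).trace := by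
  simp [hessNormSq, Matrix.trace, Matrix.mul_apply]

theorem hessNormSq_nonneg (hG : IsMetricOn G Ω) (hf : ContDiffOn ℝ ∞ f Ω) (hy : y ∈ Ω) :
    0 ≤ hessNormSq G f y := by
  rw [hessNormSq_eq_trace]
  exact (PosDef.form_sq_le_trace_mul (hG.posDef y hy).inv
    (by ext i j; exact hG.hess_symm hf hy j i)).1

/-- The gradient of `|∇ f|²` is controlled by the Hessian of `f`. -/
theorem coordGrad_gradSq_sq_le (hG : IsMetricOn G Ω) (hf : ContDiffOn ℝ ∞ f Ω) (hy : y ∈ Ω)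
    (h : Model n → ℝ) :
    coordGrad G (coordGrad G f f) h y ^ 2
      ≤ 4 * hessNormSq G f y * (coordGrad G f f y * coordGrad G h h y) := by
  have h0 := (PosDef.form_sq_le_trace_mul (hG.posDef y hy).inv
    (S := Matrix.of fun i j => coordHess G f i j y)
    (by ext i j; exact hG.hess_symm hf hy j i)).2 (fun i => pd i f y) (fun i => pd i h y)
  rw [← hessNormSq_eq_trace, ← coordGrad_eq_dotProduct, ← coordGrad_eq_dotProduct] at h0
  -- The differential of `(∇f)²` is `2 Hess f (∇f, ·)`, which brings the claim to the operator-norm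
  -- bound for the Hessian.
  have h1 : coordGrad G (coordGrad G f f) h y = 2 * (((G y)⁻¹ *ᵥ fun i => pd i f y) ⬝ᵥ
      ((Matrix.of fun i j => coordHess G f i j y) *ᵥ ((G y)⁻¹ *ᵥ fun i => pd i h y))) := by
    rw [hG.coordGrad_comm hy, hG.coordGrad_eq hy]
    simp only [hG.pd_coordGrad hf hf hy, dotProduct, Matrix.mulVec, ← two_mul]
    simp only [← gradVec.eq_1, Matrix.of_apply, Finset.mul_sum]
    rw [Finset.sum_comm]
    exact Finset.sum_congr rfl fun i _ => Finset.sum_congr rfl fun j _ => by ring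
  rw [h1]
  nlinarith [h0]

/-- Commuting covariant derivatives produces the Ricci tensor. -/
theorem sum_pd_hess (hG : IsMetricOn G Ω) (hf : ContDiffOn ℝ ∞ f Ω) (hy : y ∈ Ω) (k : Fin n) :
    ∑ i, pd i (fun z => ∑ l, (G z)⁻¹ i l * coordHess G f l k z) y
      = ∑ i, pd k (fun z => ∑ l, (G z)⁻¹ i l * coordHess G f l i z) y
        + ∑ l, coordRic G l k y * gradVec G f l y
        - ∑ i, (∑ j, coordChris G j i j y) * (∑ l, (G y)⁻¹ i l * coordHess G f l k y)
        + ∑ i, ∑ m, coordChris G m i k y * (∑ l, (G y)⁻¹ i l * coordHess G f l m y) := by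
  have hga := fun i => hG.contDiffOn_gradVec hf i
  have hda := fun i => hG.diff (hga i) hy
  have hdda := fun i j => hG.diff (contDiffOn_pd hG.isOpen (hga i) j) hy
  have hdc := fun i j k => hG.diff (hG.contDiffOn_chris i j k) hy
  -- The raised Hessian is the covariant derivative `∂_m a^i + Γ^i_{ml} a^l` of the gradient `a`. In
  -- the commutator the second derivatives of `a` drop out, and the terms in `∂Γ` and `ΓΓ` assemble
  -- into the Ricci tensor; `e0` to `e6` only match indices.
  have hB : ∀ j i m, pd j (fun z => ∑ l, (G z)⁻¹ i l * coordHess G f l m z) y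
      = pd j (pd m (gradVec G f i)) y + ∑ l, (pd j (coordChris G i m l) y * gradVec G f l y
        + coordChris G i m l y * pd j (gradVec G f l) y) := by
    intro j i m
    rw [pd_congr hG.isOpen hy j fun z hz => (hG.pd_gradVec hf hz i m).symm,
      pd_add j (hdda i m) (DifferentiableAt.fun_sum fun l _ => (hdc i m l).fun_mul (hda l)),
      pd_sum _ _ _ fun l _ => (hdc i m l).fun_mul (hda l)]
    congr 1
    exact Finset.sum_congr rfl fun l _ => pd_mul j (hdc i m l) (hda l)
  simp only [hB, ← hG.pd_gradVec hf hy, coordRic]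
  simp only [Finset.sum_add_distrib, mul_add, add_mul, sub_mul, Finset.sum_mul, Finset.mul_sum,
    Finset.sum_sub_distrib]
  have e0 : ∑ i, pd i (pd k (gradVec G f i)) y = ∑ i, pd k (pd i (gradVec G f i)) y :=
    Finset.sum_congr rfl fun i _ => pd_comm hG.isOpen (hga i) hy i k
  have e1 : ∑ i, ∑ l, pd i (coordChris G i k l) y * gradVec G f l y
      = ∑ l, ∑ i, pd i (coordChris G i l k) y * gradVec G f l y := by
    rw [Finset.sum_comm]
    refine Finset.sum_congr rfl fun l _ => Finset.sum_congr rfl fun i _ => ?_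
    rw [pd_congr hG.isOpen hy i fun z hz => hG.chris_symm hz i k l]
  have e2 : ∑ i, ∑ l, pd k (coordChris G i i l) y * gradVec G f l y
      = ∑ l, ∑ i, pd k (coordChris G i l i) y * gradVec G f l y := by
    rw [Finset.sum_comm]
    refine Finset.sum_congr rfl fun l _ => Finset.sum_congr rfl fun i _ => ?_
    rw [pd_congr hG.isOpen hy k fun z hz => hG.chris_symm hz i i l]
  have e3 : ∑ i, ∑ l, coordChris G i k l y * pd i (gradVec G f l) y
      = ∑ i, ∑ m, coordChris G m i k y * pd m (gradVec G f i) y := by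
    rw [Finset.sum_comm]
    refine Finset.sum_congr rfl fun l _ => Finset.sum_congr rfl fun i _ => ?_
    rw [hG.chris_symm hy i k l]
  have e4 : ∑ i, ∑ l, coordChris G i i l y * pd k (gradVec G f l) y
      = ∑ i, ∑ j, coordChris G j i j y * pd k (gradVec G f i) y := by
    rw [Finset.sum_comm]
    refine Finset.sum_congr rfl fun l _ => Finset.sum_congr rfl fun i _ => ?_
    rw [hG.chris_symm hy i i l]
  have e5 : ∑ i, ∑ l, ∑ j, coordChris G j i j y * (coordChris G i k l y * gradVec G f l y)
      = ∑ l, ∑ i, ∑ m, coordChris G i i m y * coordChris G m l k y * gradVec G f l y := by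
    rw [Finset.sum_comm]
    refine Finset.sum_congr rfl fun l _ => ?_
    rw [Finset.sum_comm]
    refine Finset.sum_congr rfl fun j _ => Finset.sum_congr rfl fun i _ => ?_
    rw [hG.chris_symm hy j i j, hG.chris_symm hy i k l]; ring
  have e6 : ∑ i, ∑ m, ∑ l, coordChris G m i k y * (coordChris G i m l y * gradVec G f l y)
      = ∑ l, ∑ i, ∑ m, coordChris G i k m y * coordChris G m l i y * gradVec G f l y := by
    have : ∀ i m l, coordChris G m i k y * (coordChris G i m l y * gradVec G f l y)
        = coordChris G m k i y * coordChris G i l m y * gradVec G f l y := by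
      intro i m l
      rw [hG.chris_symm hy m i k, hG.chris_symm hy i m l]; ring
    simp only [this]
    rw [Finset.sum_congr rfl fun i _ => Finset.sum_comm, Finset.sum_comm]
    exact Finset.sum_congr rfl fun l _ => Finset.sum_comm
  rw [e0, e1, e2, e3, e4, e5, e6]
  ring

/-- **Bochner's formula** in coordinates. -/
theorem bochner (hG : IsMetricOn G Ω) (hf : ContDiffOn ℝ ∞ f Ω) (hy : y ∈ Ω) :
    coordLap G (coordGrad G f f) y = 2 * hessNormSq G f y + 2 * coordGrad G f (coordLap G f) y
      + 2 * ∑ k, ∑ l, coordRic G l k y * gradVec G f l y * gradVec G f k y := by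
  have hB : ∀ i k, ContDiffOn ℝ ∞ (fun z => ∑ l, (G z)⁻¹ i l * coordHess G f l k z) Ω :=
    fun i k => ContDiffOn.sum fun l _ => (hG.contDiffOn_inv i l).mul (hG.contDiffOn_hess hf l k)
  have hdB := fun i k => hG.diff (hB i k) hy
  have hda := fun i => hG.diff (hG.contDiffOn_gradVec hf i) hy
  -- The gradient of `(∇f)²` is twice the raised Hessian applied to `∇f`. Its divergence therefore
  -- contains `|Hess f|²` and a derivative of the Hessian.
  have hgq : ∀ z ∈ Ω, ∀ i, gradVec G (coordGrad G f f) i z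
      = 2 * ∑ k, (∑ l, (G z)⁻¹ i l * coordHess G f l k z) * gradVec G f k z := by
    intro z hz i
    rw [gradVec]
    simp only [hG.pd_coordGrad hf hf hz, ← two_mul, Finset.mul_sum, Finset.sum_mul]
    rw [Finset.sum_comm]
    refine Finset.sum_congr rfl fun k _ => Finset.sum_congr rfl fun j _ => ?_
    rw [hG.hess_symm hf hz k j]; ring
  -- The Laplacian is the trace of the raised Hessian.
  have hlap : ∀ z ∈ Ω, coordLap G f z = ∑ i, ∑ l, (G z)⁻¹ i l * coordHess G f l i z := by
    intro z hz
    rw [hG.coordLap_eq hf hz]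
    simp only [← hG.pd_gradVec hf hz, Finset.sum_add_distrib, Finset.sum_mul]
    congr 1
    rw [Finset.sum_comm]
    refine Finset.sum_congr rfl fun k _ => Finset.sum_congr rfl fun j _ => ?_
    rw [hG.chris_symm hz k j k]
  have hp : ∀ i, pd i (gradVec G (coordGrad G f f) i) y
      = 2 * ∑ k, (pd i (fun z => ∑ l, (G z)⁻¹ i l * coordHess G f l k z) y * gradVec G f k y
        + (∑ l, (G y)⁻¹ i l * coordHess G f l k y)
          * ((∑ l, (G y)⁻¹ k l * coordHess G f l i y)
            - ∑ m, coordChris G k i m y * gradVec G f m y)) := by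
    intro i
    rw [pd_congr hG.isOpen hy i fun z hz => hgq z hz i,
      pd_const_mul i 2 (DifferentiableAt.fun_sum fun k _ => (hdB i k).fun_mul (hda k)),
      pd_sum _ _ _ fun k _ => (hdB i k).fun_mul (hda k)]
    congr 1
    refine Finset.sum_congr rfl fun k _ => ?_
    rw [pd_mul i (hdB i k) (hda k), ← hG.pd_gradVec hf hy k i]
    ring
  have hl : ∀ k, pd k (coordLap G f) y
      = ∑ i, pd k (fun z => ∑ l, (G z)⁻¹ i l * coordHess G f l i z) y := by
    intro k
    rw [pd_congr hG.isOpen hy k hlap, pd_sum _ _ _ fun i _ => hdB i i]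
  rw [hG.coordLap_eq (hG.contDiffOn_coordGrad hf hf) hy, hG.coordGrad_eq hy]
  simp only [hp, hl, hgq y hy, hessNormSq]
  -- Contracting the commutation formula with `∇f` exchanges the divergence of the Hessian for `∇Δf`
  -- plus Ricci. The Christoffel corrections it carries cancel those left by the two divergences.
  have hR := fun k => hG.sum_pd_hess hf hy k
  set B : Fin n → Fin n → ℝ := fun i k => ∑ l, (G y)⁻¹ i l * coordHess G f l k y with hBdef
  set a : Fin n → ℝ := fun i => gradVec G f i y with ha
  set D : Fin n → Fin n → Fin n → ℝ := fun j i k =>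
    pd j (fun z => ∑ l, (G z)⁻¹ i l * coordHess G f l k z) y with hD
  have hR' : ∀ k, ∑ i, D i i k = ∑ i, D k i i + ∑ l, coordRic G l k y * a l
      - ∑ i, (∑ j, coordChris G j i j y) * B i k + ∑ i, ∑ m, coordChris G m i k y * B i m := hR
  change ∑ i, 2 * ∑ k, (D i i k * a k + B i k * (B k i - ∑ m, coordChris G k i m y * a m))
      + ∑ i, (∑ j, coordChris G j i j y) * (2 * ∑ k, B i k * a k)
    = 2 * ∑ i, ∑ k, B i k * B k i + 2 * ∑ k, a k * ∑ i, D k i i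
      + 2 * ∑ k, ∑ l, coordRic G l k y * a l * a k
  have hk : ∀ k, (∑ i, D i i k) * a k = (∑ i, D k i i + ∑ l, coordRic G l k y * a l
      - ∑ i, (∑ j, coordChris G j i j y) * B i k + ∑ i, ∑ m, coordChris G m i k y * B i m) * a k :=
    fun k => by rw [hR' k]
  have hs := Finset.sum_congr rfl fun k (_ : k ∈ (Finset.univ : Finset (Fin n))) => hk k
  have e1 : ∑ k, (∑ i, D i i k) * a k = ∑ i, ∑ k, D i i k * a k := by
    simp only [Finset.sum_mul]; rw [Finset.sum_comm]
  have e2 : ∑ k, (∑ i, (∑ j, coordChris G j i j y) * B i k) * a k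
      = ∑ i, (∑ j, coordChris G j i j y) * ∑ k, B i k * a k := by
    simp only [Finset.sum_mul _ _ (a _), Finset.mul_sum]
    rw [Finset.sum_comm]
    exact Finset.sum_congr rfl fun i _ => Finset.sum_congr rfl fun k _ => by ring
  have e3 : ∑ k, (∑ i, ∑ m, coordChris G m i k y * B i m) * a k
      = ∑ i, ∑ k, B i k * ∑ m, coordChris G k i m y * a m := by
    simp only [Finset.sum_mul, Finset.mul_sum]
    rw [Finset.sum_comm]
    refine Finset.sum_congr rfl fun i _ => ?_
    rw [Finset.sum_comm]
    exact Finset.sum_congr rfl fun k _ => Finset.sum_congr rfl fun m _ => by ring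
  have e4 : ∑ k, (∑ i, D k i i) * a k = ∑ k, a k * ∑ i, D k i i :=
    Finset.sum_congr rfl fun k _ => mul_comm _ _
  have e5 : ∑ k, (∑ l, coordRic G l k y * a l) * a k
      = ∑ k, ∑ l, coordRic G l k y * a l * a k := by
    simp only [Finset.sum_mul]
  have e6 : ∑ i, (∑ j, coordChris G j i j y) * (2 * ∑ k, B i k * a k)
      = 2 * ∑ i, (∑ j, coordChris G j i j y) * ∑ k, B i k * a k := by
    rw [Finset.mul_sum]; exact Finset.sum_congr rfl fun i _ => by ring
  simp only [add_mul, sub_mul, Finset.sum_add_distrib, Finset.sum_sub_distrib] at hs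
  rw [e1, e2, e3, e4, e5] at hs
  rw [e6, ← Finset.mul_sum]
  simp only [Finset.sum_add_distrib, mul_sub, Finset.sum_sub_distrib]
  linarith

end IsMetricOn

/-! ### Evolution of the squared gradient under a moving metric. -/

section TimeDependent

variable {n : ℕ}

/-- Again from `G⁻¹ G = 1`. Differentiability of `G⁻¹` has to be known beforehand and comes from the
adjugate formula. Invertibility is only assumed at time `t` and persists nearby by continuity of the
determinant. -/
theorem hasDerivAt_inv_entry {G : ℝ → Matrix (Fin n) (Fin n) ℝ} {G' : Matrix (Fin n) (Fin n) ℝ}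
    {t : ℝ} (hG : ∀ i j, HasDerivAt (fun s => G s i j) (G' i j) t)
    (hdet : IsUnit (G t).det) (i j : Fin n) :
    HasDerivAt (fun s => (G s)⁻¹ i j) (-((G t)⁻¹ * G' * (G t)⁻¹) i j) t := by
  have hdd : DifferentiableAt ℝ (fun s => (G s).det) t :=
    (hasFDerivAt_det (fun i j => (hG i j).differentiableAt) 1).1
  have hadj : ∀ i j, DifferentiableAt ℝ (fun s => (G s).adjugate i j) t := by
    intro i j
    simp only [Matrix.adjugate_apply]
    refine (hasFDerivAt_det (fun a b => ?_) 1).1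
    simp only [Matrix.updateRow_apply]
    split_ifs
    · exact differentiableAt_const _
    · exact (hG a b).differentiableAt
  have hinv : ∀ i j, DifferentiableAt ℝ (fun s => (G s)⁻¹ i j) t := by
    intro i j
    have h2 : DifferentiableAt ℝ (fun s => ((G s).det)⁻¹ * (G s).adjugate i j) t :=
      (hdd.inv hdet.ne_zero).mul (hadj i j)
    refine h2.congr_of_eventuallyEq (Eventually.of_forall fun s => ?_)
    simp [Matrix.inv_def, Ring.inverse_eq_inv]
  have hne : ∀ᶠ s in 𝓝 t, (G s).det ≠ 0 := hdd.continuousAt.eventually_ne hdet.ne_zero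
  let D : Matrix (Fin n) (Fin n) ℝ := Matrix.of fun a b => deriv (fun s => (G s)⁻¹ a b) t
  have h0 : D * G t + (G t)⁻¹ * G' = 0 := by
    ext a b
    have h1 : HasDerivAt (fun s => ∑ l, (G s)⁻¹ a l * G s l b)
        (∑ l, (D a l * G t l b + (G t)⁻¹ a l * G' l b)) t :=
      HasDerivAt.fun_sum fun l _ => (hinv a l).hasDerivAt.mul (hG l b)
    have h2 : (fun s => ∑ l, (G s)⁻¹ a l * G s l b) =ᶠ[𝓝 t]
        fun _ => (1 : Matrix (Fin n) (Fin n) ℝ) a b := by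
      filter_upwards [hne] with s hs
      rw [← Matrix.mul_apply, Matrix.nonsing_inv_mul _ hs.isUnit]
    have h3 := h1.unique ((hasDerivAt_const t _).congr_of_eventuallyEq h2)
    rw [Finset.sum_add_distrib] at h3
    simpa [Matrix.mul_apply] using h3
  have h1 : D = -((G t)⁻¹ * G' * (G t)⁻¹) := by
    have := congrArg (· * (G t)⁻¹) (eq_neg_of_add_eq_zero_left h0)
    simpa [Matrix.mul_assoc, Matrix.mul_nonsing_inv _ hdet] using this
  have := (hinv i j).hasDerivAt
  rwa [show deriv (fun s => (G s)⁻¹ i j) t = -((G t)⁻¹ * G' * (G t)⁻¹) i j from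
    congrFun (congrFun h1 i) j] at this

namespace IsMetricOn

variable {G : ℝ → Model n → Matrix (Fin n) (Fin n) ℝ} {Ω : Set (Model n)} {t : ℝ}
  {y : Model n} {u : ℝ → Model n → ℝ} {V u' : Model n → ℝ} {G' : Matrix (Fin n) (Fin n) ℝ}

/-- The derivative of the inverse metric is `-g⁻¹ ġ g⁻¹`, so the motion of the metric contributes
`-ġ(∇u, ∇u)`. This is the origin of `½ ġ` in the curvature condition. -/
theorem hasDerivAt_coordGrad_self (hG : IsMetricOn (G t) Ω) (hy : y ∈ Ω)
    (hG' : ∀ i j, HasDerivAt (fun s => G s y i j) (G' i j) t)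
    (hu' : ∀ i, HasDerivAt (fun s => pd i (u s) y) (pd i u' y) t) :
    HasDerivAt (fun s => coordGrad (G s) (u s) (u s) y)
      (2 * coordGrad (G t) (u t) u' y
        - ∑ i, ∑ j, G' i j * gradVec (G t) (u t) i y * gradVec (G t) (u t) j y) t := by
  have hi := hasDerivAt_inv_entry hG' (hG.det_pos hy).ne'.isUnit
  have h1 : HasDerivAt (fun s => coordGrad (G s) (u s) (u s) y)
      (∑ i, ∑ j, ((-((G t y)⁻¹ * G' * (G t y)⁻¹) i j * pd i (u t) y
        + (G t y)⁻¹ i j * pd i u' y) * pd j (u t) y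
        + (G t y)⁻¹ i j * pd i (u t) y * pd j u' y)) t :=
    HasDerivAt.fun_sum fun i _ => HasDerivAt.fun_sum fun j _ =>
      ((hi i j).mul (hu' i)).mul (hu' j)
  convert h1 using 1
  simp only [add_mul, Finset.sum_add_distrib]
  have e1 : ∑ i, ∑ j, (G t y)⁻¹ i j * pd i u' y * pd j (u t) y = coordGrad (G t) (u t) u' y := by
    rw [hG.coordGrad_comm hy]; rfl
  have e2 : ∑ i, ∑ j, (G t y)⁻¹ i j * pd i (u t) y * pd j u' y = coordGrad (G t) (u t) u' y := rfl
  have e3 : ∑ i, ∑ j, -((G t y)⁻¹ * G' * (G t y)⁻¹) i j * pd i (u t) y * pd j (u t) y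
      = -∑ i, ∑ j, G' i j * gradVec (G t) (u t) i y * gradVec (G t) (u t) j y := by
    set p : Fin n → ℝ := fun i => pd i (u t) y
    have hL : ∑ i, ∑ j, -((G t y)⁻¹ * G' * (G t y)⁻¹) i j * p i * p j
        = -(p ⬝ᵥ (((G t y)⁻¹ * G' * (G t y)⁻¹) *ᵥ p)) := by
      simp only [dotProduct, Matrix.mulVec, Finset.mul_sum, ← Finset.sum_neg_distrib]
      exact Finset.sum_congr rfl fun i _ => Finset.sum_congr rfl fun j _ => by ring
    have hR : ∑ i, ∑ j, G' i j * gradVec (G t) (u t) i y * gradVec (G t) (u t) j y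
        = ((G t y)⁻¹ *ᵥ p) ⬝ᵥ (G' *ᵥ ((G t y)⁻¹ *ᵥ p)) := by
      have hw : ∀ i, gradVec (G t) (u t) i y = ((G t y)⁻¹ *ᵥ p) i := fun i => rfl
      simp only [hw]
      generalize (G t y)⁻¹ *ᵥ p = w
      simp only [dotProduct, Matrix.mulVec, Finset.mul_sum]
      exact Finset.sum_congr rfl fun i _ => Finset.sum_congr rfl fun j _ => by ring
    rw [hL, hR, ← Matrix.mulVec_mulVec, ← Matrix.mulVec_mulVec, Matrix.dotProduct_mulVec,
      ← Matrix.mulVec_transpose]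
    rw [show (G t y)⁻¹ᵀ = (G t y)⁻¹ by ext i j; exact hG.inv_symm hy j i]
  rw [e1, e2, e3]; ring

/-- The curvature-dimension computation for a solution of the Hamilton–Jacobi type equation
`∂_t u = ½ Δ u - (∇ V, ∇ u) + ½ |∇ u|²`. -/
theorem evolution_gradSq_le (hG : IsMetricOn (G t) Ω) (hy : y ∈ Ω)
    (hu : ContDiffOn ℝ ∞ (u t) Ω) (hV : ContDiffOn ℝ ∞ V Ω)
    (hG' : ∀ i j, HasDerivAt (fun s => G s y i j) (G' i j) t)
    (hu' : ∀ i, HasDerivAt (fun s => pd i (u s) y) (pd i u' y) t)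
    (heq : ∀ z ∈ Ω, u' z = (1 / 2) * coordLap (G t) (u t) z - coordGrad (G t) V (u t) z
      + (1 / 2) * coordGrad (G t) (u t) (u t) z)
    {lam : ℝ}
    (hlam : ∀ v : Fin n → ℝ, lam * (v ⬝ᵥ (G t y *ᵥ v)) ≤
      v ⬝ᵥ ((Matrix.of (fun i j => coordHess (G t) V i j y)
        + (1 / 2 : ℝ) • Matrix.of (fun i j => coordRic (G t) i j y) + (1 / 2 : ℝ) • G') *ᵥ v)) :
    deriv (fun s => coordGrad (G s) (u s) (u s) y) t
      - ((1 / 2) * coordLap (G t) (coordGrad (G t) (u t) (u t)) y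
        - coordGrad (G t) V (coordGrad (G t) (u t) (u t)) y)
      ≤ -hessNormSq (G t) (u t) y - 2 * lam * coordGrad (G t) (u t) (u t) y
        + coordGrad (G t) (u t) (coordGrad (G t) (u t) (u t)) y := by
  rw [(hG.hasDerivAt_coordGrad_self hy hG' hu').deriv, hG.bochner hu hy]
  set a : Fin n → ℝ := fun i => gradVec (G t) (u t) i y with ha
  set b : Fin n → ℝ := fun i => gradVec (G t) V i y with hb
  have hq := hG.contDiffOn_coordGrad hu hu
  have hVu := hG.contDiffOn_coordGrad hV hu
  have hL := hG.contDiffOn_coordLap hu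
  -- The gradient of the equation for `u`, paired with `∇u`.
  have h1 : coordGrad (G t) (u t) u' y = (1 / 2) * coordGrad (G t) (u t) (coordLap (G t) (u t)) y
      - ∑ j, a j * (∑ i, coordHess (G t) V i j y * a i + ∑ i, coordHess (G t) (u t) i j y * b i)
      + (1 / 2) * coordGrad (G t) (u t) (coordGrad (G t) (u t) (u t)) y := by
    simp only [hG.coordGrad_eq (f := u t) hy, Finset.mul_sum]
    rw [← Finset.sum_sub_distrib, ← Finset.sum_add_distrib]
    refine Finset.sum_congr rfl fun j _ => ?_
    rw [pd_congr hG.isOpen hy j heq, pd_add j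
      ((hG.diff (contDiffOn_const.mul hL) hy).fun_sub (hG.diff hVu hy))
      (hG.diff (contDiffOn_const.mul hq) hy), pd_sub j (hG.diff (contDiffOn_const.mul hL) hy)
      (hG.diff hVu hy), pd_const_mul j _ (hG.diff hL hy), pd_const_mul j _ (hG.diff hq hy),
      hG.pd_coordGrad hV hu hy]
    simp only [ha, hb]
    ring
  -- The drift in the generator produces the same term `2 Hess u (∇u, ∇V)` as the one in `h1`, and
  -- they cancel.
  have h2 : coordGrad (G t) V (coordGrad (G t) (u t) (u t)) y
      = 2 * ∑ j, a j * ∑ i, coordHess (G t) (u t) i j y * b i := by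
    rw [hG.coordGrad_eq hy]
    simp only [hG.pd_coordGrad hu hu hy, ← two_mul, Finset.mul_sum]
    rw [Finset.sum_comm]
    refine Finset.sum_congr rfl fun i _ => Finset.sum_congr rfl fun j _ => ?_
    rw [hG.hess_symm hu hy j i]; ring
  have h3 : a ⬝ᵥ (G t y *ᵥ a) = coordGrad (G t) (u t) (u t) y := by
    have : a = (G t y)⁻¹ *ᵥ fun i => pd i (u t) y := by
      funext i; simp [ha, gradVec, Matrix.mulVec, dotProduct]
    rw [this, Matrix.mulVec_mulVec, hG.mul_inv hy, Matrix.one_mulVec,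
      IsMetricOn.coordGrad_eq_dotProduct, dotProduct_comm]
  have h4 : a ⬝ᵥ ((Matrix.of (fun i j => coordHess (G t) V i j y)
        + (1 / 2 : ℝ) • Matrix.of (fun i j => coordRic (G t) i j y) + (1 / 2 : ℝ) • G') *ᵥ a)
      = ∑ j, a j * ∑ i, coordHess (G t) V i j y * a i
        + (1 / 2) * ∑ k, ∑ l, coordRic (G t) l k y * a l * a k
        + (1 / 2) * ∑ i, ∑ j, G' i j * a i * a j := by
    simp only [dotProduct, Matrix.mulVec, Finset.mul_sum]
    rw [Finset.sum_comm (f := fun k l => 1 / 2 * (coordRic (G t) l k y * a l * a k))]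
    simp only [← Finset.sum_add_distrib]
    refine Finset.sum_congr rfl fun i _ => Finset.sum_congr rfl fun j _ => ?_
    simp only [Matrix.add_apply, Matrix.smul_apply, Matrix.of_apply, smul_eq_mul]
    rw [hG.hess_symm hV hy j i]
    ring
  -- What remains besides `-|Hess u|²` and the transport term is minus twice the curvature form at
  -- `a = ∇u`.
  have h5 := hlam a
  rw [h3, h4] at h5
  rw [h1, h2]
  simp only [mul_add, Finset.sum_add_distrib] at *
  linarith

end IsMetricOn

end TimeDependent

/-! ### Transformation laws of metric, volume density and gradient product. -/

section ChartChange

variable {n : ℕ} {X : Type*} [TopologicalSpace X] [ChartedSpace (Model n) X]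

/-- The change of coordinates from the chart around `x₀` to the chart around `x`. -/
def chartTrans (x₀ x : X) (y : Model n) : Model n :=
  extChartAt (𝓡 n) x ((extChartAt (𝓡 n) x₀).symm y)

/-- The Jacobian matrix of `chartTrans`. -/
def chartJac (x₀ x : X) (y : Model n) : Matrix (Fin n) (Fin n) ℝ :=
  Matrix.of fun a i => fderiv ℝ (chartTrans x₀ x) y (EuclideanSpace.single i 1) a

/-- The part of the chart around `x₀` that lies in the domain of the chart around `x`. -/
def overlap (x₀ x : X) : Set (Model n) :=
  (extChartAt (𝓡 n) x₀).target ∩ (extChartAt (𝓡 n) x₀).symm ⁻¹' (extChartAt (𝓡 n) x).source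

theorem isOpen_overlap (x₀ x : X) : IsOpen (overlap (n := n) x₀ x) :=
  (continuousOn_extChartAt_symm x₀).isOpen_inter_preimage (isOpen_extChartAt_target x₀)
    (isOpen_extChartAt_source x)

theorem chartTrans_mem {x₀ x : X} {y : Model n} (hy : y ∈ overlap x₀ x) :
    chartTrans x₀ x y ∈ (extChartAt (𝓡 n) x).target := (extChartAt (𝓡 n) x).map_source hy.2

theorem symm_chartTrans {x₀ x : X} {y : Model n} (hy : y ∈ overlap x₀ x) :
    (extChartAt (𝓡 n) x).symm (chartTrans x₀ x y) = (extChartAt (𝓡 n) x₀).symm y :=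
  (extChartAt (𝓡 n) x).left_inv hy.2

theorem sum_smul_coordVec {x₀ : X} {y : Model n} (v : Fin n → ℝ) :
    (∑ i, v i • coordVec x₀ i y : TangentSpace (𝓡 n) ((extChartAt (𝓡 n) x₀).symm y))
      = mfderiv 𝓘(ℝ, Model n) (𝓡 n) (extChartAt (𝓡 n) x₀).symm y (WithLp.toLp 2 v : Model n) := by
  have : (WithLp.toLp 2 v : Model n) = ∑ i, v i • (EuclideanSpace.single i (1 : ℝ) : Model n) := by
    ext j
    simp [Finset.sum_apply, Pi.single_apply]
  rw [this]
  simp only [coordVec]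
  erw [map_sum]
  refine Finset.sum_congr rfl fun i _ => ?_
  erw [map_smul]

theorem fderiv_chartTrans_toLp (x₀ x : X) (y : Model n) (v : Fin n → ℝ) :
    fderiv ℝ (chartTrans x₀ x) y (WithLp.toLp 2 v) = WithLp.toLp 2 (chartJac x₀ x y *ᵥ v) := by
  have : (WithLp.toLp 2 v : Model n) = ∑ i, v i • (EuclideanSpace.single i (1 : ℝ) : Model n) := by
    ext j
    simp [Finset.sum_apply, Pi.single_apply]
  rw [this, map_sum]
  ext a
  simp [chartJac, Matrix.mulVec, dotProduct, Finset.sum_apply, mul_comm]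

variable [IsManifold (𝓡 n) ∞ X]

theorem contDiffOn_chartTrans (x₀ x : X) :
    ContDiffOn ℝ ∞ (chartTrans (n := n) x₀ x) (overlap x₀ x) := by
  have h1 : ContMDiffOn 𝓘(ℝ, Model n) (𝓡 n) ∞ (extChartAt (𝓡 n) x₀).symm (overlap (n := n) x₀ x) :=
    (contMDiffOn_extChartAt_symm x₀).mono inter_subset_left
  have h2 : ContMDiffOn (𝓡 n) 𝓘(ℝ, Model n) ∞ (extChartAt (𝓡 n) x) (chartAt (Model n) x).source :=
    contMDiffOn_extChartAt
  have h3 := h2.comp h1 (fun y hy => by simpa using hy.2)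
  exact h3.contDiffOn

theorem mdifferentiableAt_extChartAt_symm {x₀ : X} {y : Model n}
    (hy : y ∈ (extChartAt (𝓡 n) x₀).target) :
    MDifferentiableAt 𝓘(ℝ, Model n) (𝓡 n) (extChartAt (𝓡 n) x₀).symm y := by
  have h1 : ContMDiffOn 𝓘(ℝ, Model n) (𝓡 n) ∞ (extChartAt (𝓡 n) x₀).symm
    (extChartAt (𝓡 n) x₀).target := contMDiffOn_extChartAt_symm x₀
  exact (h1.contMDiffAt ((isOpen_extChartAt_target x₀).mem_nhds hy)).mdifferentiableAt (by simp)

theorem mfderiv_extChartAt_symm_injective {x₀ : X} {y : Model n}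
    (hy : y ∈ (extChartAt (𝓡 n) x₀).target) :
    Function.Injective (mfderiv 𝓘(ℝ, Model n) (𝓡 n) (extChartAt (𝓡 n) x₀).symm y) := by
  have : IsManifold (𝓡 n) 1 X := IsManifold.of_le (n := ∞) (by simp)
  have h := mfderiv_extChartAt_comp_mfderivWithin_extChartAt_symm (I := 𝓡 n) hy
  rw [ModelWithCorners.range_eq_univ, mfderivWithin_univ] at h
  intro v w hvw
  have h1 := DFunLike.congr_fun h v
  have h2 := DFunLike.congr_fun h w
  simp only [ContinuousLinearMap.comp_apply] at h1 h2
  rw [hvw] at h1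
  exact h1.symm.trans h2

theorem metricMat_mulVec (g : RMetric n X) (x₀ : X) (y : Model n) (v w : Fin n → ℝ) :
    v ⬝ᵥ (metricMat g x₀ y *ᵥ w) = g.inner ((extChartAt (𝓡 n) x₀).symm y)
      (∑ i, v i • coordVec x₀ i y) (∑ i, w i • coordVec x₀ i y) := by
  simp only [map_sum, map_smul, _root_.sum_apply, _root_.smul_apply,
    dotProduct, Matrix.mulVec, metricMat, Matrix.of_apply, smul_eq_mul, Finset.mul_sum]
  rw [Finset.sum_comm]
  exact Finset.sum_congr rfl fun i _ => Finset.sum_congr rfl fun j _ => by ring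

theorem posDef_metricMat (g : RMetric n X) {x₀ : X} {y : Model n}
    (hy : y ∈ (extChartAt (𝓡 n) x₀).target) : (metricMat g x₀ y).PosDef := by
  refine Matrix.PosDef.of_dotProduct_mulVec_pos ?_ fun v hv => ?_
  · ext i j
    simp only [Matrix.conjTranspose_apply, metricMat, Matrix.of_apply, star_trivial]
    exact g.symm _ _ _
  · rw [star_trivial, metricMat_mulVec, sum_smul_coordVec]
    refine g.pos _ _ fun h0 => hv ?_
    have := mfderiv_extChartAt_symm_injective hy (h0.trans (map_zero _).symm)
    exact congrArg WithLp.ofLp this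

/-- All tangent spaces are the same model vector space, so vectors can be carried between equal base
points without casts. -/
theorem inner_congr (g : RMetric n X) {p p' : X} (h : p = p') (v w : Model n) :
    g.inner p (v : TangentSpace (𝓡 n) p) (w : TangentSpace (𝓡 n) p)
      = g.inner p' (v : TangentSpace (𝓡 n) p') (w : TangentSpace (𝓡 n) p') := by
  subst h; rfl

theorem differentiableAt_chartTrans {x₀ x : X} {y : Model n} (hy : y ∈ overlap x₀ x) :
    DifferentiableAt ℝ (chartTrans x₀ x) y :=
  ((contDiffOn_chartTrans x₀ x).contDiffAt ((isOpen_overlap x₀ x).mem_nhds hy)).differentiableAt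
    (by simp)

theorem mfderiv_symm_change {x₀ x : X} {y : Model n} (hy : y ∈ overlap x₀ x) (v : Model n) :
    (mfderiv 𝓘(ℝ, Model n) (𝓡 n) (extChartAt (𝓡 n) x₀).symm y v : Model n)
      = mfderiv 𝓘(ℝ, Model n) (𝓡 n) (extChartAt (𝓡 n) x).symm (chartTrans x₀ x y)
        (fderiv ℝ (chartTrans x₀ x) y v) := by
  have h1 : (extChartAt (𝓡 n) x₀).symm =ᶠ[𝓝 y]
      (extChartAt (𝓡 n) x).symm ∘ chartTrans (n := n) x₀ x := by
    filter_upwards [(isOpen_overlap x₀ x).mem_nhds hy] with z hz using (symm_chartTrans hz).symm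
  have h2 : HasMFDerivAt 𝓘(ℝ, Model n) (𝓡 n) ((extChartAt (𝓡 n) x).symm ∘ chartTrans (n := n) x₀ x)
      y _ := (mdifferentiableAt_extChartAt_symm (chartTrans_mem hy)).hasMFDerivAt.comp y
    (differentiableAt_chartTrans hy).hasFDerivAt.hasMFDerivAt
  have h3 := (h2.congr_of_eventuallyEq h1).mfderiv
  have := DFunLike.congr_fun h3 v
  exact this

/-- The transformation law of the metric. -/
theorem metricMat_change (g : RMetric n X) {x₀ x : X} {y : Model n} (hy : y ∈ overlap x₀ x) :
    metricMat g x₀ y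
      = (chartJac x₀ x y)ᵀ * metricMat g x (chartTrans x₀ x y) * chartJac x₀ x y := by
  have key : ∀ v w : Fin n → ℝ, v ⬝ᵥ (metricMat g x₀ y *ᵥ w)
      = v ⬝ᵥ (((chartJac x₀ x y)ᵀ * metricMat g x (chartTrans x₀ x y) * chartJac x₀ x y) *ᵥ w) := by
    intro v w
    rw [← Matrix.mulVec_mulVec, ← Matrix.mulVec_mulVec, Matrix.dotProduct_mulVec v (chartJac x₀ x y)ᵀ,
      Matrix.vecMul_transpose, metricMat_mulVec, metricMat_mulVec, sum_smul_coordVec,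
      sum_smul_coordVec, sum_smul_coordVec, sum_smul_coordVec, ← fderiv_chartTrans_toLp,
      ← fderiv_chartTrans_toLp]
    have e := fun v => mfderiv_symm_change hy (WithLp.toLp 2 v : Model n)
    have := inner_congr g (symm_chartTrans hy).symm
      (mfderiv 𝓘(ℝ, Model n) (𝓡 n) (extChartAt (𝓡 n) x₀).symm y (WithLp.toLp 2 v : Model n))
      (mfderiv 𝓘(ℝ, Model n) (𝓡 n) (extChartAt (𝓡 n) x₀).symm y (WithLp.toLp 2 w : Model n))
    refine this.trans ?_
    rw [e v, e w]
  ext i j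
  simpa using key (Pi.single i 1) (Pi.single j 1)

/-- Take determinants in the transformation law of any metric: the left-hand side is positive. -/
theorem det_chartJac_ne_zero [Nonempty (RMetric n X)] {x₀ x : X} {y : Model n}
    (hy : y ∈ overlap x₀ x) : (chartJac x₀ x y).det ≠ 0 := by
  obtain ⟨g⟩ := ‹Nonempty (RMetric n X)›
  have h := congrArg Matrix.det (metricMat_change g hy)
  rw [Matrix.det_mul, Matrix.det_mul] at h
  intro h0
  rw [h0, mul_zero] at h
  exact (posDef_metricMat g hy.1).det_pos.ne' h

/-- The transformation law of the volume density. -/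
theorem volDensity_change (g : RMetric n X) {x₀ x : X} {y : Model n} (hy : y ∈ overlap x₀ x) :
    volDensity g x₀ y = |(chartJac x₀ x y).det| * volDensity g x (chartTrans x₀ x y) := by
  rw [volDensity, volDensity, metricMat_change g hy, Matrix.det_mul, Matrix.det_mul,
    Matrix.det_transpose, abs_mul, abs_mul, mul_right_comm,
    Real.sqrt_mul (mul_nonneg (abs_nonneg _) (abs_nonneg _)), Real.sqrt_mul_self (abs_nonneg _)]

theorem pd_inChart_change {x₀ x : X} {y : Model n} (hy : y ∈ overlap x₀ x) {a : X → ℝ}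
    (ha : DifferentiableAt ℝ (inChart x a) (chartTrans x₀ x y)) (i : Fin n) :
    pd i (inChart x₀ a) y
      = ∑ b, chartJac x₀ x y b i * pd b (inChart x a) (chartTrans x₀ x y) := by
  have h1 : inChart x₀ a =ᶠ[𝓝 y] inChart x a ∘ chartTrans (n := n) x₀ x := by
    filter_upwards [(isOpen_overlap x₀ x).mem_nhds hy] with z hz
    simp only [inChart, Function.comp]
    rw [symm_chartTrans hz]
  have h2 := (ha.hasFDerivAt.comp y (differentiableAt_chartTrans hy).hasFDerivAt).fderiv
  simp only [pd]
  rw [h1.fderiv_eq, h2, ContinuousLinearMap.comp_apply]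
  have h3 : fderiv ℝ (chartTrans x₀ x) y (EuclideanSpace.single i 1)
      = ∑ b, chartJac x₀ x y b i • (EuclideanSpace.single b (1 : ℝ) : Model n) := by
    ext j
    simp [chartJac, Finset.sum_apply, Pi.single_apply]
  rw [h3, map_sum]
  simp

/-- The scalar product of gradients does not depend on the chart. -/
theorem coordGrad_change (g : RMetric n X) {x₀ x : X} {y : Model n} (hy : y ∈ overlap x₀ x)
    {a b : X → ℝ} (ha : DifferentiableAt ℝ (inChart x a) (chartTrans x₀ x y))
    (hb : DifferentiableAt ℝ (inChart x b) (chartTrans x₀ x y)) :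
    coordGrad (metricMat g x₀) (inChart x₀ a) (inChart x₀ b) y
      = coordGrad (metricMat g x) (inChart x a) (inChart x b) (chartTrans x₀ x y) := by
  have : Nonempty (RMetric n X) := ⟨g⟩
  rw [IsMetricOn.coordGrad_eq_dotProduct, IsMetricOn.coordGrad_eq_dotProduct]
  have e : ∀ {c : X → ℝ}, DifferentiableAt ℝ (inChart x c) (chartTrans x₀ x y) →
      (fun i => pd i (inChart x₀ c) y)
        = (chartJac x₀ x y)ᵀ *ᵥ fun i => pd i (inChart x c) (chartTrans x₀ x y) := by
    intro c hc
    funext i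
    rw [pd_inChart_change hy hc]
    simp [Matrix.mulVec, dotProduct]
  rw [e ha, e hb, metricMat_change g hy, Matrix.mul_inv_rev, Matrix.mul_inv_rev]
  set J := chartJac x₀ x y
  have hJ : IsUnit J.det := (det_chartJac_ne_zero hy).isUnit
  have hJt : IsUnit Jᵀ.det := by rwa [Matrix.det_transpose]
  set M := metricMat g x (chartTrans x₀ x y)
  rw [Matrix.mulVec_transpose, ← Matrix.dotProduct_mulVec, Matrix.mulVec_mulVec,
    Matrix.mulVec_mulVec]
  congr 2
  rw [Matrix.mul_nonsing_inv_cancel_left _ _ hJ, Matrix.mul_assoc,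
    Matrix.nonsing_inv_mul _ hJt, Matrix.mul_one]

end ChartChange

/-! ### The Riemannian volume: chart formula, positivity on open sets, local finiteness. -/

section Volume

variable {n : ℕ} {X : Type*} [TopologicalSpace X] [ChartedSpace (Model n) X]

theorem det_fderiv_chartTrans (x₀ x : X) (y : Model n) :
    (fderiv ℝ (chartTrans x₀ x) y).det = (chartJac x₀ x y).det := by
  rw [ContinuousLinearMap.det, ← LinearMap.det_toMatrix (EuclideanSpace.basisFun (Fin n) ℝ).toBasis]
  congr 1

variable (n X) in
theorem exists_countable_charts [SecondCountableTopology X] [Nonempty X] :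
    ∃ c : ℕ → X, ⋃ k, (extChartAt (𝓡 n) (c k)).source = univ := by
  obtain ⟨s, hs, hsu⟩ := TopologicalSpace.countable_cover_nhds
    (fun x : X => (isOpen_extChartAt_source (I := 𝓡 n) x).mem_nhds (mem_extChartAt_source x))
  have hne : s.Nonempty := by
    by_contra h
    rw [not_nonempty_iff_eq_empty] at h
    subst h
    simp at hsu
    exact (univ_nonempty (α := X)).ne_empty hsu.symm
  obtain ⟨c, rfl⟩ := hs.exists_eq_range hne
  exact ⟨c, by simpa using hsu⟩

variable [IsManifold (𝓡 n) ∞ X]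

/-- All components of the metric in charts are smooth. -/
def IsSmoothMetric (g : RMetric n X) : Prop :=
  ∀ x₀ : X, ∀ i j, ContDiffOn ℝ ∞ (fun y => metricMat g x₀ y i j) (extChartAt (𝓡 n) x₀).target

theorem IsSmoothMetric.isMetricOn {g : RMetric n X} (hg : IsSmoothMetric g) (x₀ : X) :
    IsMetricOn (metricMat g x₀) (extChartAt (𝓡 n) x₀).target :=
  ⟨isOpen_extChartAt_target x₀, hg x₀, fun _ hy => posDef_metricMat g hy⟩

theorem volDensity_pos (g : RMetric n X) {x₀ : X} {y : Model n}
    (hy : y ∈ (extChartAt (𝓡 n) x₀).target) : 0 < volDensity g x₀ y :=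
  Real.sqrt_pos.2 (abs_pos.2 (posDef_metricMat g hy).det_pos.ne')

theorem IsSmoothMetric.continuousOn_volDensity {g : RMetric n X} (hg : IsSmoothMetric g) (x₀ : X) :
    ContinuousOn (volDensity g x₀) (extChartAt (𝓡 n) x₀).target :=
  (hg.isMetricOn x₀).contDiffOn_coordDens.continuousOn

variable [MeasurableSpace X] [BorelSpace X]

theorem measurableSet_symm_preimage (x₀ : X) {s : Set X} (hs : MeasurableSet s) :
    MeasurableSet ((extChartAt (𝓡 n) x₀).symm ⁻¹' s ∩ (extChartAt (𝓡 n) x₀).target) := by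
  classical
  have hm : Measurable ((extChartAt (𝓡 n) x₀).target.piecewise (extChartAt (𝓡 n) x₀).symm
      fun _ => x₀) :=
    (continuousOn_extChartAt_symm x₀).measurable_piecewise continuousOn_const
      (isOpen_extChartAt_target x₀).measurableSet
  have h2 := (hm hs).inter (isOpen_extChartAt_target (I := 𝓡 n) x₀).measurableSet
  convert h2 using 1
  ext y
  by_cases hy : y ∈ (extChartAt (𝓡 n) x₀).target
  · simp only [mem_inter_iff, mem_preimage, Set.piecewise_eq_of_mem _ _ _ hy]
  · simp only [mem_inter_iff, hy, and_false]

theorem aemeasurable_symm (x₀ : X) (μ : Measure (Model n)) :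
    AEMeasurable (extChartAt (𝓡 n) x₀).symm (μ.restrict (extChartAt (𝓡 n) x₀).target) := by
  classical
  have hm : Measurable ((extChartAt (𝓡 n) x₀).target.piecewise (extChartAt (𝓡 n) x₀).symm
      fun _ => x₀) :=
    (continuousOn_extChartAt_symm x₀).measurable_piecewise continuousOn_const
      (isOpen_extChartAt_target x₀).measurableSet
  refine ⟨_, hm, ?_⟩
  filter_upwards [ae_restrict_mem (isOpen_extChartAt_target (I := 𝓡 n) x₀).measurableSet] with y hy
  rw [Set.piecewise_eq_of_mem _ _ _ hy]

theorem chartVolume_apply (g : RMetric n X) (x₀ : X) {s : Set X} (hs : MeasurableSet s) :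
    chartVolume g x₀ s = ∫⁻ y in (extChartAt (𝓡 n) x₀).symm ⁻¹' s ∩ (extChartAt (𝓡 n) x₀).target,
      ENNReal.ofReal (volDensity g x₀ y) := by
  rw [chartVolume, Measure.map_apply_of_aemeasurable
    ((aemeasurable_symm x₀ _).mono_ac (withDensity_absolutelyContinuous _ _)) hs,
    withDensity_apply', Measure.restrict_restrict' (isOpen_extChartAt_target x₀).measurableSet]

/-- On overlaps of charts the chart measures agree, by the change of variables formula. -/
theorem chartVolume_eq (g : RMetric n X) {x₀ x : X} {s : Set X} (hs : MeasurableSet s)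
    (h₀ : s ⊆ (extChartAt (𝓡 n) x₀).source) (h : s ⊆ (extChartAt (𝓡 n) x).source) :
    chartVolume g x₀ s = chartVolume g x s := by
  rw [chartVolume_apply g x₀ hs, chartVolume_apply g x hs]
  set A₀ := (extChartAt (𝓡 n) x₀).symm ⁻¹' s ∩ (extChartAt (𝓡 n) x₀).target with hA₀
  have hsub : A₀ ⊆ overlap x₀ x := fun y hy => ⟨hy.2, h hy.1⟩
  have himg : (extChartAt (𝓡 n) x).symm ⁻¹' s ∩ (extChartAt (𝓡 n) x).target
      = chartTrans x₀ x '' A₀ := by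
    ext z
    constructor
    · rintro ⟨hz, hzt⟩
      refine ⟨extChartAt (𝓡 n) x₀ ((extChartAt (𝓡 n) x).symm z), ⟨?_, ?_⟩, ?_⟩
      · rw [mem_preimage, (extChartAt (𝓡 n) x₀).left_inv (h₀ hz)]; exact hz
      · exact (extChartAt (𝓡 n) x₀).map_source (h₀ hz)
      · rw [chartTrans, (extChartAt (𝓡 n) x₀).left_inv (h₀ hz), (extChartAt (𝓡 n) x).right_inv hzt]
    · rintro ⟨y, hy, rfl⟩
      refine ⟨?_, chartTrans_mem (hsub hy)⟩
      rw [mem_preimage, symm_chartTrans (hsub hy)]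
      exact hy.1
  have hinj : InjOn (chartTrans (n := n) x₀ x) A₀ := by
    intro y hy z hz hyz
    have h1 := congrArg (extChartAt (𝓡 n) x).symm hyz
    rw [symm_chartTrans (hsub hy), symm_chartTrans (hsub hz)] at h1
    exact (extChartAt (𝓡 n) x₀).symm.injOn hy.2 hz.2 h1
  have hmeas : MeasurableSet A₀ := measurableSet_symm_preimage x₀ hs
  rw [himg, lintegral_image_eq_lintegral_abs_det_fderiv_mul volume hmeas
    (fun y hy => (differentiableAt_chartTrans (hsub hy)).hasFDerivAt.hasFDerivWithinAt) hinj]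
  refine setLIntegral_congr_fun hmeas fun y hy => ?_
  rw [volDensity_change g (hsub hy), det_fderiv_chartTrans, ENNReal.ofReal_mul (abs_nonneg _)]

theorem chartVolume_compl_source (g : RMetric n X) (x₀ : X) :
    chartVolume g x₀ (extChartAt (𝓡 n) x₀).sourceᶜ = 0 := by
  rw [chartVolume_apply g x₀ (isOpen_extChartAt_source x₀).measurableSet.compl]
  have : (extChartAt (𝓡 n) x₀).symm ⁻¹' (extChartAt (𝓡 n) x₀).sourceᶜ
      ∩ (extChartAt (𝓡 n) x₀).target = ∅ := by
    ext y
    simp only [mem_inter_iff, mem_preimage, mem_compl_iff, mem_empty_iff_false, iff_false, not_and]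
    exact fun h1 h2 => h1 ((extChartAt (𝓡 n) x₀).map_target h2)
  rw [this]; simp

theorem chartVolume_inter_source (g : RMetric n X) (x₀ : X) (s : Set X) :
    chartVolume g x₀ (s ∩ (extChartAt (𝓡 n) x₀).source) = chartVolume g x₀ s := by
  refine measure_congr (inter_ae_eq_left_of_ae_eq_univ ?_)
  rw [ae_eq_univ]
  exact chartVolume_compl_source g x₀

variable [SecondCountableTopology X]

/-- Cut `X` into countably many disjoint pieces, each inside one chart, and glue the chart measures
along them. As chart measures agree on overlaps, the glued measure dominates every chart measure,
hence the supremum; and on a set inside the chart around `x₀` it equals the chart measure there. -/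
theorem riemVolume_apply (g : RMetric n X) (x₀ : X) {s : Set X} (hs : MeasurableSet s)
    (h₀ : s ⊆ (extChartAt (𝓡 n) x₀).source) : riemVolume g s = chartVolume g x₀ s := by
  have : Nonempty X := ⟨x₀⟩
  refine le_antisymm ?_ (le_iSup (fun x => chartVolume g x) x₀ s)
  obtain ⟨c, hc⟩ := exists_countable_charts n X
  let U : ℕ → Set X := fun k => (extChartAt (𝓡 n) (c k)).source
  have hU : ∀ k, MeasurableSet (U k) := fun k => (isOpen_extChartAt_source (c k)).measurableSet
  have hA : ∀ k, MeasurableSet (disjointed U k) := fun k => MeasurableSet.disjointed hU k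
  have hAU : ⋃ k, disjointed U k = univ := by rw [iUnion_disjointed]; exact hc
  let ν : Measure X := Measure.sum fun k => (chartVolume g (c k)).restrict (disjointed U k)
  have hsplit : ∀ (μ : Measure X) {t : Set X}, MeasurableSet t →
      μ t = ∑' k, μ (t ∩ disjointed U k) := by
    intro μ t ht
    rw [← measure_iUnion (fun i j hij => ((disjoint_disjointed U hij).mono
      inter_subset_right inter_subset_right)) fun k => ht.inter (hA k), ← inter_iUnion, hAU,
      inter_univ]
  have hν : ∀ {t : Set X}, MeasurableSet t → ν t = ∑' k, chartVolume g (c k) (t ∩ disjointed U k) := by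
    intro t ht
    rw [Measure.sum_apply _ ht]
    exact tsum_congr fun k => Measure.restrict_apply ht
  have hle : riemVolume g ≤ ν := by
    refine iSup_le fun x => Measure.le_iff.2 fun t ht => ?_
    rw [hν ht, hsplit _ ht]
    refine ENNReal.tsum_le_tsum fun k => ?_
    have hsx := (isOpen_extChartAt_source (I := 𝓡 n) x).measurableSet
    rw [← chartVolume_inter_source g x, chartVolume_eq g (x := c k)
      ((ht.inter (hA k)).inter hsx) inter_subset_right
      (fun z hz => disjointed_subset U k hz.1.2)]
    exact measure_mono inter_subset_left
  refine (hle s).trans (le_of_eq ?_)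
  rw [hν hs, hsplit _ hs]
  refine tsum_congr fun k => (chartVolume_eq g (hs.inter (hA k))
    (fun z hz => h₀ hz.1) (fun z hz => disjointed_subset U k hz.2)).symm

theorem restrict_riemVolume (g : RMetric n X) (x₀ : X) :
    (riemVolume g).restrict (extChartAt (𝓡 n) x₀).source = chartVolume g x₀ := by
  ext s hs
  rw [Measure.restrict_apply hs, riemVolume_apply g x₀
    (hs.inter (isOpen_extChartAt_source x₀).measurableSet) inter_subset_right,
    chartVolume_inter_source]

variable (n) in
theorem measure_ext_of_charts {μ ν : Measure X}
    (h : ∀ x₀ : X, μ.restrict (extChartAt (𝓡 n) x₀).source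
      = ν.restrict (extChartAt (𝓡 n) x₀).source) : μ = ν := by
  rcases isEmpty_or_nonempty X with hX | hX
  · exact Measure.ext fun s _ => by rw [Set.eq_empty_of_isEmpty s]; simp
  obtain ⟨c, hc⟩ := exists_countable_charts n X
  exact (Measure.ext_iff_of_iUnion_eq_univ hc).2 fun k => h (c k)

theorem IsSmoothMetric.integral_chartVolume {g : RMetric n X} (hg : IsSmoothMetric g) (x₀ : X)
    {f : X → ℝ} (hf : AEStronglyMeasurable f (chartVolume g x₀)) :
    ∫ x, f x ∂(chartVolume g x₀)
      = ∫ y in (extChartAt (𝓡 n) x₀).target, volDensity g x₀ y * f ((extChartAt (𝓡 n) x₀).symm y) := by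
  have hd : AEMeasurable (fun y => ENNReal.ofReal (volDensity g x₀ y))
      (volume.restrict (extChartAt (𝓡 n) x₀).target) :=
    ((hg.continuousOn_volDensity x₀).aemeasurable
      (isOpen_extChartAt_target x₀).measurableSet).ennreal_ofReal
  rw [chartVolume, integral_map ((aemeasurable_symm x₀ _).mono_ac
    (withDensity_absolutelyContinuous _ _)) hf, integral_withDensity_eq_integral_toReal_smul₀ hd
    (Eventually.of_forall fun _ => ENNReal.ofReal_lt_top)]
  refine setIntegral_congr_fun (isOpen_extChartAt_target x₀).measurableSet fun y hy => ?_
  simp [ENNReal.toReal_ofReal (volDensity_pos g hy).le]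

/-- Integrals against the Riemannian volume of functions that live in one chart. -/
theorem IsSmoothMetric.integral_riemVolume {g : RMetric n X} (hg : IsSmoothMetric g) (x₀ : X)
    {f : X → ℝ} (hf : ContinuousOn f (extChartAt (𝓡 n) x₀).source)
    (hf₀ : ∀ x, x ∉ (extChartAt (𝓡 n) x₀).source → f x = 0) :
    ∫ x, f x ∂(riemVolume g)
      = ∫ y in (extChartAt (𝓡 n) x₀).target, volDensity g x₀ y * f ((extChartAt (𝓡 n) x₀).symm y) := by
  rw [← setIntegral_eq_integral_of_forall_compl_eq_zero hf₀, restrict_riemVolume,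
    hg.integral_chartVolume]
  rw [← restrict_riemVolume]
  exact hf.aestronglyMeasurable (isOpen_extChartAt_source x₀).measurableSet

theorem isOpenPosMeasure_riemVolume (g : RMetric n X) (hg : IsSmoothMetric g) :
    (riemVolume g).IsOpenPosMeasure := by
  refine ⟨fun U hU ⟨x, hx⟩ h0 => ?_⟩
  have hs := isOpen_extChartAt_source (I := 𝓡 n) x
  have h1 : riemVolume g (U ∩ (extChartAt (𝓡 n) x).source) = 0 :=
    measure_mono_null inter_subset_left h0
  rw [riemVolume_apply g x (hU.measurableSet.inter hs.measurableSet) inter_subset_right,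
    chartVolume_apply g x (hU.measurableSet.inter hs.measurableSet)] at h1
  set A := (extChartAt (𝓡 n) x).symm ⁻¹' (U ∩ (extChartAt (𝓡 n) x).source)
    ∩ (extChartAt (𝓡 n) x).target with hA
  have hAo : IsOpen A := by
    rw [hA, inter_comm]
    exact (continuousOn_extChartAt_symm x).isOpen_inter_preimage (isOpen_extChartAt_target x)
      (hU.inter hs)
  have hAne : A.Nonempty := ⟨extChartAt (𝓡 n) x x, by simp [hx], mem_extChartAt_target x⟩
  have hm : AEMeasurable (fun y => ENNReal.ofReal (volDensity g x y)) (volume.restrict A) :=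
    (((hg.continuousOn_volDensity x).mono inter_subset_right).aemeasurable
      hAo.measurableSet).ennreal_ofReal
  rw [lintegral_eq_zero_iff' hm] at h1
  have h2 : ∀ᵐ y ∂(volume.restrict A), False := by
    filter_upwards [h1, ae_restrict_mem hAo.measurableSet] with y hy hyA
    have := volDensity_pos g hyA.2
    simp at hy
    linarith
  rw [eventually_false_iff_eq_bot, ae_eq_bot, Measure.restrict_eq_zero] at h2
  exact (hAo.measure_pos volume hAne).ne' h2

theorem isLocallyFiniteMeasure_riemVolume (g : RMetric n X) (hg : IsSmoothMetric g) :
    IsLocallyFiniteMeasure (riemVolume g) := by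
  refine ⟨fun x => ?_⟩
  have ht := isOpen_extChartAt_target (I := 𝓡 n) x
  obtain ⟨r, hr, hball⟩ := Metric.nhds_basis_closedBall.mem_iff.1
    (ht.mem_nhds (mem_extChartAt_target x))
  have hs := isOpen_extChartAt_source (I := 𝓡 n) x
  set U := (extChartAt (𝓡 n) x).source ∩ extChartAt (𝓡 n) x ⁻¹' Metric.ball (extChartAt (𝓡 n) x x) r
    with hU
  have hUo : IsOpen U := (continuousOn_extChartAt x).isOpen_inter_preimage hs Metric.isOpen_ball
  refine ⟨U, hUo.mem_nhds ⟨mem_extChartAt_source x, by simpa using hr⟩, ?_⟩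
  rw [riemVolume_apply g x hUo.measurableSet inter_subset_left,
    chartVolume_apply g x hUo.measurableSet]
  have hsub : (extChartAt (𝓡 n) x).symm ⁻¹' U ∩ (extChartAt (𝓡 n) x).target
      ⊆ Metric.closedBall (extChartAt (𝓡 n) x x) r := by
    rintro y ⟨hy, hyt⟩
    have := hy.2
    rw [mem_preimage, (extChartAt (𝓡 n) x).right_inv hyt] at this
    exact Metric.ball_subset_closedBall this
  refine (lintegral_mono_set hsub).trans_lt ?_
  have hIntOn : IntegrableOn (volDensity g x) (Metric.closedBall (extChartAt (𝓡 n) x x) r) :=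
    ((hg.continuousOn_volDensity x).mono hball).integrableOn_compact
      (isCompact_closedBall _ _)
  exact hIntOn.lintegral_lt_top

end Volume

/-! ### Calculus on the manifold for a fixed metric. -/

section Static

variable {n : ℕ} {X : Type*} [TopologicalSpace X] [ChartedSpace (Model n) X]
  [IsManifold (𝓡 n) ∞ X]

theorem contDiffOn_inChart {a : X → ℝ} (ha : ContMDiff (𝓡 n) 𝓘(ℝ, ℝ) ∞ a) (x₀ : X) :
    ContDiffOn ℝ ∞ (inChart (n := n) x₀ a) (extChartAt (𝓡 n) x₀).target := by
  have h1 : ContMDiffOn 𝓘(ℝ, Model n) (𝓡 n) ∞ (extChartAt (𝓡 n) x₀).symm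
    (extChartAt (𝓡 n) x₀).target := contMDiffOn_extChartAt_symm x₀
  exact (ha.comp_contMDiffOn h1).contDiffOn

theorem differentiableAt_inChart {a : X → ℝ} (ha : ContMDiff (𝓡 n) 𝓘(ℝ, ℝ) ∞ a) {x₀ : X}
    {y : Model n} (hy : y ∈ (extChartAt (𝓡 n) x₀).target) :
    DifferentiableAt ℝ (inChart x₀ a) y :=
  differentiableAt_of_contDiffOn (isOpen_extChartAt_target x₀) (contDiffOn_inChart ha x₀) hy

/-- Objects such as `gradInner` are defined at `x` through the chart around `x`. Their smoothness is
proved by identifying them with one expression in a fixed chart. -/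
theorem contMDiff_of_inChart {a : X → ℝ}
    (ha : ∀ x₀ : X, ContDiffOn ℝ ∞ (inChart (n := n) x₀ a) (extChartAt (𝓡 n) x₀).target) :
    ContMDiff (𝓡 n) 𝓘(ℝ, ℝ) ∞ a := by
  intro x
  have h1 : ContMDiffOn (𝓡 n) 𝓘(ℝ, Model n) ∞ (extChartAt (𝓡 n) x) (chartAt (Model n) x).source :=
    contMDiffOn_extChartAt
  have h2 : ContMDiffOn (𝓡 n) 𝓘(ℝ, ℝ) ∞ (inChart x a ∘ extChartAt (𝓡 n) x)
      (chartAt (Model n) x).source :=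
    (ha x).contMDiffOn.comp h1 fun z hz =>
      (extChartAt (𝓡 n) x).map_source (by rwa [extChartAt_source])
  have h3 : ContMDiffOn (𝓡 n) 𝓘(ℝ, ℝ) ∞ a (chartAt (Model n) x).source := by
    refine h2.congr fun z hz => ?_
    simp only [inChart, Function.comp]
    rw [(extChartAt (𝓡 n) x).left_inv (by rwa [extChartAt_source])]
  exact h3.contMDiffAt ((chartAt (Model n) x).open_source.mem_nhds (mem_chart_source _ x))

theorem overlap_self_mem {x₀ x : X} (hx : x ∈ (extChartAt (𝓡 n) x₀).source) :
    extChartAt (𝓡 n) x₀ x ∈ overlap x₀ x :=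
  ⟨(extChartAt (𝓡 n) x₀).map_source hx, by
    rw [mem_preimage, (extChartAt (𝓡 n) x₀).left_inv hx]; exact mem_extChartAt_source x⟩

theorem chartTrans_self {x₀ x : X} (hx : x ∈ (extChartAt (𝓡 n) x₀).source) :
    chartTrans x₀ x (extChartAt (𝓡 n) x₀ x) = extChartAt (𝓡 n) x x := by
  rw [chartTrans, (extChartAt (𝓡 n) x₀).left_inv hx]

/-- The scalar product of gradients in an arbitrary chart. -/
theorem gradInner_eq_coordGrad (g : RMetric n X) {a b : X → ℝ} {x₀ x : X}
    (hx : x ∈ (extChartAt (𝓡 n) x₀).source)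
    (ha : DifferentiableAt ℝ (inChart x a) (extChartAt (𝓡 n) x x))
    (hb : DifferentiableAt ℝ (inChart x b) (extChartAt (𝓡 n) x x)) :
    gradInner g a b x
      = coordGrad (metricMat g x₀) (inChart x₀ a) (inChart x₀ b) (extChartAt (𝓡 n) x₀ x) := by
  rw [← chartTrans_self hx] at ha hb
  rw [coordGrad_change g (overlap_self_mem hx) ha hb, chartTrans_self hx]
  rfl

theorem gradInner_symm_apply (g : RMetric n X) {a b : X → ℝ}
    (ha : ContMDiff (𝓡 n) 𝓘(ℝ, ℝ) ∞ a) (hb : ContMDiff (𝓡 n) 𝓘(ℝ, ℝ) ∞ b) {x₀ : X} {y : Model n}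
    (hy : y ∈ (extChartAt (𝓡 n) x₀).target) :
    gradInner g a b ((extChartAt (𝓡 n) x₀).symm y)
      = coordGrad (metricMat g x₀) (inChart x₀ a) (inChart x₀ b) y := by
  rw [gradInner_eq_coordGrad g ((extChartAt (𝓡 n) x₀).map_target hy)
    (differentiableAt_inChart ha (mem_extChartAt_target _))
    (differentiableAt_inChart hb (mem_extChartAt_target _)), (extChartAt (𝓡 n) x₀).right_inv hy]

theorem laplaceBeltrami_eq (g : RMetric n X) (f : X → ℝ) (x : X) :
    laplaceBeltrami g f x = coordLap (metricMat g x) (inChart x f) (extChartAt (𝓡 n) x x) := rfl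

theorem gradInner_eq (g : RMetric n X) (a b : X → ℝ) (x : X) :
    gradInner g a b x
      = coordGrad (metricMat g x) (inChart x a) (inChart x b) (extChartAt (𝓡 n) x x) := rfl

theorem IsSmoothMetric.contMDiff_gradInner {g : RMetric n X} (hg : IsSmoothMetric g) {a b : X → ℝ}
    (ha : ContMDiff (𝓡 n) 𝓘(ℝ, ℝ) ∞ a) (hb : ContMDiff (𝓡 n) 𝓘(ℝ, ℝ) ∞ b) :
    ContMDiff (𝓡 n) 𝓘(ℝ, ℝ) ∞ (gradInner g a b) :=
  contMDiff_of_inChart fun x₀ => ((hg.isMetricOn x₀).contDiffOn_coordGrad (contDiffOn_inChart ha x₀)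
    (contDiffOn_inChart hb x₀)).congr fun _ hy => gradInner_symm_apply g ha hb hy

section Algebra

variable {g : RMetric n X} {a b c : X → ℝ} {x : X}

theorem IsSmoothMetric.gradInner_comm (hg : IsSmoothMetric g) (a b : X → ℝ) (x : X) :
    gradInner g a b x = gradInner g b a x :=
  (hg.isMetricOn x).coordGrad_comm (mem_extChartAt_target x)

theorem IsSmoothMetric.gradSq_nonneg (hg : IsSmoothMetric g) (a : X → ℝ) (x : X) :
    0 ≤ gradSq g a x :=
  (hg.isMetricOn x).coordGrad_self_nonneg (mem_extChartAt_target x) _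

theorem IsSmoothMetric.gradInner_sq_le (hg : IsSmoothMetric g) (a b : X → ℝ) (x : X) :
    gradInner g a b x ^ 2 ≤ gradSq g a x * gradSq g b x :=
  (hg.isMetricOn x).coordGrad_sq_le (mem_extChartAt_target x) _ _

theorem IsSmoothMetric.abs_gradInner_le (hg : IsSmoothMetric g) (a b : X → ℝ) (x : X) :
    |gradInner g a b x| ≤ Real.sqrt (gradSq g a x) * Real.sqrt (gradSq g b x) := by
  rw [← Real.sqrt_mul (hg.gradSq_nonneg a x)]
  exact Real.abs_le_sqrt (hg.gradInner_sq_le a b x)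

/-- The derivation rule, in the form that covers products, compositions and sums. -/
theorem gradInner_of_pd {p q : ℝ}
    (h : ∀ i, pd i (inChart x c) (extChartAt (𝓡 n) x x)
      = p * pd i (inChart x a) (extChartAt (𝓡 n) x x)
        + q * pd i (inChart x b) (extChartAt (𝓡 n) x x)) (d : X → ℝ) :
    gradInner g c d x = p * gradInner g a d x + q * gradInner g b d x := by
  simp only [gradInner, h, Finset.mul_sum, ← Finset.sum_add_distrib]
  exact Finset.sum_congr rfl fun i _ => Finset.sum_congr rfl fun j _ => by ring

theorem gradInner_mul_left (ha : ContMDiff (𝓡 n) 𝓘(ℝ, ℝ) ∞ a) (hb : ContMDiff (𝓡 n) 𝓘(ℝ, ℝ) ∞ b)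
    (d : X → ℝ) (x : X) :
    gradInner g (fun z => a z * b z) d x = b x * gradInner g a d x + a x * gradInner g b d x := by
  refine gradInner_of_pd (fun i => ?_) d
  have := pd_mul i (differentiableAt_inChart ha (mem_extChartAt_target x))
    (differentiableAt_inChart hb (mem_extChartAt_target x))
  have e : inChart (n := n) x (fun z => a z * b z) = fun y => inChart x a y * inChart x b y := rfl
  rw [e, this]
  simp only [inChart, extChartAt_to_inv]
  ring

theorem gradInner_add_left (ha : ContMDiff (𝓡 n) 𝓘(ℝ, ℝ) ∞ a) (hb : ContMDiff (𝓡 n) 𝓘(ℝ, ℝ) ∞ b)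
    (d : X → ℝ) (x : X) :
    gradInner g (fun z => a z + b z) d x = gradInner g a d x + gradInner g b d x := by
  rw [gradInner_of_pd (p := 1) (q := 1) (a := a) (b := b) (fun i => ?_) d, one_mul, one_mul]
  have := pd_add i (differentiableAt_inChart ha (mem_extChartAt_target x))
    (differentiableAt_inChart hb (mem_extChartAt_target x))
  have e : inChart (n := n) x (fun z => a z + b z) = fun y => inChart x a y + inChart x b y := rfl
  rw [e, this, one_mul, one_mul]

theorem gradInner_comp_left {φ : ℝ → ℝ} (hφ : DifferentiableAt ℝ φ (a x))
    (ha : ContMDiff (𝓡 n) 𝓘(ℝ, ℝ) ∞ a) (d : X → ℝ) :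
    gradInner g (fun z => φ (a z)) d x = deriv φ (a x) * gradInner g a d x := by
  have ex : inChart (n := n) x a (extChartAt (𝓡 n) x x) = a x := by
    simp only [inChart, extChartAt_to_inv]
  rw [gradInner_of_pd (p := deriv φ (a x)) (q := 0) (a := a) (b := a) (fun i => ?_) d, zero_mul,
    add_zero]
  have := pd_comp i (f := inChart x a) (y := extChartAt (𝓡 n) x x) (φ := φ) (by rwa [ex])
    (differentiableAt_inChart ha (mem_extChartAt_target x))
  have e : inChart (n := n) x (fun z => φ (a z)) = fun y => φ (inChart x a y) := rfl
  rw [e, this, ex, zero_mul, add_zero]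

/-- The locality of the gradient, used wherever a cutoff vanishes near a point. -/
theorem gradInner_eq_zero_of_eventually (h : a =ᶠ[𝓝 x] fun _ => (0 : ℝ)) (d : X → ℝ) :
    gradInner g a d x = 0 := by
  rw [gradInner_of_pd (p := 0) (q := 0) (a := a) (b := a) (fun i => ?_) d]
  · ring
  · have h1 : inChart (n := n) x a =ᶠ[𝓝 (extChartAt (𝓡 n) x x)] fun _ => (0 : ℝ) :=
      (continuousAt_extChartAt_symm (I := 𝓡 n) x).eventually
        (p := fun z => a z = 0) (by rwa [extChartAt_to_inv])
    simp only [pd, h1.fderiv_eq]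
    simp

theorem IsSmoothMetric.laplaceBeltrami_mul (hg : IsSmoothMetric g)
    (ha : ContMDiff (𝓡 n) 𝓘(ℝ, ℝ) ∞ a) (hb : ContMDiff (𝓡 n) 𝓘(ℝ, ℝ) ∞ b) (x : X) :
    laplaceBeltrami g (fun z => a z * b z) x
      = a x * laplaceBeltrami g b x + b x * laplaceBeltrami g a x + 2 * gradInner g a b x := by
  have := (hg.isMetricOn x).coordLap_mul (contDiffOn_inChart ha x) (contDiffOn_inChart hb x)
    (mem_extChartAt_target x)
  simp only [laplaceBeltrami_eq, gradInner_eq]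
  refine Eq.trans this ?_
  simp only [inChart, extChartAt_to_inv]

theorem IsSmoothMetric.laplaceBeltrami_comp (hg : IsSmoothMetric g) {φ : ℝ → ℝ} {U : Set ℝ}
    (hU : IsOpen U) (hφ : ContDiffOn ℝ ∞ φ U) (ha : ContMDiff (𝓡 n) 𝓘(ℝ, ℝ) ∞ a)
    (haU : ∀ z, a z ∈ U) (x : X) :
    laplaceBeltrami g (fun z => φ (a z)) x
      = deriv φ (a x) * laplaceBeltrami g a x + deriv (deriv φ) (a x) * gradSq g a x := by
  have := (hg.isMetricOn x).coordLap_comp hU hφ (contDiffOn_inChart ha x) (fun z _ => haU _)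
    (mem_extChartAt_target x)
  simp only [laplaceBeltrami_eq, gradSq, gradInner_eq]
  refine Eq.trans this ?_
  simp only [inChart, extChartAt_to_inv]

end Algebra

end Static

/-! ### Green's formula in coordinates. -/

theorem continuous_mul_of_tsupport_subset {Y : Type*} [TopologicalSpace Y] {f h : Y → ℝ} {Ω : Set Y}
    (hf : Continuous f) (hsub : tsupport f ⊆ Ω) (hΩ : IsOpen Ω) (hh : ContinuousOn h Ω) :
    Continuous fun y => f y * h y := by
  rw [continuous_iff_continuousAt]
  intro y
  by_cases hy : y ∈ tsupport f
  · exact hf.continuousAt.mul (hh.continuousAt (hΩ.mem_nhds (hsub hy)))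
  · have : (fun z => f z * h z) =ᶠ[𝓝 y] fun _ => 0 := by
      filter_upwards [(isClosed_tsupport f).isOpen_compl.mem_nhds hy] with z hz
      rw [image_eq_zero_of_notMem_tsupport hz, zero_mul]
    exact continuousAt_const.congr this.symm

theorem integrable_mul_of_tsupport_subset {n : ℕ} {f h : Model n → ℝ} {Ω : Set (Model n)}
    (hf : Continuous f) (hc : HasCompactSupport f) (hsub : tsupport f ⊆ Ω) (hΩ : IsOpen Ω)
    (hh : ContinuousOn h Ω) : Integrable fun y => f y * h y :=
  (continuous_mul_of_tsupport_subset hf hsub hΩ hh).integrable_of_hasCompactSupport hc.mul_right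

/-- Green's formula in coordinates. -/
theorem IsMetricOn.green {n : ℕ} {G : Model n → Matrix (Fin n) (Fin n) ℝ} {Ω : Set (Model n)}
    (hG : IsMetricOn G Ω) {f b : Model n → ℝ} (hf : ContDiff ℝ ∞ f) (hc : HasCompactSupport f)
    (hsub : tsupport f ⊆ Ω) (hb : ContDiffOn ℝ ∞ b Ω) :
    ∫ y in Ω, coordDens G y * (f y * coordLap G b y)
      = -∫ y in Ω, coordDens G y * coordGrad G f b y := by
  set W : Fin n → Model n → ℝ := fun i z => ∑ j, coordDens G z * (G z)⁻¹ i j * pd j b z with hW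
  have hWs : ∀ i, ContDiffOn ℝ ∞ (W i) Ω := fun i => ContDiffOn.sum fun j _ =>
    (hG.contDiffOn_coordDens.mul (hG.contDiffOn_inv i j)).mul (contDiffOn_pd hG.isOpen hb j)
  have hpf : ∀ i, tsupport (fun y => pd i f y) ⊆ tsupport f := fun i =>
    (tsupport_fderiv_apply_subset ℝ (EuclideanSpace.single i 1))
  have hpc : ∀ i, Continuous (fun y => pd i f y) := fun i =>
    (hf.continuous_fderiv (by simp)).clm_apply continuous_const
  have hpcs : ∀ i, HasCompactSupport (fun y => pd i f y) := fun i =>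
    hc.of_isClosed_subset (isClosed_tsupport _) (hpf i)
  have hi1 : ∀ i, Integrable fun y => f y * pd i (W i) y := fun i =>
    integrable_mul_of_tsupport_subset hf.continuous hc hsub hG.isOpen
      (contDiffOn_pd hG.isOpen (hWs i) i).continuousOn
  have hi2 : ∀ i, Integrable fun y => pd i f y * W i y := fun i =>
    integrable_mul_of_tsupport_subset (hpc i) (hpcs i) ((hpf i).trans hsub) hG.isOpen
      (hWs i).continuousOn
  have hi3 : ∀ i, Integrable fun y => f y * W i y := fun i =>
    integrable_mul_of_tsupport_subset hf.continuous hc hsub hG.isOpen (hWs i).continuousOn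
  -- `W` is the flux `√|G| G⁻¹ ∂b`. It is differentiable on the support of `f`, which is all that
  -- flat integration by parts over the whole space requires.
  have key : ∀ i, ∫ y, f y * pd i (W i) y = -∫ y, pd i f y * W i y := fun i =>
    integral_mul_fderiv_eq_neg_fderiv_mul_of_integrable (hi2 i) (hi1 i) (hi3 i)
      (fun y _ => (hf.differentiable (by simp)) y)
      (fun y hy => hG.diff (hWs i) (hsub hy))
  have hf0 : ∀ y, y ∉ Ω → f y = 0 := fun y hy =>
    image_eq_zero_of_notMem_tsupport fun h => hy (hsub h)
  have hpf0 : ∀ i y, y ∉ Ω → pd i f y = 0 := fun i y hy =>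
    image_eq_zero_of_notMem_tsupport fun h => hy (hsub (hpf i h))
  have e1 : ∫ y in Ω, coordDens G y * (f y * coordLap G b y) = ∑ i, ∫ y, f y * pd i (W i) y := by
    rw [← integral_finsetSum _ fun i _ => hi1 i,
      ← setIntegral_eq_integral_of_forall_compl_eq_zero (s := Ω)
        (f := fun y => ∑ i, f y * pd i (W i) y) (fun y hy => by simp [hf0 y hy])]
    refine setIntegral_congr_fun hG.isOpen.measurableSet fun y hy => ?_
    have hd := (hG.coordDens_pos hy).ne'
    simp only [coordLap, ← Finset.mul_sum]
    field_simp
    rfl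
  have e2 : ∫ y in Ω, coordDens G y * coordGrad G f b y = ∑ i, ∫ y, pd i f y * W i y := by
    rw [← integral_finsetSum _ fun i _ => hi2 i,
      ← setIntegral_eq_integral_of_forall_compl_eq_zero (s := Ω)
        (f := fun y => ∑ i, pd i f y * W i y) (fun y hy => by simp [hpf0 _ y hy])]
    refine setIntegral_congr_fun hG.isOpen.measurableSet fun y hy => ?_
    simp only [coordGrad, hW, Finset.mul_sum]
    exact Finset.sum_congr rfl fun i _ => Finset.sum_congr rfl fun j _ => by ring
  rw [e1, e2, Finset.sum_congr rfl fun i _ => key i, Finset.sum_neg_distrib]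

/-! ### Green's formula on the manifold and independence of the Laplacian from the chart. -/

section Green

variable {n : ℕ} {X : Type*} [TopologicalSpace X] [T2Space X] [ChartedSpace (Model n) X]
  [IsManifold (𝓡 n) ∞ X]

/-- A smooth function with compact support in a chart domain, read in the chart and extended
by zero. -/
theorem exists_extension_inChart {a : X → ℝ} (ha : ContMDiff (𝓡 n) 𝓘(ℝ, ℝ) ∞ a)
    (hc : HasCompactSupport a) {x₀ : X} (hsub : tsupport a ⊆ (extChartAt (𝓡 n) x₀).source) :
    ∃ f : Model n → ℝ, ContDiff ℝ ∞ f ∧ HasCompactSupport f ∧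
      tsupport f ⊆ (extChartAt (𝓡 n) x₀).target ∧
      ∀ y ∈ (extChartAt (𝓡 n) x₀).target, f y = inChart x₀ a y := by
  set K := extChartAt (𝓡 n) x₀ '' tsupport a with hK
  have hKc : IsCompact K := hc.isCompact.image_of_continuousOn ((continuousOn_extChartAt x₀).mono hsub)
  have hKt : K ⊆ (extChartAt (𝓡 n) x₀).target := by
    rintro _ ⟨x, hx, rfl⟩
    exact (extChartAt (𝓡 n) x₀).map_source (hsub hx)
  have ht := isOpen_extChartAt_target (I := 𝓡 n) x₀
  set f := (extChartAt (𝓡 n) x₀).target.indicator (inChart (n := n) x₀ a) with hf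
  have hf0 : ∀ y, y ∉ K → f y = 0 := by
    intro y hy
    by_cases hyt : y ∈ (extChartAt (𝓡 n) x₀).target
    · rw [hf, indicator_of_mem hyt]
      refine image_eq_zero_of_notMem_tsupport (f := a) fun h => hy ⟨_, h, ?_⟩
      exact (extChartAt (𝓡 n) x₀).right_inv hyt
    · rw [hf, indicator_of_notMem hyt]
  have hts : tsupport f ⊆ K := by
    refine closure_minimal (fun y hy => ?_) hKc.isClosed
    by_contra h
    exact hy (hf0 y h)
  refine ⟨f, ?_, hKc.of_isClosed_subset (isClosed_tsupport f) hts, hts.trans hKt,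
    fun y hy => indicator_of_mem hy _⟩
  rw [contDiff_iff_contDiffAt]
  intro y
  by_cases hy : y ∈ K
  · refine ((contDiffOn_inChart ha x₀).contDiffAt (ht.mem_nhds (hKt hy))).congr_of_eventuallyEq ?_
    filter_upwards [ht.mem_nhds (hKt hy)] with z hz using indicator_of_mem hz _
  · refine contDiffAt_const (c := (0 : ℝ)) |>.congr_of_eventuallyEq ?_
    filter_upwards [hKc.isClosed.isOpen_compl.mem_nhds hy] with z hz using hf0 z hz

variable [SecondCountableTopology X] [MeasurableSpace X] [BorelSpace X] {g : RMetric n X}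

/-- The Laplacian is written in the one chart that contains the support of `a`, since its
independence of the chart is not yet known. The right-hand side is intrinsic, and independence will
follow from this formula. -/
theorem IsSmoothMetric.green_chart (hg : IsSmoothMetric g) {a b : X → ℝ}
    (ha : ContMDiff (𝓡 n) 𝓘(ℝ, ℝ) ∞ a) (hc : HasCompactSupport a) {x₀ : X}
    (hsub : tsupport a ⊆ (extChartAt (𝓡 n) x₀).source) (hb : ContMDiff (𝓡 n) 𝓘(ℝ, ℝ) ∞ b) :
    ∫ x, a x * coordLap (metricMat g x₀) (inChart x₀ b) (extChartAt (𝓡 n) x₀ x) ∂(riemVolume g)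
      = -∫ x, gradInner g a b x ∂(riemVolume g) := by
  have hG := hg.isMetricOn x₀
  have ht := isOpen_extChartAt_target (I := 𝓡 n) x₀
  have ha0 : ∀ x, x ∉ (extChartAt (𝓡 n) x₀).source → a x = 0 := fun x hx =>
    image_eq_zero_of_notMem_tsupport fun h => hx (hsub h)
  rw [hg.integral_riemVolume x₀ (f := fun x => a x * coordLap (metricMat g x₀) (inChart x₀ b)
      (extChartAt (𝓡 n) x₀ x)) ?_ (fun x hx => by simp [ha0 x hx]),
    hg.integral_riemVolume x₀ (f := gradInner g a b)
      (hg.contMDiff_gradInner ha hb).continuous.continuousOn (fun x hx => ?_)]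
  · obtain ⟨f, hf, hfc, hft, hfa⟩ := exists_extension_inChart ha hc hsub
    have hgreen := hG.green hf hfc hft (contDiffOn_inChart hb x₀)
    have e1 : ∫ y in (extChartAt (𝓡 n) x₀).target, volDensity g x₀ y *
        (a ((extChartAt (𝓡 n) x₀).symm y) * coordLap (metricMat g x₀) (inChart x₀ b)
          (extChartAt (𝓡 n) x₀ ((extChartAt (𝓡 n) x₀).symm y)))
        = ∫ y in (extChartAt (𝓡 n) x₀).target, coordDens (metricMat g x₀) y *
          (f y * coordLap (metricMat g x₀) (inChart x₀ b) y) := by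
      refine setIntegral_congr_fun ht.measurableSet fun y hy => ?_
      simp only [hfa y hy, (extChartAt (𝓡 n) x₀).right_inv hy]
      rfl
    have e2 : ∫ y in (extChartAt (𝓡 n) x₀).target, volDensity g x₀ y *
        gradInner g a b ((extChartAt (𝓡 n) x₀).symm y)
        = ∫ y in (extChartAt (𝓡 n) x₀).target, coordDens (metricMat g x₀) y *
          coordGrad (metricMat g x₀) f (inChart x₀ b) y := by
      refine setIntegral_congr_fun ht.measurableSet fun y hy => ?_
      simp only [gradInner_symm_apply g ha hb hy, coordGrad]
      simp only [pd_congr ht hy _ hfa]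
      rfl
    rw [e1, e2, hgreen]
  · refine gradInner_eq_zero_of_eventually ?_ b
    filter_upwards [(isClosed_tsupport a).isOpen_compl.mem_nhds fun h => hx (hsub h)] with z hz
    exact image_eq_zero_of_notMem_tsupport hz
  · exact ha.continuous.continuousOn.mul ((hG.contDiffOn_coordLap
      (contDiffOn_inChart hb x₀)).continuousOn.comp (continuousOn_extChartAt x₀)
        fun x hx => (extChartAt (𝓡 n) x₀).map_source hx)

/-- The Laplace–Beltrami operator does not depend on the chart. -/
theorem IsSmoothMetric.laplaceBeltrami_eq_coordLap (hg : IsSmoothMetric g) {b : X → ℝ}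
    (hb : ContMDiff (𝓡 n) 𝓘(ℝ, ℝ) ∞ b) {x₀ x : X} (hx : x ∈ (extChartAt (𝓡 n) x₀).source) :
    laplaceBeltrami g b x
      = coordLap (metricMat g x₀) (inChart x₀ b) (extChartAt (𝓡 n) x₀ x) := by
  have : LocallyCompactSpace X := ChartedSpace.locallyCompactSpace (Model n) X
  have := isOpenPosMeasure_riemVolume g hg
  have := isLocallyFiniteMeasure_riemVolume g hg
  let D : X → X → ℝ := fun p z => coordLap (metricMat g p) (inChart p b) (extChartAt (𝓡 n) p z)
  have hD : ∀ p, ContinuousOn (D p) (extChartAt (𝓡 n) p).source := fun p =>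
    ((hg.isMetricOn p).contDiffOn_coordLap (contDiffOn_inChart hb p)).continuousOn.comp
      (continuousOn_extChartAt p) fun z hz => (extChartAt (𝓡 n) p).map_source hz
  set U := (extChartAt (𝓡 n) x₀).source ∩ (extChartAt (𝓡 n) x).source with hU
  have hUo : IsOpen U := (isOpen_extChartAt_source x₀).inter (isOpen_extChartAt_source x)
  have hDU : ContinuousOn (fun z => D x₀ z - D x z) U :=
    ((hD x₀).mono inter_subset_left).sub ((hD x).mono inter_subset_right)
  -- The expressions in the two charts have the same integral against every test function supported
  -- in the overlap, namely minus the integral of the gradient product. So they agree almost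
  -- everywhere there, and by continuity everywhere, since the volume charges open sets.
  have hae : ∀ᵐ z ∂(riemVolume g), z ∈ U → D x₀ z - D x z = 0 := by
    refine hUo.ae_eq_zero_of_integral_contMDiff_smul_eq_zero (𝓡 n)
      (hDU.locallyIntegrableOn hUo.measurableSet) fun a ha hac haU => ?_
    have hi : ∀ p, tsupport a ⊆ (extChartAt (𝓡 n) p).source →
        Integrable (fun z => a z * D p z) (riemVolume g) := fun p hp =>
      (continuous_mul_of_tsupport_subset ha.continuous hp (isOpen_extChartAt_source p)
        (hD p)).integrable_of_hasCompactSupport hac.mul_right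
    have h0 := haU.trans inter_subset_left
    have h1 := haU.trans inter_subset_right
    simp only [smul_eq_mul, mul_sub]
    rw [integral_sub (hi x₀ h0) (hi x h1), hg.green_chart ha hac h0 hb, hg.green_chart ha hac h1 hb,
      sub_self]
  have heq := Measure.eqOn_open_of_ae_eq (μ := riemVolume g) (g := fun _ => (0 : ℝ))
    ((ae_restrict_iff' hUo.measurableSet).2 hae) hUo hDU continuousOn_const
  have := heq (show x ∈ U from ⟨hx, mem_extChartAt_source x⟩)
  exact (sub_eq_zero.1 this).symm

theorem IsSmoothMetric.contMDiff_laplaceBeltrami (hg : IsSmoothMetric g) {b : X → ℝ}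
    (hb : ContMDiff (𝓡 n) 𝓘(ℝ, ℝ) ∞ b) : ContMDiff (𝓡 n) 𝓘(ℝ, ℝ) ∞ (laplaceBeltrami g b) :=
  contMDiff_of_inChart fun x₀ => ((hg.isMetricOn x₀).contDiffOn_coordLap
    (contDiffOn_inChart hb x₀)).congr fun y hy => by
      rw [inChart, hg.laplaceBeltrami_eq_coordLap hb ((extChartAt (𝓡 n) x₀).map_target hy),
        (extChartAt (𝓡 n) x₀).right_inv hy]

theorem hasCompactSupport_gradInner {a : X → ℝ} (hc : HasCompactSupport a) (b : X → ℝ) :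
    HasCompactSupport (gradInner g a b) := by
  refine hc.of_isClosed_subset (isClosed_tsupport _) (closure_minimal (fun x hx => ?_)
    (isClosed_tsupport a))
  by_contra h
  refine hx (gradInner_eq_zero_of_eventually ?_ b)
  filter_upwards [(isClosed_tsupport a).isOpen_compl.mem_nhds h] with z hz
  exact image_eq_zero_of_notMem_tsupport hz

theorem gradInner_sum_left {ι : Type*} (s : Finset ι) {a : ι → X → ℝ}
    (ha : ∀ i, ContMDiff (𝓡 n) 𝓘(ℝ, ℝ) ∞ (a i)) (d : X → ℝ) (x : X) :
    gradInner g (fun z => ∑ i ∈ s, a i z) d x = ∑ i ∈ s, gradInner g (a i) d x := by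
  classical
  induction s using Finset.induction_on with
  | empty =>
    simp only [Finset.sum_empty]
    exact gradInner_eq_zero_of_eventually (Eventually.of_forall fun _ => rfl) d
  | insert i s hi ih =>
    simp only [Finset.sum_insert hi]
    rw [gradInner_add_left (ha i) (contMDiff_finsetSum fun j _ => ha j), ih]

/-- **Green's formula** on a Riemannian manifold. -/
theorem IsSmoothMetric.green (hg : IsSmoothMetric g) {a b : X → ℝ}
    (ha : ContMDiff (𝓡 n) 𝓘(ℝ, ℝ) ∞ a) (hc : HasCompactSupport a)
    (hb : ContMDiff (𝓡 n) 𝓘(ℝ, ℝ) ∞ b) :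
    ∫ x, a x * laplaceBeltrami g b x ∂(riemVolume g)
      = -∫ x, gradInner g a b x ∂(riemVolume g) := by
  have := isLocallyFiniteMeasure_riemVolume g hg
  have : LocallyCompactSpace X := ChartedSpace.locallyCompactSpace (Model n) X
  obtain ⟨ρ, hρ⟩ := SmoothPartitionOfUnity.exists_isSubordinate_chartAt_source (𝓡 n) X
  have hfin := ρ.locallyFinite.finite_nonempty_inter_compact hc.isCompact
  set s := hfin.toFinset with hs
  -- Localisation by a partition of unity; only finitely many pieces meet the compact support of
  -- `a`.
  let A : X → X → ℝ := fun i x => ρ i x * a x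
  have hA : ∀ i, ContMDiff (𝓡 n) 𝓘(ℝ, ℝ) ∞ (A i) := fun i => (ρ i).contMDiff.mul ha
  have hAc : ∀ i, HasCompactSupport (A i) := fun i => hc.mul_left
  have hAs : ∀ i, tsupport (A i) ⊆ (extChartAt (𝓡 n) i).source := fun i => by
    rw [extChartAt_source]
    exact (tsupport_mul_subset_left).trans (hρ i)
  have hsum : a = fun x => ∑ i ∈ s, A i x := by
    funext x
    by_cases hx : x ∈ tsupport a
    · have h1 := ρ.sum_eq_one (mem_univ x)
      rw [finsum_eq_sum_of_support_subset (s := s)] at h1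
      · simp only [A]
        rw [← Finset.sum_mul, h1, one_mul]
      · intro i hi
        simp only [hs, Finite.coe_toFinset, mem_ofPred_eq]
        exact ⟨x, hi, hx⟩
    · have h0 := image_eq_zero_of_notMem_tsupport hx
      simp [A, h0]
  have hlap := (hg.contMDiff_laplaceBeltrami hb).continuous
  have hi1 : ∀ i, Integrable (fun x => A i x * laplaceBeltrami g b x) (riemVolume g) := fun i =>
    ((hA i).continuous.mul hlap).integrable_of_hasCompactSupport (hAc i).mul_right
  have hi2 : ∀ i, Integrable (gradInner g (A i) b) (riemVolume g) := fun i =>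
    (hg.contMDiff_gradInner (hA i) hb).continuous.integrable_of_hasCompactSupport
      (hasCompactSupport_gradInner (hAc i) b)
  have key : ∀ i, ∫ x, A i x * laplaceBeltrami g b x ∂(riemVolume g)
      = -∫ x, gradInner g (A i) b x ∂(riemVolume g) := by
    intro i
    rw [← hg.green_chart (hA i) (hAc i) (hAs i) hb]
    refine integral_congr_ae (Eventually.of_forall fun x => ?_)
    by_cases hx : x ∈ (extChartAt (𝓡 n) i).source
    · simp only [hg.laplaceBeltrami_eq_coordLap hb hx]
    · have h0 : A i x = 0 := image_eq_zero_of_notMem_tsupport fun h => hx (hAs i h)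
      simp [h0]
  rw [hsum]
  simp only [gradInner_sum_left s hA, Finset.sum_mul]
  rw [integral_finsetSum _ fun i _ => hi1 i, integral_finsetSum _ fun i _ => hi2 i,
    Finset.sum_congr rfl fun i _ => key i, Finset.sum_neg_distrib]

end Green

/-! ### Functions of time and coordinates, smooth up to the initial time. -/

section TimeCoordinates

variable {n : ℕ} {S : Set ℝ} {Ω : Set (Model n)} {u : ℝ → Model n → ℝ} {t : ℝ} {y : Model n}

theorem hasFDerivAt_slice (hΩ : IsOpen Ω)
    (hu : ContDiffOn ℝ ∞ (fun p : ℝ × Model n => u p.1 p.2) (S ×ˢ Ω)) (ht : t ∈ S) (hy : y ∈ Ω) :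
    HasFDerivAt (u t) ((fderivWithin ℝ (fun p : ℝ × Model n => u p.1 p.2) (S ×ˢ Ω) (t, y)).comp
      (ContinuousLinearMap.inr ℝ ℝ (Model n))) y := by
  have h1 : HasFDerivWithinAt (fun p : ℝ × Model n => u p.1 p.2) _ (S ×ˢ Ω) (t, y) :=
    ((hu.differentiableOn (by simp)) (t, y) ⟨ht, hy⟩).hasFDerivWithinAt
  have h2 : HasFDerivWithinAt (fun z : Model n => ((t, z) : ℝ × Model n))
      (ContinuousLinearMap.inr ℝ ℝ (Model n)) Ω y := (hasFDerivAt_prodMk_right t y).hasFDerivWithinAt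
  exact (h1.comp y h2 fun z hz => ⟨ht, hz⟩).hasFDerivAt (hΩ.mem_nhds hy)

theorem contDiffOn_pd_slice (hS : UniqueDiffOn ℝ S) (hΩ : IsOpen Ω)
    (hu : ContDiffOn ℝ ∞ (fun p : ℝ × Model n => u p.1 p.2) (S ×ˢ Ω)) (i : Fin n) :
    ContDiffOn ℝ ∞ (fun p : ℝ × Model n => pd i (u p.1) p.2) (S ×ˢ Ω) := by
  have h1 := (hu.fderivWithin (m := ∞) (hS.prod hΩ.uniqueDiffOn) (by simp)).clm_apply
    (contDiffOn_const (c := ((0 : ℝ), (EuclideanSpace.single i (1 : ℝ) : Model n))))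
  refine h1.congr fun p hp => ?_
  rw [pd, (hasFDerivAt_slice hΩ hu hp.1 hp.2).fderiv]
  simp

theorem hasDerivWithinAt_slice
    (hu : ContDiffOn ℝ ∞ (fun p : ℝ × Model n => u p.1 p.2) (S ×ˢ Ω)) (ht : t ∈ S) (hy : y ∈ Ω) :
    HasDerivWithinAt (fun s => u s y)
      (fderivWithin ℝ (fun p : ℝ × Model n => u p.1 p.2) (S ×ˢ Ω) (t, y) (1, 0)) S t := by
  have h1 : HasFDerivWithinAt (fun p : ℝ × Model n => u p.1 p.2) _ (S ×ˢ Ω) (t, y) :=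
    ((hu.differentiableOn (by simp)) (t, y) ⟨ht, hy⟩).hasFDerivWithinAt
  have h2 : HasDerivWithinAt (fun s : ℝ => ((s, y) : ℝ × Model n)) (1, 0) S t :=
    (hasDerivWithinAt_id t S).prodMk (hasDerivWithinAt_const t S y)
  exact h1.comp_hasDerivWithinAt_of_eq t h2 (fun s hs => ⟨hs, hy⟩) rfl

theorem contDiffOn_derivWithin_slice (hS : UniqueDiffOn ℝ S) (hΩ : IsOpen Ω)
    (hu : ContDiffOn ℝ ∞ (fun p : ℝ × Model n => u p.1 p.2) (S ×ˢ Ω)) :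
    ContDiffOn ℝ ∞ (fun p : ℝ × Model n => derivWithin (fun s => u s p.2) S p.1) (S ×ˢ Ω) := by
  have h1 := (hu.fderivWithin (m := ∞) (hS.prod hΩ.uniqueDiffOn) (by simp)).clm_apply
    (contDiffOn_const (c := ((1 : ℝ), (0 : Model n))))
  exact h1.congr fun p hp =>
    (hasDerivWithinAt_slice hu hp.1 hp.2).derivWithin (hS p.1 hp.1)

/-- Time derivatives commute with partial derivatives. -/
theorem hasDerivAt_pd_slice (hΩ : IsOpen Ω)
    (hu : ContDiffOn ℝ ∞ (fun p : ℝ × Model n => u p.1 p.2) (S ×ˢ Ω)) (ht : S ∈ 𝓝 t) (hy : y ∈ Ω)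
    (i : Fin n) :
    HasDerivAt (fun s => pd i (u s) y) (pd i (fun z => deriv (fun s => u s z) t) y) t := by
  set F := fun p : ℝ × Model n => u p.1 p.2 with hF
  set e : Model n := EuclideanSpace.single i 1
  -- On the interior the within-derivatives are genuine derivatives, and symmetry of the second
  -- derivative of `F` on the product exchanges the two.
  have hFo : ContDiffOn ℝ ∞ F (interior S ×ˢ Ω) := hu.mono (prod_mono interior_subset le_rfl)
  have ho : IsOpen (interior S ×ˢ Ω) := isOpen_interior.prod hΩ
  have ht' : t ∈ interior S := mem_interior_iff_mem_nhds.2 ht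
  have hc : ContDiffAt ℝ ∞ F (t, y) := hFo.contDiffAt (ho.mem_nhds ⟨ht', hy⟩)
  have hsym : IsSymmSndFDerivAt ℝ F (t, y) :=
    hc.isSymmSndFDerivAt (by rw [minSmoothness_of_isRCLikeNormedField]; exact WithTop.coe_le_coe.2 le_top)
  have hd : HasFDerivAt (fderiv ℝ F) (fderiv ℝ (fderiv ℝ F) (t, y)) (t, y) :=
    ((hc.fderiv_right (m := ∞) (by simp)).differentiableAt (by simp)).hasFDerivAt
  have hd1 : ∀ s ∈ interior S, ∀ z ∈ Ω, pd i (u s) z = fderiv ℝ F (s, z) (0, e) := by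
    intro s hs z hz
    rw [pd, (hasFDerivAt_slice hΩ hFo hs hz).fderiv, fderivWithin_of_isOpen ho ⟨hs, hz⟩]
    simp [e, hF]
  have hd2 : ∀ z ∈ Ω, deriv (fun s => u s z) t = fderiv ℝ F (t, z) (1, 0) := by
    intro z hz
    rw [((hasDerivWithinAt_slice hFo ht' hz).hasDerivAt (isOpen_interior.mem_nhds ht')).deriv,
      fderivWithin_of_isOpen ho ⟨ht', hz⟩]
  have h1 : HasDerivAt (fun s => fderiv ℝ F (s, y) (0, e))
      (fderiv ℝ (fderiv ℝ F) (t, y) (1, 0) (0, e)) t := by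
    have h2 : HasDerivAt (fun s : ℝ => ((s, y) : ℝ × Model n)) (1, 0) t :=
      (hasDerivAt_id t).prodMk (hasDerivAt_const t y)
    have h3 : HasDerivAt (fun s => fderiv ℝ F (s, y)) (fderiv ℝ (fderiv ℝ F) (t, y) (1, 0)) t :=
      hd.comp_hasDerivAt_of_eq t h2 rfl
    simpa using h3.clm_apply (hasDerivAt_const t ((0 : ℝ), e))
  have h4 : pd i (fun z => deriv (fun s => u s z) t) y
      = fderiv ℝ (fderiv ℝ F) (t, y) (0, e) (1, 0) := by
    rw [pd_congr hΩ hy i hd2]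
    have h2 : HasFDerivAt (fun z : Model n => ((t, z) : ℝ × Model n))
      (ContinuousLinearMap.inr ℝ ℝ (Model n)) y := hasFDerivAt_prodMk_right t y
    have h3 := (HasFDerivAt.comp y (f := fun z : Model n => ((t, z) : ℝ × Model n)) hd h2).clm_apply
      (hasFDerivAt_const ((1 : ℝ), (0 : Model n)) y)
    have h5 := h3.fderiv
    simp only [Function.comp_def] at h5
    rw [pd, h5]
    simp [e]
  rw [h4, ← hsym.eq (1, 0) (0, e)]
  refine h1.congr_of_eventuallyEq ?_
  filter_upwards [isOpen_interior.mem_nhds ht'] with s hs using hd1 s hs y hy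

end TimeCoordinates

/-! ### Smooth time-dependent functions, metrics and volume ratios on the manifold. -/

section SmoothT

variable {n : ℕ} {X : Type*} [TopologicalSpace X] [ChartedSpace (Model n) X]

/-- Smoothness on `S × X`, read in the charts of `X`. -/
def SmoothT (n : ℕ) {X : Type*} [TopologicalSpace X] [ChartedSpace (Model n) X] (S : Set ℝ)
    (f : ℝ → X → ℝ) : Prop :=
  ∀ x₀ : X, ContDiffOn ℝ ∞ (fun p : ℝ × Model n => inChart x₀ (f p.1) p.2)
    (S ×ˢ (extChartAt (𝓡 n) x₀).target)

/-- The time derivative of `f`, one-sided at the boundary of `S`. -/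
def dtime (S : Set ℝ) (f : ℝ → X → ℝ) (t : ℝ) (x : X) : ℝ := derivWithin (fun s => f s x) S t

variable {S : Set ℝ} {f h : ℝ → X → ℝ} {t : ℝ}

theorem SmoothT.add (hf : SmoothT n S f) (hh : SmoothT n S h) :
    SmoothT n S fun t x => f t x + h t x := fun x₀ => (hf x₀).add (hh x₀)

theorem SmoothT.mul (hf : SmoothT n S f) (hh : SmoothT n S h) :
    SmoothT n S fun t x => f t x * h t x := fun x₀ => (hf x₀).mul (hh x₀)

theorem smoothT_const (c : ℝ) : SmoothT n S fun _ (_ : X) => c := fun _ => contDiffOn_const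

theorem SmoothT.comp (hf : SmoothT n S f) {φ : ℝ → ℝ} {U : Set ℝ} (hφ : ContDiffOn ℝ ∞ φ U)
    (hU : ∀ t ∈ S, ∀ x, f t x ∈ U) : SmoothT n S fun t x => φ (f t x) :=
  fun x₀ => hφ.comp (hf x₀) fun p hp => hU p.1 hp.1 _

theorem SmoothT.dtime (hf : SmoothT n S f) (hS : UniqueDiffOn ℝ S) :
    SmoothT n S (MultiscaleLSI.dtime S f) :=
  fun x₀ => contDiffOn_derivWithin_slice (u := fun s => inChart x₀ (f s)) hS
    (isOpen_extChartAt_target x₀) (hf x₀)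

theorem dtime_eq_deriv (ht : S ∈ 𝓝 t) (x : X) : dtime S f t x = deriv (fun s => f s x) t :=
  derivWithin_of_mem_nhds ht

theorem SmoothT.hasDerivWithinAt (hf : SmoothT n S f) (ht : t ∈ S) (x : X) :
    HasDerivWithinAt (fun s => f s x) (MultiscaleLSI.dtime S f t x) S t := by
  have h1 := hasDerivWithinAt_slice (u := fun s => inChart x (f s)) (hf x) ht
    (mem_extChartAt_target x)
  simp only [inChart, extChartAt_to_inv] at h1
  exact (h1.differentiableWithinAt).hasDerivWithinAt

theorem SmoothT.hasDerivAt (hf : SmoothT n S f) (ht : S ∈ 𝓝 t) (x : X) :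
    HasDerivAt (fun s => f s x) (MultiscaleLSI.dtime S f t x) t :=
  (hf.hasDerivWithinAt (mem_of_mem_nhds ht) x).hasDerivAt ht

theorem SmoothT.continuousOn (hf : SmoothT n S f) :
    ContinuousOn (fun p : ℝ × X => f p.1 p.2) (S ×ˢ univ) := by
  rintro ⟨t, x⟩ ⟨ht, -⟩
  have hs := isOpen_extChartAt_source (I := 𝓡 n) x
  have h1 : ContinuousOn (fun p : ℝ × X => inChart (n := n) x (f p.1) (extChartAt (𝓡 n) x p.2))
      (S ×ˢ (extChartAt (𝓡 n) x).source) := by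
    refine (hf x).continuousOn.comp (f := fun p : ℝ × X => (p.1, extChartAt (𝓡 n) x p.2)) ?_ ?_
    · exact continuousOn_fst.prodMk ((continuousOn_extChartAt x).comp continuousOn_snd
        fun p hp => hp.2)
    · exact fun p hp => ⟨hp.1, (extChartAt (𝓡 n) x).map_source hp.2⟩
  have h2 : ContinuousOn (fun p : ℝ × X => f p.1 p.2) (S ×ˢ (extChartAt (𝓡 n) x).source) := by
    refine h1.congr fun p hp => ?_
    simp only [inChart]
    rw [(extChartAt (𝓡 n) x).left_inv hp.2]
  refine (h2 (t, x) ⟨ht, mem_extChartAt_source x⟩).mono_of_mem_nhdsWithin ?_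
  rw [nhdsWithin_prod_eq, nhdsWithin_univ]
  exact prod_mem_prod self_mem_nhdsWithin (hs.mem_nhds (mem_extChartAt_source x))

theorem SmoothT.exists_bound (hf : SmoothT n S f) {A : Set ℝ} (hA : IsCompact A) (hAS : A ⊆ S)
    {K : Set X} (hK : IsCompact K) : ∃ C, ∀ t ∈ A, ∀ x ∈ K, |f t x| ≤ C := by
  obtain ⟨C, hC⟩ := (hA.prod hK).exists_bound_of_continuousOn
    (hf.continuousOn.mono (prod_mono hAS (subset_univ K)))
  exact ⟨C, fun t ht x hx => by simpa using hC (t, x) ⟨ht, hx⟩⟩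

variable [IsManifold (𝓡 n) ∞ X]

theorem smoothT_static {a : X → ℝ} (ha : ContMDiff (𝓡 n) 𝓘(ℝ, ℝ) ∞ a) :
    SmoothT n S fun _ => a :=
  fun x₀ => (contDiffOn_inChart ha x₀).comp contDiffOn_snd fun _ hp => hp.2

theorem SmoothT.slice (hf : SmoothT n S f) (ht : t ∈ S) : ContMDiff (𝓡 n) 𝓘(ℝ, ℝ) ∞ (f t) :=
  contMDiff_of_inChart fun x₀ => (hf x₀).comp (contDiffOn_const.prodMk contDiffOn_id)
    fun _ hy => ⟨ht, hy⟩

theorem SmoothInTime.smoothT {T : EReal} (hf : SmoothInTime n T f) : SmoothT n (timeSet T) f := by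
  intro x₀
  have h1 : ContMDiffOn 𝓘(ℝ, Model n) (𝓡 n) ∞ (extChartAt (𝓡 n) x₀).symm
    (extChartAt (𝓡 n) x₀).target := contMDiffOn_extChartAt_symm x₀
  have h2 : ContMDiffOn 𝓘(ℝ, ℝ × Model n) (𝓘(ℝ, ℝ).prod (𝓡 n)) ∞
      (fun p : ℝ × Model n => (p.1, (extChartAt (𝓡 n) x₀).symm p.2))
      (timeSet T ×ˢ (extChartAt (𝓡 n) x₀).target) := by
    refine ContMDiffOn.prodMk contDiffOn_fst.contMDiffOn ?_
    exact h1.comp contDiffOn_snd.contMDiffOn fun p hp => hp.2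
  exact (ContMDiffOn.comp hf h2 fun p hp => ⟨hp.1, mem_univ _⟩).contDiffOn

/-- The components of the time-dependent metric are smooth on `S × X`. -/
def SmoothMetricT (S : Set ℝ) (g : ℝ → RMetric n X) : Prop :=
  ∀ (x₀ : X) (i j : Fin n), ContDiffOn ℝ ∞ (fun p : ℝ × Model n => metricMat (g p.1) x₀ p.2 i j)
    (S ×ˢ (extChartAt (𝓡 n) x₀).target)

variable {g : ℝ → RMetric n X}

theorem SmoothMetricT.slice (hg : SmoothMetricT S g) (ht : t ∈ S) : IsSmoothMetric (g t) :=
  fun x₀ i j => (hg x₀ i j).comp (contDiffOn_const.prodMk contDiffOn_id) fun _ hy => ⟨ht, hy⟩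

theorem SmoothMetricT.contDiffOn_det (hg : SmoothMetricT S g) (x₀ : X) :
    ContDiffOn ℝ ∞ (fun p : ℝ × Model n => (metricMat (g p.1) x₀ p.2).det)
      (S ×ˢ (extChartAt (𝓡 n) x₀).target) := by
  simp only [Matrix.det_apply]
  exact ContDiffOn.sum fun σ _ => (contDiffOn_prod fun i _ => hg x₀ _ _).const_smul _

theorem SmoothMetricT.contDiffOn_inv (hg : SmoothMetricT S g) (x₀ : X) (i j : Fin n) :
    ContDiffOn ℝ ∞ (fun p : ℝ × Model n => (metricMat (g p.1) x₀ p.2)⁻¹ i j)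
      (S ×ˢ (extChartAt (𝓡 n) x₀).target) := by
  have h1 : ContDiffOn ℝ ∞ (fun p : ℝ × Model n => (metricMat (g p.1) x₀ p.2).adjugate i j)
      (S ×ˢ (extChartAt (𝓡 n) x₀).target) := by
    simp only [Matrix.adjugate_apply, Matrix.det_apply]
    refine ContDiffOn.sum fun σ _ => (contDiffOn_prod fun k _ => ?_).const_smul _
    simp only [Matrix.updateRow_apply]
    split_ifs
    · exact contDiffOn_const
    · exact hg x₀ _ _
  refine (((hg.contDiffOn_det x₀).inv fun p hp =>
    (posDef_metricMat (g p.1) hp.2).det_pos.ne').mul h1).congr fun p hp => ?_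
  simp [Matrix.inv_def, Ring.inverse_eq_inv]

theorem SmoothMetricT.contDiffOn_volDensity (hg : SmoothMetricT S g) (x₀ : X) :
    ContDiffOn ℝ ∞ (fun p : ℝ × Model n => volDensity (g p.1) x₀ p.2)
      (S ×ˢ (extChartAt (𝓡 n) x₀).target) := by
  refine ((hg.contDiffOn_det x₀).sqrt fun p hp =>
    (posDef_metricMat (g p.1) hp.2).det_pos.ne').congr fun p hp => ?_
  rw [volDensity, abs_of_pos (posDef_metricMat (g p.1) hp.2).det_pos]

theorem SmoothMetricT.smoothT_gradInner (hg : SmoothMetricT S g) (hS : UniqueDiffOn ℝ S)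
    (hf : SmoothT n S f) (hh : SmoothT n S h) :
    SmoothT n S fun t => gradInner (g t) (f t) (h t) := by
  intro x₀
  have ho := isOpen_extChartAt_target (I := 𝓡 n) x₀
  have h1 : ContDiffOn ℝ ∞ (fun p : ℝ × Model n => coordGrad (metricMat (g p.1) x₀)
      (inChart x₀ (f p.1)) (inChart x₀ (h p.1)) p.2) (S ×ˢ (extChartAt (𝓡 n) x₀).target) :=
    ContDiffOn.sum fun i _ => ContDiffOn.sum fun j _ =>
      ((hg.contDiffOn_inv x₀ i j).mul
        (contDiffOn_pd_slice (u := fun s => inChart x₀ (f s)) hS ho (hf x₀) i)).mul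
        (contDiffOn_pd_slice (u := fun s => inChart x₀ (h s)) hS ho (hh x₀) j)
  refine h1.congr fun p hp => ?_
  exact gradInner_symm_apply (g p.1) (hf.slice hp.1) (hh.slice hp.1) hp.2

/-- The density of the Riemannian volume of `g'` with respect to that of `g`. -/
def volRatio (g g' : RMetric n X) (x : X) : ℝ :=
  volDensity g' x (extChartAt (𝓡 n) x x) / volDensity g x (extChartAt (𝓡 n) x x)

/-- Both densities acquire the same Jacobian factor under a change of chart. -/
theorem volRatio_eq (g g' : RMetric n X) {x₀ x : X} (hx : x ∈ (extChartAt (𝓡 n) x₀).source) :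
    volRatio g g' x = volDensity g' x₀ (extChartAt (𝓡 n) x₀ x)
      / volDensity g x₀ (extChartAt (𝓡 n) x₀ x) := by
  have : Nonempty (RMetric n X) := ⟨g⟩
  rw [volDensity_change g (overlap_self_mem hx), volDensity_change g' (overlap_self_mem hx),
    chartTrans_self hx, mul_div_mul_left _ _ (abs_ne_zero.2
      (det_chartJac_ne_zero (overlap_self_mem hx)))]
  rfl

theorem volRatio_pos (g g' : RMetric n X) (x : X) : 0 < volRatio g g' x :=
  div_pos (volDensity_pos g' (mem_extChartAt_target x)) (volDensity_pos g (mem_extChartAt_target x))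

theorem SmoothMetricT.smoothT_volRatio (hg : SmoothMetricT S g) {t₀ : ℝ} (ht₀ : t₀ ∈ S) :
    SmoothT n S fun t => volRatio (g t₀) (g t) := by
  intro x₀
  have h0 : ContDiffOn ℝ ∞ (fun p : ℝ × Model n => volDensity (g t₀) x₀ p.2)
      (S ×ˢ (extChartAt (𝓡 n) x₀).target) :=
    ((hg.slice ht₀).isMetricOn x₀).contDiffOn_coordDens.comp contDiffOn_snd fun p hp => hp.2
  refine ((hg.contDiffOn_volDensity x₀).div h0 fun p hp => (volDensity_pos _ hp.2).ne').congr
    fun p hp => ?_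
  simp only [inChart, Pi.div_apply]
  rw [volRatio_eq _ _ ((extChartAt (𝓡 n) x₀).map_target hp.2),
    (extChartAt (𝓡 n) x₀).right_inv hp.2]

/-- It suffices to compare both sides on chart domains, where each is an explicit density. This lets
the volumes at all times be expressed by the one at time `0`. -/
theorem riemVolume_eq_withDensity [MeasurableSpace X] [BorelSpace X] [SecondCountableTopology X]
    {g g' : RMetric n X} (hg : IsSmoothMetric g) (hr : Continuous (volRatio g g')) :
    riemVolume g' = (riemVolume g).withDensity fun x => ENNReal.ofReal (volRatio g g' x) := by
  refine measure_ext_of_charts n fun x₀ => ?_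
  have hs := (isOpen_extChartAt_source (I := 𝓡 n) x₀).measurableSet
  have hrm : Measurable fun x => ENNReal.ofReal (volRatio g g' x) :=
    hr.measurable.ennreal_ofReal
  rw [restrict_withDensity hs, restrict_riemVolume, restrict_riemVolume]
  ext s hsm
  rw [chartVolume_apply g' x₀ hsm, withDensity_apply _ hsm, chartVolume]
  have hsymm : AEMeasurable (extChartAt (𝓡 n) x₀).symm
      ((volume.restrict (extChartAt (𝓡 n) x₀).target).withDensity
        fun y => ENNReal.ofReal (volDensity g x₀ y)) :=
    (aemeasurable_symm x₀ _).mono_ac (withDensity_absolutelyContinuous _ _)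
  have hd : AEMeasurable (fun y => ENNReal.ofReal (volDensity g x₀ y))
      (volume.restrict (extChartAt (𝓡 n) x₀).target) :=
    ((hg.continuousOn_volDensity x₀).aemeasurable
      (isOpen_extChartAt_target x₀).measurableSet).ennreal_ofReal
  have ht := (isOpen_extChartAt_target (I := 𝓡 n) x₀).measurableSet
  have hA := measurableSet_symm_preimage (n := n) x₀ hsm
  set A := (extChartAt (𝓡 n) x₀).symm ⁻¹' s ∩ (extChartAt (𝓡 n) x₀).target with hAdef
  have hcomp : AEMeasurable (fun y => s.indicator (fun x => ENNReal.ofReal (volRatio g g' x))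
      ((extChartAt (𝓡 n) x₀).symm y)) (volume.restrict (extChartAt (𝓡 n) x₀).target) :=
    (hrm.indicator hsm).comp_aemeasurable (aemeasurable_symm x₀ _)
  rw [← lintegral_indicator hsm, lintegral_map' (hrm.indicator hsm).aemeasurable hsymm,
    lintegral_withDensity_eq_lintegral_mul₀ hd hcomp,
    show volume.restrict A = (volume.restrict (extChartAt (𝓡 n) x₀).target).restrict A by
      rw [Measure.restrict_restrict hA, inter_eq_self_of_subset_left inter_subset_right],
    ← lintegral_indicator hA]
  refine setLIntegral_congr_fun ht fun y hy => ?_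
  by_cases hys : (extChartAt (𝓡 n) x₀).symm y ∈ s
  · have hyA : y ∈ A := ⟨hys, hy⟩
    simp only [indicator_of_mem hyA, Pi.mul_apply, indicator_of_mem hys]
    rw [volRatio_eq _ _ ((extChartAt (𝓡 n) x₀).map_target hy), (extChartAt (𝓡 n) x₀).right_inv hy,
      ← ENNReal.ofReal_mul (volDensity_pos g hy).le, mul_div_cancel₀ _ (volDensity_pos g hy).ne']
  · have hyA : y ∉ A := fun h => hys h.1
    simp only [indicator_of_notMem hyA, Pi.mul_apply, indicator_of_notMem hys, mul_zero]

end SmoothT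

/-! ### The time interval. -/

section TimeSet

variable {T : EReal} {t : ℝ}

theorem zero_mem_timeSet (hT : 0 < T) : (0 : ℝ) ∈ timeSet T := ⟨le_rfl, by simpa using hT⟩

theorem Icc_subset_timeSet (ht : t ∈ timeSet T) : Icc 0 t ⊆ timeSet T := fun _ hs =>
  ⟨hs.1, lt_of_le_of_lt (EReal.coe_le_coe_iff.2 hs.2) ht.2⟩

theorem isOpen_lt_coe (T : EReal) : IsOpen {t : ℝ | (t : EReal) < T} :=
  isOpen_Iio.preimage continuous_coe_real_ereal

theorem timeSet_mem_nhds (ht : t ∈ timeSet T) (h0 : 0 < t) : timeSet T ∈ 𝓝 t := by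
  filter_upwards [isOpen_Ioi.mem_nhds h0, (isOpen_lt_coe T).mem_nhds ht.2] with s hs hs'
  exact ⟨le_of_lt hs, hs'⟩

theorem exists_pos_mem_timeSet (hT : 0 < T) : ∃ t ∈ timeSet T, 0 < t := by
  obtain ⟨t, h0, h1⟩ := EReal.lt_iff_exists_real_btwn.1 hT
  have h0' : 0 < t := by exact_mod_cast h0
  exact ⟨t, ⟨h0'.le, h1⟩, h0'⟩

theorem exists_gt_mem_timeSet (ht : t ∈ timeSet T) : ∃ s ∈ timeSet T, t < s := by
  obtain ⟨s, h0, h1⟩ := EReal.lt_iff_exists_real_btwn.1 ht.2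
  have h0' : t < s := by exact_mod_cast h0
  exact ⟨s, ⟨ht.1.trans h0'.le, h1⟩, h0'⟩

theorem uniqueDiffOn_timeSet (hT : 0 < T) : UniqueDiffOn ℝ (timeSet T) := by
  refine uniqueDiffOn_convex ?_ ?_
  · refine Set.OrdConnected.convex ⟨fun a ha b hb s hs => ?_⟩
    exact ⟨ha.1.trans hs.1, lt_of_le_of_lt (EReal.coe_le_coe_iff.2 hs.2) hb.2⟩
  · obtain ⟨t, ht, h0⟩ := exists_pos_mem_timeSet hT
    exact ⟨t, mem_interior_iff_mem_nhds.2 (timeSet_mem_nhds ht h0)⟩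

end TimeSet

/-! ### The measures `μ_t` relative to `μ_0`, and differentiation under the integral. -/

section WeakEvolution

variable {n : ℕ} {X : Type*} [TopologicalSpace X] [T2Space X] [SecondCountableTopology X]
  [ChartedSpace (Model n) X] [IsManifold (𝓡 n) ∞ X] [MeasurableSpace X] [BorelSpace X]

theorem integral_weightedMeasure {g : RMetric n X} {Z V : X → ℝ} (hZ : Continuous Z)
    (hV : Continuous V) (hZ0 : ∀ x, 0 < Z x) (f : X → ℝ) :
    ∫ x, f x ∂(weightedMeasure g Z V)
      = ∫ x, Real.exp (-V x) * Z x * f x ∂(riemVolume g) := by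
  have hm : Measurable fun x => ENNReal.ofReal (Real.exp (-V x) * Z x) :=
    ((Real.continuous_exp.comp hV.neg).mul hZ).measurable.ennreal_ofReal
  rw [weightedMeasure, integral_withDensity_eq_integral_toReal_smul hm
    (Eventually.of_forall fun _ => ENNReal.ofReal_lt_top)]
  refine integral_congr_ae (Eventually.of_forall fun x => ?_)
  simp only [smul_eq_mul]
  rw [ENNReal.toReal_ofReal (mul_pos (Real.exp_pos _) (hZ0 x)).le]

theorem isOpenPosMeasure_weightedMeasure {g : RMetric n X} (hg : IsSmoothMetric g) {Z V : X → ℝ}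
    (hZ : Continuous Z) (hV : Continuous V) (hZ0 : ∀ x, 0 < Z x) :
    (weightedMeasure g Z V).IsOpenPosMeasure := by
  have := isOpenPosMeasure_riemVolume g hg
  have hm : Measurable fun x => ENNReal.ofReal (Real.exp (-V x) * Z x) :=
    ((Real.continuous_exp.comp hV.neg).mul hZ).measurable.ennreal_ofReal
  have hac : riemVolume g ≪ weightedMeasure g Z V :=
    withDensity_absolutelyContinuous' hm.aemeasurable (Eventually.of_forall fun x => by
      simpa using mul_pos (Real.exp_pos _) (hZ0 x))
  exact hac.isOpenPosMeasure

/-- The density of `e^{-V_t} Z_t dm_{g_t}` with respect to `e^{-V_0} Z_0 dm_{g_0}`. -/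
def weightRatio (g : ℝ → RMetric n X) (Z V : ℝ → X → ℝ) (t : ℝ) (x : X) : ℝ :=
  Real.exp (-V t x) * Z t x * volRatio (g 0) (g t) x * (Real.exp (-V 0 x) * Z 0 x)⁻¹

namespace IsRenormFlow

variable {T : EReal} {g : ℝ → RMetric n X} {Z V : ℝ → X → ℝ} {t : ℝ}

theorem smoothMetricT (hF : IsRenormFlow T g Z V) : SmoothMetricT (timeSet T) g := hF.smooth_metric

theorem isSmoothMetric (hF : IsRenormFlow T g Z V) (ht : t ∈ timeSet T) : IsSmoothMetric (g t) :=
  hF.smoothMetricT.slice ht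

theorem smoothT_Z (hF : IsRenormFlow T g Z V) : SmoothT n (timeSet T) Z := hF.smooth_Z.smoothT

theorem smoothT_V (hF : IsRenormFlow T g Z V) : SmoothT n (timeSet T) V := hF.smooth_V.smoothT

theorem smoothT_exp (hF : IsRenormFlow T g Z V) :
    SmoothT n (timeSet T) fun t x => Real.exp (-V t x) :=
  hF.smoothT_V.comp (φ := fun r => Real.exp (-r)) (U := univ)
    (Real.contDiff_exp.comp contDiff_neg).contDiffOn fun _ _ _ => mem_univ _

theorem smoothT_logZ (hF : IsRenormFlow T g Z V) :
    SmoothT n (timeSet T) fun t x => Real.log (Z t x) :=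
  hF.smoothT_Z.comp (φ := Real.log) (U := Ioi 0)
    (Real.contDiffOn_log.mono fun _ hx => (ne_of_gt hx : _ ≠ (0 : ℝ))) hF.Z_pos

theorem smoothT_weightRatio (hF : IsRenormFlow T g Z V) (hT : 0 < T) :
    SmoothT n (timeSet T) (weightRatio g Z V) := by
  have h0 := zero_mem_timeSet hT
  refine ((hF.smoothT_exp.mul hF.smoothT_Z).mul (hF.smoothMetricT.smoothT_volRatio h0)).mul ?_
  have h1 : SmoothT n (timeSet T) fun _ x => Real.exp (-V 0 x) * Z 0 x :=
    (smoothT_static (hF.smoothT_exp.slice h0)).mul (smoothT_static (hF.smoothT_Z.slice h0))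
  exact h1.comp (φ := fun r => r⁻¹) (U := Ioi 0)
    (contDiffOn_id.inv fun x hx => (ne_of_gt hx : x ≠ 0))
    fun _ _ x => mul_pos (Real.exp_pos _) (hF.Z_pos 0 h0 x)

theorem weightRatio_pos (hF : IsRenormFlow T g Z V) (hT : 0 < T) (ht : t ∈ timeSet T) (x : X) :
    0 < weightRatio g Z V t x :=
  mul_pos (mul_pos (mul_pos (Real.exp_pos _) (hF.Z_pos t ht x)) (volRatio_pos _ _ x))
    (inv_pos.2 (mul_pos (Real.exp_pos _) (hF.Z_pos 0 (zero_mem_timeSet hT) x)))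

/-- All time dependence is moved from the measure into a smooth positive density, so integrals over
`μ_t` can be differentiated as integrals over one fixed finite measure. -/
theorem weightedMeasure_eq_withDensity (hF : IsRenormFlow T g Z V) (hT : 0 < T)
    (ht : t ∈ timeSet T) :
    weightedMeasure (g t) (Z t) (V t) = (weightedMeasure (g 0) (Z 0) (V 0)).withDensity
      fun x => ENNReal.ofReal (weightRatio g Z V t x) := by
  have h0 := zero_mem_timeSet hT
  have hr := ((hF.smoothMetricT.smoothT_volRatio h0).slice ht).continuous
  have hm : ∀ {s}, s ∈ timeSet T → Measurable fun x => ENNReal.ofReal (Real.exp (-V s x) * Z s x) :=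
    fun hs => (((hF.smoothT_exp.mul hF.smoothT_Z).slice hs).continuous).measurable.ennreal_ofReal
  have hw : Measurable fun x => ENNReal.ofReal (weightRatio g Z V t x) :=
    ((hF.smoothT_weightRatio hT).slice ht).continuous.measurable.ennreal_ofReal
  rw [weightedMeasure, weightedMeasure, riemVolume_eq_withDensity (hF.isSmoothMetric h0) hr,
    ← withDensity_mul _ hr.measurable.ennreal_ofReal (hm ht), ← withDensity_mul _ (hm h0) hw]
  congr 1
  funext x
  have hp0 : 0 < Real.exp (-V 0 x) * Z 0 x := mul_pos (Real.exp_pos _) (hF.Z_pos 0 h0 x)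
  have hZ0 := (hF.Z_pos 0 h0 x).ne'
  simp only [Pi.mul_apply]
  rw [← ENNReal.ofReal_mul (volRatio_pos _ _ x).le, ← ENNReal.ofReal_mul hp0.le, weightRatio]
  congr 1
  field_simp

theorem integral_eq_reference (hF : IsRenormFlow T g Z V) (hT : 0 < T) (ht : t ∈ timeSet T)
    (f : X → ℝ) :
    ∫ x, f x ∂(weightedMeasure (g t) (Z t) (V t))
      = ∫ x, weightRatio g Z V t x * f x ∂(weightedMeasure (g 0) (Z 0) (V 0)) := by
  have hw : Measurable fun x => ENNReal.ofReal (weightRatio g Z V t x) :=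
    ((hF.smoothT_weightRatio hT).slice ht).continuous.measurable.ennreal_ofReal
  rw [hF.weightedMeasure_eq_withDensity hT ht, integral_withDensity_eq_integral_toReal_smul hw
    (Eventually.of_forall fun _ => ENNReal.ofReal_lt_top)]
  refine integral_congr_ae (Eventually.of_forall fun x => ?_)
  simp only [smul_eq_mul]
  rw [ENNReal.toReal_ofReal (hF.weightRatio_pos hT ht x).le]

theorem isFiniteMeasure (hF : IsRenormFlow T g Z V) (ht : t ∈ timeSet T) :
    IsFiniteMeasure (weightedMeasure (g t) (Z t) (V t)) :=
  ⟨lt_top_iff_ne_top.2 (hF.finite_mass t ht)⟩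

/-- The time derivative of the density. -/
theorem dtime_weightRatio (hF : IsRenormFlow T g Z V) (hT : 0 < T) (ht : t ∈ timeSet T)
    (h0 : 0 < t) (x : X) :
    dtime (timeSet T) (weightRatio g Z V) t x
      = weightRatio g Z V t x * ((1 / 2) *
        (laplaceBeltrami (g t) (fun z => Real.exp (-V t z)) x * Real.exp (V t x)
          - laplaceBeltrami (g t) (Z t) x * (Z t x)⁻¹)) := by
  have hnt := timeSet_mem_nhds ht h0
  have h00 := zero_mem_timeSet hT
  have hg := hF.isSmoothMetric ht
  set d : ℝ → ℝ := fun s => volDensity (g s) x (extChartAt (𝓡 n) x x) with hd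
  have hdpos : ∀ s, 0 < d s := fun s => volDensity_pos (g s) (mem_extChartAt_target x)
  -- `Z` and the volume density are kept together: the backward heat equation specifies the
  -- derivative of their product only.
  have hZd : HasDerivAt (fun s => Z s x * d s) (-(1 / 2) * laplaceBeltrami (g t) (Z t) x * d t) t := by
    have h1 : DifferentiableAt ℝ d t := by
      have := hasDerivWithinAt_slice (u := fun s y => volDensity (g s) x y)
        (hF.smoothMetricT.contDiffOn_volDensity x) ht (mem_extChartAt_target x)
      exact (this.hasDerivAt hnt).differentiableAt
    have h2 := ((hF.smoothT_Z.hasDerivAt hnt x).differentiableAt.mul h1).hasDerivAt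
    rw [← hF.backward_heat t ht h0 x]
    exact h2
  have hV : HasDerivAt (fun s => V s x) ((1 / 2) * laplaceBeltrami (g t) (V t) x
      - (1 / 2) * gradSq (g t) (V t) x) t := by
    rw [← hF.polchinski t ht h0 x]
    exact (hF.smoothT_V.hasDerivAt hnt x).differentiableAt.hasDerivAt
  -- The Hopf–Cole transformation: together with the equation for `V` this says that `e^{-V}` solves
  -- the heat equation `∂_t = ½ Δ`.
  have hlapE : laplaceBeltrami (g t) (fun z => Real.exp (-V t z)) x
      = Real.exp (-V t x) * (gradSq (g t) (V t) x - laplaceBeltrami (g t) (V t) x) := by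
    have hderiv : ∀ r : ℝ, HasDerivAt (fun r => Real.exp (-r)) (-Real.exp (-r)) r := fun r => by
      simpa using (hasDerivAt_id' r).fun_neg.exp
    have hderiv1 : deriv (fun r => Real.exp (-r)) = fun r => -Real.exp (-r) :=
      funext fun r => (hderiv r).deriv
    rw [hg.laplaceBeltrami_comp (φ := fun r => Real.exp (-r)) isOpen_univ
      (Real.contDiff_exp.comp contDiff_neg).contDiffOn (hF.smoothT_V.slice ht)
      (fun _ => mem_univ _), hderiv1, (hderiv _).fun_neg.deriv]
    ring
  have hall : HasDerivAt (fun s => Real.exp (-V s x) * (Z s x * d s) *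
      ((d 0)⁻¹ * (Real.exp (-V 0 x) * Z 0 x)⁻¹)) _ t :=
    ((hV.fun_neg.exp).mul hZd).mul_const _
  have heq : (fun s => weightRatio g Z V s x) = fun s => Real.exp (-V s x) * (Z s x * d s) *
      ((d 0)⁻¹ * (Real.exp (-V 0 x) * Z 0 x)⁻¹) := by
    funext s
    simp only [weightRatio, volRatio, hd]
    ring
  rw [dtime_eq_deriv hnt, heq, hall.deriv, hlapE, congrFun heq t, Real.exp_neg (V t x)]
  have hZ := (hF.Z_pos t ht x).ne'
  have hE := (Real.exp_pos (V t x)).ne'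
  field_simp
  ring

variable {η : X → ℝ} {ψ : ℝ → X → ℝ}

theorem continuousOn_integral_reference (hF : IsRenormFlow T g Z V) (hT : 0 < T)
    (hη : ContMDiff (𝓡 n) 𝓘(ℝ, ℝ) ∞ η) (hηc : HasCompactSupport η) {f : ℝ → X → ℝ}
    (hf : SmoothT n (timeSet T) f) :
    ContinuousOn (fun t => ∫ x, η x * f t x ∂(weightedMeasure (g 0) (Z 0) (V 0))) (timeSet T) := by
  have := hF.isFiniteMeasure (zero_mem_timeSet hT)
  refine continuousOn_integral_of_compact_support hηc.isCompact ?_ ?_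
  · exact ((smoothT_static hη).mul hf).continuousOn
  · intro t x _ hx
    rw [image_eq_zero_of_notMem_tsupport hx, zero_mul]

theorem hasDerivAt_integral_reference (hF : IsRenormFlow T g Z V) (hT : 0 < T)
    (hη : ContMDiff (𝓡 n) 𝓘(ℝ, ℝ) ∞ η) (hηc : HasCompactSupport η) {f : ℝ → X → ℝ}
    (hf : SmoothT n (timeSet T) f) (ht : t ∈ timeSet T) (h0 : 0 < t) :
    HasDerivAt (fun t => ∫ x, η x * f t x ∂(weightedMeasure (g 0) (Z 0) (V 0)))
      (∫ x, η x * dtime (timeSet T) f t x ∂(weightedMeasure (g 0) (Z 0) (V 0))) t := by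
  have := hF.isFiniteMeasure (zero_mem_timeSet hT)
  have hS := uniqueDiffOn_timeSet hT
  -- The compact interval `[t/2, s]` surrounds `t` inside the time set and stays away from `0`. On
  -- it the derivative is bounded over the support of `η`, and a constant is integrable because
  -- `μ_0` is finite.
  obtain ⟨s, hs, hts⟩ := exists_gt_mem_timeSet ht
  have hA : Icc (t / 2) s ⊆ timeSet T := fun r hr =>
    Icc_subset_timeSet hs ⟨(half_pos h0).le.trans hr.1, hr.2⟩
  have hsm := (smoothT_static hη).mul (hf.dtime hS)
  obtain ⟨C, hC⟩ := hsm.exists_bound isCompact_Icc hA hηc.isCompact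
  have hC0 : ∀ r ∈ Icc (t / 2) s, ∀ x, ‖η x * dtime (timeSet T) f r x‖ ≤ max C 0 := by
    intro r hr x
    by_cases hx : x ∈ tsupport η
    · exact (hC r hr x hx).trans (le_max_left _ _)
    · rw [image_eq_zero_of_notMem_tsupport hx, zero_mul, norm_zero]; exact le_max_right _ _
  have hnhds : Ioo (t / 2) s ∈ 𝓝 t := Ioo_mem_nhds (half_lt_self h0) hts
  have hpos : ∀ r ∈ Ioo (t / 2) s, timeSet T ∈ 𝓝 r := fun r hr =>
    timeSet_mem_nhds (hA (Ioo_subset_Icc_self hr)) ((half_pos h0).trans hr.1)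
  have hcont : ∀ {r}, r ∈ timeSet T → ∀ {f : ℝ → X → ℝ}, SmoothT n (timeSet T) f →
      Continuous fun x => η x * f r x := fun hr _ hf => hη.continuous.mul (hf.slice hr).continuous
  refine (hasDerivAt_integral_of_dominated_loc_of_deriv_le (F := fun t x => η x * f t x)
    (F' := fun t x => η x * dtime (timeSet T) f t x) (bound := fun _ => max C 0) hnhds
    ?_ ?_ ?_ ?_ (integrable_const (μ := weightedMeasure (g 0) (Z 0) (V 0)) _) ?_).2
  · filter_upwards [hnhds] with r hr
    exact (hcont (hA (Ioo_subset_Icc_self hr)) hf).aestronglyMeasurable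
  · exact (hcont ht hf).integrable_of_hasCompactSupport hηc.mul_right
  · exact (hcont ht (hf.dtime hS)).aestronglyMeasurable
  · exact Eventually.of_forall fun x r hr => hC0 r (Ioo_subset_Icc_self hr) x
  · exact Eventually.of_forall fun x r hr => (hf.hasDerivAt (hpos r hr) x).const_mul (η x)

end IsRenormFlow

end WeakEvolution

/-! ### Integration by parts: the weak evolution equation of `ψ_t μ_t`. -/

section WeakEvolution

variable {n : ℕ} {X : Type*} [TopologicalSpace X] [T2Space X] [SecondCountableTopology X]
  [ChartedSpace (Model n) X] [IsManifold (𝓡 n) ∞ X] [MeasurableSpace X] [BorelSpace X]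

theorem continuous_hasCompactSupport_integrable {g : RMetric n X} (hg : IsSmoothMetric g)
    {f : X → ℝ} (hf : Continuous f) (hc : HasCompactSupport f) : Integrable f (riemVolume g) := by
  have := isLocallyFiniteMeasure_riemVolume g hg
  exact hf.integrable_of_hasCompactSupport hc

theorem IsSmoothMetric.green_zero {g : RMetric n X} (hg : IsSmoothMetric g) {a b : X → ℝ}
    (ha : ContMDiff (𝓡 n) 𝓘(ℝ, ℝ) ∞ a) (hc : HasCompactSupport a)
    (hb : ContMDiff (𝓡 n) 𝓘(ℝ, ℝ) ∞ b) :
    Integrable (fun x => a x * laplaceBeltrami g b x + gradInner g a b x) (riemVolume g) ∧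
      ∫ x, (a x * laplaceBeltrami g b x + gradInner g a b x) ∂(riemVolume g) = 0 := by
  have h1 : Integrable (fun x => a x * laplaceBeltrami g b x) (riemVolume g) :=
    continuous_hasCompactSupport_integrable hg
      (ha.continuous.mul (hg.contMDiff_laplaceBeltrami hb).continuous) hc.mul_right
  have h2 : Integrable (fun x => gradInner g a b x) (riemVolume g) :=
    continuous_hasCompactSupport_integrable hg (hg.contMDiff_gradInner ha hb).continuous
      (hasCompactSupport_gradInner hc b)
  exact ⟨h1.add h2, by rw [integral_add h1 h2, hg.green ha hc hb, neg_add_cancel]⟩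

theorem integral_linear_combination_eq_zero {μ : Measure X} {A B C : X → ℝ} (hA : Integrable A μ)
    (hB : Integrable B μ) (hC : Integrable C μ) (eA : ∫ x, A x ∂μ = 0) (eB : ∫ x, B x ∂μ = 0)
    (eC : ∫ x, C x ∂μ = 0) (a b c : ℝ) : ∫ x, (a * A x - b * B x + c * C x) ∂μ = 0 := by
  have hAB : Integrable (fun x => a * A x - b * B x) μ := (hA.const_mul a).sub (hB.const_mul b)
  rw [integral_add hAB (hC.const_mul c), integral_sub (hA.const_mul a) (hB.const_mul b),
    integral_const_mul, integral_const_mul, integral_const_mul, eA, eB, eC]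
  simp

/-- Integration by parts against the measure `e^{-V} Z dm_g`: the time derivative of the density,
tested against `η ψ`, is moved onto `η` and `ψ`. -/
theorem IsSmoothMetric.integral_weighted_by_parts {g : RMetric n X} (hg : IsSmoothMetric g)
    {Z V η ψ ψ' : X → ℝ} (hZ : ContMDiff (𝓡 n) 𝓘(ℝ, ℝ) ∞ Z) (hV : ContMDiff (𝓡 n) 𝓘(ℝ, ℝ) ∞ V)
    (hZ0 : ∀ x, 0 < Z x) (hη : ContMDiff (𝓡 n) 𝓘(ℝ, ℝ) ∞ η) (hc : HasCompactSupport η)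
    (hψ : ContMDiff (𝓡 n) 𝓘(ℝ, ℝ) ∞ ψ) (hψ' : Continuous ψ') :
    ∫ x, η x * ((1 / 2) * (laplaceBeltrami g (fun z => Real.exp (-V z)) x * Real.exp (V x)
        - laplaceBeltrami g Z x * (Z x)⁻¹) * ψ x + ψ' x) ∂(weightedMeasure g Z V)
      = ∫ x, (η x * (ψ' x - generator g V ψ x) - (1 / 2) * gradInner g ψ η x
        + (1 / 2) * ψ x * gradInner g η (fun z => Real.log (Z z) + V z) x)
          ∂(weightedMeasure g Z V) := by
  have hE : ContMDiff (𝓡 n) 𝓘(ℝ, ℝ) ∞ fun z => Real.exp (-V z) :=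
    (Real.contDiff_exp.comp contDiff_neg).contMDiff.comp hV
  have hlogZ : ContMDiff (𝓡 n) 𝓘(ℝ, ℝ) ∞ fun z => Real.log (Z z) := fun x =>
    ((Real.contDiffAt_log.2 (hZ0 x).ne').contMDiffAt).comp x (hZ x)
  have hsum := hlogZ.add hV
  have hηψ : ContMDiff (𝓡 n) 𝓘(ℝ, ℝ) ∞ fun z => η z * ψ z := hη.mul hψ
  have hηE : ContMDiff (𝓡 n) 𝓘(ℝ, ℝ) ∞ fun z => η z * Real.exp (-V z) := hη.mul hE
  -- Three Green identities. The first two treat `Z Δe^{-V} - e^{-V} ΔZ`, the divergence of the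
  -- current; the third treats `Δψ`, the second-order part of the generator.
  obtain ⟨i1, e1⟩ := hg.green_zero (a := fun z => η z * ψ z * Z z) (hηψ.mul hZ)
    (hc.mul_right.mul_right) hE
  obtain ⟨i2, e2⟩ := hg.green_zero (a := fun z => η z * ψ z * Real.exp (-V z)) (hηψ.mul hE)
    (hc.mul_right.mul_right) hZ
  obtain ⟨i3, e3⟩ := hg.green_zero (a := fun z => η z * Real.exp (-V z) * Z z) (hηE.mul hZ)
    (hc.mul_right.mul_right) hψ
  have hZi : Continuous fun x => (Z x)⁻¹ := hZ.continuous.inv₀ fun x => (hZ0 x).ne'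
  rw [integral_weightedMeasure hZ.continuous hV.continuous hZ0,
    integral_weightedMeasure hZ.continuous hV.continuous hZ0, ← sub_eq_zero, ← integral_sub]
  -- Pointwise the two integrands differ by a combination, with coefficients `±½`, of the three
  -- integrands of zero integral.
  · have key : ∀ x, Real.exp (-V x) * Z x * (η x * ((1 / 2) *
        (laplaceBeltrami g (fun z => Real.exp (-V z)) x * Real.exp (V x)
          - laplaceBeltrami g Z x * (Z x)⁻¹) * ψ x + ψ' x))
        - Real.exp (-V x) * Z x * (η x * (ψ' x - generator g V ψ x)
          - (1 / 2) * gradInner g ψ η x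
          + (1 / 2) * ψ x * gradInner g η (fun z => Real.log (Z z) + V z) x)
        = ((1 / 2) * (η x * ψ x * Z x * laplaceBeltrami g (fun z => Real.exp (-V z)) x
            + gradInner g (fun z => η z * ψ z * Z z) (fun z => Real.exp (-V z)) x)
          - (1 / 2) * (η x * ψ x * Real.exp (-V x) * laplaceBeltrami g Z x
            + gradInner g (fun z => η z * ψ z * Real.exp (-V z)) Z x))
          + (1 / 2) * (η x * Real.exp (-V x) * Z x * laplaceBeltrami g ψ x
            + gradInner g (fun z => η z * Real.exp (-V z) * Z z) ψ x) := by
      intro x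
      rw [gradInner_mul_left hηψ hZ, gradInner_mul_left hη hψ,
        gradInner_mul_left hηψ hE, gradInner_mul_left hη hψ,
        gradInner_mul_left hηE hZ, gradInner_mul_left hη hE,
        hg.gradInner_comm η (fun z => Real.log (Z z) + V z), gradInner_add_left hlogZ hV,
        gradInner_comp_left (φ := Real.log) (Real.differentiableAt_log (hZ0 x).ne') hZ,
        Real.deriv_log, hg.gradInner_comm Z (fun z => Real.exp (-V z)),
        hg.gradInner_comm ψ (fun z => Real.exp (-V z)),
        hg.gradInner_comm η (fun z => Real.exp (-V z)), hg.gradInner_comm ψ η,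
        hg.gradInner_comm ψ Z, hg.gradInner_comm η Z]
      have hEV : ∀ d : X → ℝ, gradInner g (fun z => Real.exp (-V z)) d x
          = -Real.exp (-V x) * gradInner g V d x := by
        intro d
        have hderiv : HasDerivAt (fun r => Real.exp (-r)) (-Real.exp (-V x)) (V x) := by
          simpa using (hasDerivAt_id' (V x)).fun_neg.exp
        rw [gradInner_comp_left (φ := fun r => Real.exp (-r)) hderiv.differentiableAt hV,
          hderiv.deriv]
      simp only [hEV, generator]
      have hz := (hZ0 x).ne'
      have hee : Real.exp (-V x) * Real.exp (V x) = 1 := by rw [← Real.exp_add]; simp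
      have hzz : Z x * (Z x)⁻¹ = 1 := mul_inv_cancel₀ hz
      linear_combination ((1 / 2) * Z x * η x * ψ x *
          laplaceBeltrami g (fun z => Real.exp (-V z)) x) * hee
        - ((1 / 2) * Real.exp (-V x) * η x * ψ x * laplaceBeltrami g Z x
          + (1 / 2) * Real.exp (-V x) * ψ x * gradInner g Z η x) * hzz
    rw [integral_congr_ae (Eventually.of_forall key)]
    exact integral_linear_combination_eq_zero i1 i2 i3 e1 e2 e3 _ _ _
  · refine continuous_hasCompactSupport_integrable hg ?_ hc.mul_right.mul_left
    exact (hE.continuous.mul hZ.continuous).mul (hη.continuous.mul ((((continuous_const.mul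
      (((hg.contMDiff_laplaceBeltrami hE).continuous.mul (Real.continuous_exp.comp hV.continuous)).sub
        ((hg.contMDiff_laplaceBeltrami hZ).continuous.mul hZi))).mul hψ.continuous)).add hψ'))
  · refine continuous_hasCompactSupport_integrable hg ?_
      (HasCompactSupport.intro hc.isCompact fun x hx => ?_)
    · exact (hE.continuous.mul hZ.continuous).mul (((hη.continuous.mul (hψ'.sub
        ((continuous_const.mul (hg.contMDiff_laplaceBeltrami hψ).continuous).sub
          (hg.contMDiff_gradInner hV hψ).continuous))).sub
        (continuous_const.mul (hg.contMDiff_gradInner hψ hη).continuous)).add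
        ((continuous_const.mul hψ.continuous).mul (hg.contMDiff_gradInner hη hsum).continuous))
    · have h0 := gradInner_eq_zero_of_eventually (g := g) (notMem_tsupport_iff_eventuallyEq.1 hx)
      rw [image_eq_zero_of_notMem_tsupport hx, hg.gradInner_comm ψ η, h0, h0]
      ring

namespace IsRenormFlow

variable {T : EReal} {g : ℝ → RMetric n X} {Z V : ℝ → X → ℝ} {t : ℝ} {η : X → ℝ} {ψ : ℝ → X → ℝ}

/-- The weak form of the evolution of `ψ_t e^{-V_t} Z_t dm_{g_t}`: the integrand of
`∂_t ∫ η ψ_t e^{-V_t} Z_t dm_{g_t}`. -/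
def weakRate (T : EReal) (g : ℝ → RMetric n X) (Z V : ℝ → X → ℝ) (η : X → ℝ) (ψ : ℝ → X → ℝ)
    (t : ℝ) (x : X) : ℝ :=
  η x * (dtime (timeSet T) ψ t x - generator (g t) (V t) (ψ t) x)
    - (1 / 2) * gradInner (g t) (ψ t) η x
    + (1 / 2) * ψ t x * gradInner (g t) η (fun z => Real.log (Z t z) + V t z) x

theorem continuousOn_integral (hF : IsRenormFlow T g Z V) (hT : 0 < T)
    (hη : ContMDiff (𝓡 n) 𝓘(ℝ, ℝ) ∞ η) (hηc : HasCompactSupport η)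
    (hψ : SmoothT n (timeSet T) ψ) :
    ContinuousOn (fun t => ∫ x, η x * ψ t x ∂(weightedMeasure (g t) (Z t) (V t))) (timeSet T) := by
  refine (hF.continuousOn_integral_reference hT hη hηc ((hF.smoothT_weightRatio hT).mul hψ)).congr
    fun t ht => ?_
  simp only [hF.integral_eq_reference hT ht]
  exact integral_congr_ae (Eventually.of_forall fun x => by ring)

/-- The rate has two forms. The one with generator and current is used for estimates; the one over
the fixed measure `μ_0` comes from differentiating under the integral and is continuous in time. -/
theorem integral_weakRate (hF : IsRenormFlow T g Z V) (hT : 0 < T)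
    (hη : ContMDiff (𝓡 n) 𝓘(ℝ, ℝ) ∞ η) (hηc : HasCompactSupport η)
    (hψ : SmoothT n (timeSet T) ψ) (ht : t ∈ timeSet T) (h0 : 0 < t) :
    ∫ x, weakRate T g Z V η ψ t x ∂(weightedMeasure (g t) (Z t) (V t))
      = ∫ x, η x * dtime (timeSet T) (fun t x => weightRatio g Z V t x * ψ t x) t x
        ∂(weightedMeasure (g 0) (Z 0) (V 0)) := by
  have hnt := timeSet_mem_nhds ht h0
  have hS := uniqueDiffOn_timeSet hT
  simp only [weakRate]
  rw [← (hF.isSmoothMetric ht).integral_weighted_by_parts (hF.smoothT_Z.slice ht)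
    (hF.smoothT_V.slice ht) (hF.Z_pos t ht) hη hηc (hψ.slice ht)
    ((hψ.dtime hS).slice ht).continuous, hF.integral_eq_reference hT ht]
  refine integral_congr_ae (Eventually.of_forall fun x => ?_)
  have hw := (hF.smoothT_weightRatio hT).hasDerivAt hnt x
  have := hw.mul (hψ.hasDerivAt hnt x)
  have h2 : dtime (timeSet T) (fun t x => weightRatio g Z V t x * ψ t x) t x = _ :=
    (dtime_eq_deriv hnt x).trans this.deriv
  simp only [h2, hF.dtime_weightRatio hT ht h0]
  ring

theorem hasDerivAt_integral (hF : IsRenormFlow T g Z V) (hT : 0 < T)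
    (hη : ContMDiff (𝓡 n) 𝓘(ℝ, ℝ) ∞ η) (hηc : HasCompactSupport η)
    (hψ : SmoothT n (timeSet T) ψ) (ht : t ∈ timeSet T) (h0 : 0 < t) :
    HasDerivAt (fun t => ∫ x, η x * ψ t x ∂(weightedMeasure (g t) (Z t) (V t)))
      (∫ x, weakRate T g Z V η ψ t x ∂(weightedMeasure (g t) (Z t) (V t))) t := by
  rw [hF.integral_weakRate hT hη hηc hψ ht h0]
  refine (hF.hasDerivAt_integral_reference hT hη hηc ((hF.smoothT_weightRatio hT).mul hψ)
    ht h0).congr_of_eventuallyEq ?_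
  filter_upwards [timeSet_mem_nhds ht h0] with s hs
  simp only [hF.integral_eq_reference hT hs]
  exact integral_congr_ae (Eventually.of_forall fun x => by ring)

/-- Continuity up to and including time `0` makes the rate integrable in time, although the
differential equations are only assumed for positive times. -/
theorem continuousOn_weakRate_reference (hF : IsRenormFlow T g Z V) (hT : 0 < T)
    (hη : ContMDiff (𝓡 n) 𝓘(ℝ, ℝ) ∞ η) (hηc : HasCompactSupport η)
    (hψ : SmoothT n (timeSet T) ψ) :
    ContinuousOn (fun t => ∫ x, η x * dtime (timeSet T) (fun t x => weightRatio g Z V t x * ψ t x)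
      t x ∂(weightedMeasure (g 0) (Z 0) (V 0))) (timeSet T) :=
  hF.continuousOn_integral_reference hT hη hηc
    (((hF.smoothT_weightRatio hT).mul hψ).dtime (uniqueDiffOn_timeSet hT))

end IsRenormFlow

end WeakEvolution

/-! ### Pointwise evolution of `h(F_t)` and of the Fisher information density. -/

section Pointwise

variable {n : ℕ} {X : Type*} [TopologicalSpace X] [T2Space X] [SecondCountableTopology X]
  [ChartedSpace (Model n) X] [IsManifold (𝓡 n) ∞ X] [MeasurableSpace X] [BorelSpace X]

theorem IsMetricOn.coordLap_congr {G : Model n → Matrix (Fin n) (Fin n) ℝ} {Ω : Set (Model n)}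
    (hG : IsMetricOn G Ω) {f h : Model n → ℝ} {y : Model n} (hy : y ∈ Ω)
    (hfh : ∀ z ∈ Ω, f z = h z) : coordLap G f y = coordLap G h y := by
  simp only [coordLap]
  congr 1
  refine Finset.sum_congr rfl fun i _ => pd_congr hG.isOpen hy i fun z hz => ?_
  exact Finset.sum_congr rfl fun j _ => by rw [pd_congr hG.isOpen hz j hfh]

theorem IsMetricOn.coordGrad_congr_left {G : Model n → Matrix (Fin n) (Fin n) ℝ}
    {Ω : Set (Model n)} (hG : IsMetricOn G Ω) {f h : Model n → ℝ} {y : Model n} (hy : y ∈ Ω)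
    (hfh : ∀ z ∈ Ω, f z = h z) (a : Model n → ℝ) : coordGrad G f a y = coordGrad G h a y := by
  simp only [coordGrad]
  exact Finset.sum_congr rfl fun i _ => Finset.sum_congr rfl fun j _ => by
    rw [pd_congr hG.isOpen hy i hfh]

theorem IsSmoothMetric.generator_mul {g : RMetric n X} (hg : IsSmoothMetric g) {V a b : X → ℝ}
    (ha : ContMDiff (𝓡 n) 𝓘(ℝ, ℝ) ∞ a) (hb : ContMDiff (𝓡 n) 𝓘(ℝ, ℝ) ∞ b) (x : X) :
    generator g V (fun z => a z * b z) x
      = a x * generator g V b x + b x * generator g V a x + gradInner g a b x := by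
  simp only [generator]
  rw [hg.laplaceBeltrami_mul ha hb, hg.gradInner_comm V, gradInner_mul_left ha hb,
    hg.gradInner_comm a V, hg.gradInner_comm b V]
  ring

theorem IsSmoothMetric.generator_comp {g : RMetric n X} (hg : IsSmoothMetric g) {V a : X → ℝ}
    {φ : ℝ → ℝ} {U : Set ℝ} (hU : IsOpen U) (hφ : ContDiffOn ℝ ∞ φ U)
    (ha : ContMDiff (𝓡 n) 𝓘(ℝ, ℝ) ∞ a) (haU : ∀ z, a z ∈ U) (x : X) :
    generator g V (fun z => φ (a z)) x
      = deriv φ (a x) * generator g V a x + (1 / 2) * deriv (deriv φ) (a x) * gradSq g a x := by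
  have hd : DifferentiableAt ℝ φ (a x) :=
    (hφ.contDiffAt (hU.mem_nhds (haU x))).differentiableAt (by simp)
  simp only [generator]
  rw [hg.laplaceBeltrami_comp hU hφ ha haU, hg.gradInner_comm V, gradInner_comp_left hd ha,
    hg.gradInner_comm a V]
  ring

variable {T : EReal} {g : ℝ → RMetric n X} {Z V : ℝ → X → ℝ} {t : ℝ}

/-- The Bakry–Émery estimate for the squared gradient of a solution of
`∂_t u = L_t u + ½ (∇u)²`. -/
theorem IsRenormFlow.exists_evolution_gradSq_le (hF : IsRenormFlow T g Z V)
    {lamDot : ℝ → ℝ} (hcond : MultiscaleCondition T g V lamDot) (ht : t ∈ timeSet T) (h0 : 0 < t)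
    {u : ℝ → X → ℝ} (hu : SmoothT n (timeSet T) u)
    (heq : ∀ x, deriv (fun s => u s x) t
      = generator (g t) (V t) (u t) x + (1 / 2) * gradSq (g t) (u t) x) (x : X) :
    ∃ N : ℝ, 0 ≤ N ∧
      deriv (fun s => gradSq (g s) (u s) x) t - generator (g t) (V t) (gradSq (g t) (u t)) x
        ≤ -N - 2 * lamDot t * gradSq (g t) (u t) x + gradInner (g t) (u t) (gradSq (g t) (u t)) x ∧
      ∀ χ : X → ℝ, gradInner (g t) (gradSq (g t) (u t)) χ x ^ 2
        ≤ 4 * N * (gradSq (g t) (u t) x * gradSq (g t) χ x) := by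
  have hnt := timeSet_mem_nhds ht h0
  have hg := hF.isSmoothMetric ht
  have hut := hu.slice ht
  have hVt := hF.smoothT_V.slice ht
  set Ω := (extChartAt (𝓡 n) x).target with hΩ
  set y := extChartAt (𝓡 n) x x with hydef
  have hy : y ∈ Ω := mem_extChartAt_target x
  have hG := hg.isMetricOn x
  set G : ℝ → Model n → Matrix (Fin n) (Fin n) ℝ := fun s => metricMat (g s) x with hGdef
  set w : ℝ → Model n → ℝ := fun s => inChart x (u s) with hw
  have hwt : ContDiffOn ℝ ∞ (w t) Ω := contDiffOn_inChart hut x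
  have hq : ∀ z ∈ Ω, inChart x (gradSq (g t) (u t)) z = coordGrad (G t) (w t) (w t) z :=
    fun z hz => gradInner_symm_apply (g t) hut hut hz
  -- Everything is read in the chart around `x` itself, the chart in which the curvature condition
  -- at `x` is stated; no transformation of Hessian or Ricci tensor is needed.
  have main := hG.evolution_gradSq_le (G := G) (u := w) (V := inChart x (V t))
    (G' := metricDot g t x) (u' := fun z => deriv (fun s => w s z) t) hy hwt
    (contDiffOn_inChart hVt x) (fun i j => by
      have h := hasDerivWithinAt_slice (u := fun s y => metricMat (g s) x y i j)
        (hF.smoothMetricT x i j) ht hy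
      exact (h.hasDerivAt hnt).differentiableAt.hasDerivAt)
    (fun i => hasDerivAt_pd_slice hG.isOpen (hu x) hnt hy i)
    (fun z hz => by
      have hsrc := (extChartAt (𝓡 n) x).map_target hz
      have h1 := heq ((extChartAt (𝓡 n) x).symm z)
      rw [generator, hg.laplaceBeltrami_eq_coordLap hut hsrc, gradSq,
        gradInner_symm_apply (g t) hVt hut hz, gradInner_symm_apply (g t) hut hut hz,
        (extChartAt (𝓡 n) x).right_inv hz] at h1
      exact h1)
    (hcond t ht h0 x)
  -- `N` is the squared norm of the Hessian of `u`. Only its sign and its control of `∇(∇u)²` are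
  -- passed on.
  refine ⟨IsMetricOn.hessNormSq (G t) (w t) y, hG.hessNormSq_nonneg hwt hy, ?_, fun χ => ?_⟩
  · have e1 : laplaceBeltrami (g t) (gradSq (g t) (u t)) x
        = coordLap (G t) (coordGrad (G t) (w t) (w t)) y := hG.coordLap_congr hy hq
    have e2 : ∀ a : X → ℝ, gradInner (g t) a (gradSq (g t) (u t)) x
        = coordGrad (G t) (inChart x a) (coordGrad (G t) (w t) (w t)) y := fun a => by
      rw [hg.gradInner_comm, hG.coordGrad_comm hy]
      exact hG.coordGrad_congr_left hy hq _
    rw [generator, e1, e2, e2]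
    exact main
  · have e2 : gradInner (g t) (gradSq (g t) (u t)) χ x
        = coordGrad (G t) (coordGrad (G t) (w t) (w t)) (inChart x χ) y :=
      hG.coordGrad_congr_left hy hq _
    rw [e2]
    exact hG.coordGrad_gradSq_sq_le hwt hy _

/-- `F` is a smooth solution of `∂_t F = L_t F`. -/
structure IsSolution (T : EReal) (g : ℝ → RMetric n X) (V F : ℝ → X → ℝ) : Prop where
  smooth : SmoothT n (timeSet T) F
  evolution : ∀ t ∈ timeSet T, 0 < t → ∀ x,
    deriv (fun s => F s x) t = generator (g t) (V t) (F t) x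

variable {F : ℝ → X → ℝ}

/-- The evolution of `h(F)` along a solution. -/
theorem IsSolution.dtime_comp (hS : IsSolution T g V F) (hF : IsRenormFlow T g Z V)
    (ht : t ∈ timeSet T) (h0 : 0 < t) {h : ℝ → ℝ} {U : Set ℝ} (hU : IsOpen U)
    (hh : ContDiffOn ℝ ∞ h U) (hFU : ∀ t ∈ timeSet T, ∀ x, F t x ∈ U) (x : X) :
    dtime (timeSet T) (fun s x => h (F s x)) t x - generator (g t) (V t) (fun z => h (F t z)) x
      = -(1 / 2) * deriv (deriv h) (F t x) * gradSq (g t) (F t) x := by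
  have hnt := timeSet_mem_nhds ht h0
  have hd : DifferentiableAt ℝ h (F t x) :=
    (hh.contDiffAt (hU.mem_nhds (hFU t ht x))).differentiableAt (by simp)
  have h1 : HasDerivAt (fun s => F s x) (generator (g t) (V t) (F t) x) t := by
    rw [← hS.evolution t ht h0 x]
    exact (hS.smooth.hasDerivAt hnt x).differentiableAt.hasDerivAt
  have h2 : HasDerivAt (fun s => h (F s x))
      (deriv h (F t x) * generator (g t) (V t) (F t) x) t := hd.hasDerivAt.comp t h1
  rw [dtime_eq_deriv hnt, h2.deriv, (hF.isSmoothMetric ht).generator_comp hU hh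
    (hS.smooth.slice ht) (hFU t ht)]
  ring

/-- The Fisher information density `(∇F)² / F`, in the form `F (∇ log F)²`. -/
def fisher (g : ℝ → RMetric n X) (F : ℝ → X → ℝ) (t : ℝ) (x : X) : ℝ :=
  F t x * gradSq (g t) (fun z => Real.log (F t z)) x

theorem IsSolution.smoothT_log (hS : IsSolution T g V F) (hpos : ∀ t ∈ timeSet T, ∀ x, 0 < F t x) :
    SmoothT n (timeSet T) fun t x => Real.log (F t x) :=
  hS.smooth.comp (φ := Real.log) (U := Ioi 0)
    (Real.contDiffOn_log.mono fun _ hx => (ne_of_gt hx : _ ≠ (0 : ℝ))) hpos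

theorem IsSolution.smoothT_gradSq_log (hS : IsSolution T g V F) (hF : IsRenormFlow T g Z V)
    (hT : 0 < T) (hpos : ∀ t ∈ timeSet T, ∀ x, 0 < F t x) :
    SmoothT n (timeSet T) fun t => gradSq (g t) (fun z => Real.log (F t z)) :=
  hF.smoothMetricT.smoothT_gradInner (uniqueDiffOn_timeSet hT) (hS.smoothT_log hpos)
    (hS.smoothT_log hpos)

theorem IsSolution.smoothT_fisher (hS : IsSolution T g V F) (hF : IsRenormFlow T g Z V)
    (hT : 0 < T) (hpos : ∀ t ∈ timeSet T, ∀ x, 0 < F t x) :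
    SmoothT n (timeSet T) (fisher g F) :=
  hS.smooth.mul (hS.smoothT_gradSq_log hF hT hpos)

theorem gradInner_log {g : RMetric n X} {f : X → ℝ} (hf : ContMDiff (𝓡 n) 𝓘(ℝ, ℝ) ∞ f) {x : X}
    (hx : 0 < f x) (d : X → ℝ) :
    gradInner g (fun z => Real.log (f z)) d x = (f x)⁻¹ * gradInner g f d x := by
  rw [gradInner_comp_left (Real.differentiableAt_log hx.ne') hf, Real.deriv_log]

theorem IsSmoothMetric.gradSq_log {g : RMetric n X} (hg : IsSmoothMetric g) {f : X → ℝ}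
    (hf : ContMDiff (𝓡 n) 𝓘(ℝ, ℝ) ∞ f) {x : X} (hx : 0 < f x) :
    gradSq g (fun z => Real.log (f z)) x = gradSq g f x / f x ^ 2 := by
  rw [gradSq, gradInner_log hf hx, hg.gradInner_comm, gradInner_log hf hx, gradSq]
  field_simp

/-- For `h = log` the term `-½ h''(F) (∇F)²` is `½ (∇ log F)²`: the equation of Hamilton–Jacobi type
to which the curvature computation applies. -/
theorem IsSolution.deriv_log (hS : IsSolution T g V F) (hF : IsRenormFlow T g Z V)
    (hpos : ∀ t ∈ timeSet T, ∀ x, 0 < F t x) (ht : t ∈ timeSet T) (h0 : 0 < t) (x : X) :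
    deriv (fun s => Real.log (F s x)) t
      = generator (g t) (V t) (fun z => Real.log (F t z)) x
        + (1 / 2) * gradSq (g t) (fun z => Real.log (F t z)) x := by
  have hnt := timeSet_mem_nhds ht h0
  have h := hS.dtime_comp hF ht h0 (h := Real.log) (U := Ioi 0) isOpen_Ioi
    (Real.contDiffOn_log.mono fun _ hx => (ne_of_gt hx : _ ≠ (0 : ℝ))) hpos x
  rw [dtime_eq_deriv hnt] at h
  have hd : deriv (deriv Real.log) (F t x) = -(F t x ^ 2)⁻¹ := by
    rw [Real.deriv_log', deriv_inv]
  rw [hd] at h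
  rw [(hF.isSmoothMetric ht).gradSq_log (hS.smooth.slice ht) (hpos t ht x)]
  rw [sub_eq_iff_eq_add] at h
  rw [h]
  ring

open IsRenormFlow in
/-- The localised evolution of the Fisher information. -/
theorem IsSolution.weakRate_fisher_le (hS : IsSolution T g V F) (hF : IsRenormFlow T g Z V)
    (hT : 0 < T) {lamDot : ℝ → ℝ} (hcond : MultiscaleCondition T g V lamDot)
    (hpos : ∀ t ∈ timeSet T, ∀ x, 0 < F t x) (ht : t ∈ timeSet T) (h0 : 0 < t) {χ : X → ℝ}
    (hχ : ContMDiff (𝓡 n) 𝓘(ℝ, ℝ) ∞ χ) {x : X} (hχ1 : |χ x| ≤ 1) :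
    weakRate T g Z V (fun z => χ z * χ z) (fisher g F) t x
      ≤ -2 * lamDot t * (χ x * χ x * fisher g F t x)
        + fisher g F t x * gradSq (g t) χ x
        + gradSq (g t) (fun z => Real.log (F t z)) x
          * (Real.sqrt (gradSq (g t) (F t) x) * Real.sqrt (gradSq (g t) χ x))
        + fisher g F t x * (Real.sqrt (gradSq (g t) χ x) *
          Real.sqrt (gradSq (g t) (fun z => Real.log (Z t z) + V t z) x)) := by
  have hnt := timeSet_mem_nhds ht h0
  have hg := hF.isSmoothMetric ht
  have hlog := hS.smoothT_log hpos
  have hqT := hS.smoothT_gradSq_log hF hT hpos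
  have hFt := hS.smooth.slice ht
  obtain ⟨N, hN0, hN, hNχ⟩ := hF.exists_evolution_gradSq_le hcond ht h0 hlog
    (fun x => hS.deriv_log hF hpos ht h0 x) x
  set q : X → ℝ := gradSq (g t) (fun z => Real.log (F t z)) with hq
  have hqs : ContMDiff (𝓡 n) 𝓘(ℝ, ℝ) ∞ q := hqT.slice ht
  have hFx := hpos t ht x
  have hq0 : 0 ≤ q x := hg.gradSq_nonneg _ _
  have hfish : fisher g F t = fun z => F t z * q z := rfl
  have hdt : dtime (timeSet T) (fisher g F) t x
      = generator (g t) (V t) (F t) x * q x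
        + F t x * deriv (fun s => gradSq (g s) (fun z => Real.log (F s z)) x) t := by
    have h1 : HasDerivAt (fun s => F s x) (generator (g t) (V t) (F t) x) t := by
      rw [← hS.evolution t ht h0 x]
      exact (hS.smooth.hasDerivAt hnt x).differentiableAt.hasDerivAt
    have h2 := (hqT.hasDerivAt hnt x).differentiableAt.hasDerivAt
    rw [dtime_eq_deriv hnt]
    exact (h1.mul h2).deriv
  have hlogq : gradInner (g t) (fun z => Real.log (F t z)) q x
      = (F t x)⁻¹ * gradInner (g t) (F t) q x := gradInner_log hFt hFx q
  rw [hlogq] at hN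
  -- With `q = (∇ log F)²`, the transport term is `F (∇ log F, ∇q) = (∇F, ∇q)`, precisely the cross
  -- term of the generator applied to `F q`. This is why the density is written as `F q`.
  have hevol : dtime (timeSet T) (fisher g F) t x - generator (g t) (V t) (fisher g F t) x
      ≤ -(F t x * N) - 2 * lamDot t * fisher g F t x := by
    rw [hdt, hfish, hg.generator_mul hFt hqs]
    have h3 := mul_le_mul_of_nonneg_left hN hFx.le
    have h4 : F t x * ((F t x)⁻¹ * gradInner (g t) (F t) q x) = gradInner (g t) (F t) q x := by
      rw [← mul_assoc, mul_inv_cancel₀ hFx.ne', one_mul]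
    nlinarith [h3, h4]
  have hgr : ∀ d : X → ℝ, gradInner (g t) (fun z => χ z * χ z) d x
      = 2 * χ x * gradInner (g t) χ d x := fun d => by
    rw [gradInner_mul_left hχ hχ]; ring
  have hK := hg.gradSq_nonneg χ x
  -- Nothing bounds `∇q` a priori. As `|(∇q, ∇χ)| ≤ 2 √(N q (∇χ)²)`, Young's inequality gives a term
  -- `χ² F N`, absorbed by the Hessian term of `hevol`, and a small remainder. The factor `χ²` on
  -- `N` is the reason for testing with the square of a cutoff.
  have hcross : -(χ x * (F t x * gradInner (g t) q χ x))
      ≤ F t x * (χ x ^ 2 * N + q x * gradSq (g t) χ x) := by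
    have h5 := hNχ χ
    set K := gradSq (g t) χ x
    have h6 : -(χ x * gradInner (g t) q χ x) ≤ χ x ^ 2 * N + q x * K := by
      refine abs_le_of_sq_le_sq' ?_ (by positivity) |>.2
      have : (χ x ^ 2 * N + q x * K) ^ 2 ≥ 4 * (χ x ^ 2 * N) * (q x * K) := by
        nlinarith [sq_nonneg (χ x ^ 2 * N - q x * K)]
      have := mul_le_mul_of_nonneg_left h5 (sq_nonneg (χ x))
      nlinarith
    nlinarith [mul_le_mul_of_nonneg_left h6 hFx.le]
  have hc2 : -(χ x * (q x * gradInner (g t) (F t) χ x))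
      ≤ q x * (Real.sqrt (gradSq (g t) (F t) x) * Real.sqrt (gradSq (g t) χ x)) := by
    have h7 := hg.abs_gradInner_le (F t) χ x
    have h8 : -(χ x * gradInner (g t) (F t) χ x)
        ≤ Real.sqrt (gradSq (g t) (F t) x) * Real.sqrt (gradSq (g t) χ x) :=
      (neg_le_abs _).trans ((abs_mul _ _).trans_le
        ((mul_le_of_le_one_left (abs_nonneg _) hχ1).trans h7))
    nlinarith [mul_le_mul_of_nonneg_left h8 hq0]
  have hfx : 0 ≤ fisher g F t x := mul_nonneg hFx.le hq0
  have hc3 : fisher g F t x * (χ x * gradInner (g t) χ (fun z => Real.log (Z t z) + V t z) x)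
      ≤ fisher g F t x * (Real.sqrt (gradSq (g t) χ x) *
          Real.sqrt (gradSq (g t) (fun z => Real.log (Z t z) + V t z) x)) :=
    mul_le_mul_of_nonneg_left ((le_abs_self _).trans ((abs_mul _ _).trans_le
      ((mul_le_of_le_one_left (abs_nonneg _) hχ1).trans (hg.abs_gradInner_le _ _ x)))) hfx
  have hfψ : gradInner (g t) (fisher g F t) χ x
      = q x * gradInner (g t) (F t) χ x + F t x * gradInner (g t) q χ x := by
    rw [hfish, gradInner_mul_left hFt hqs]
  rw [weakRate, hgr, hg.gradInner_comm (fisher g F t), hgr, hg.gradInner_comm χ, hfψ]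
  have hev2 := mul_le_mul_of_nonneg_left hevol (mul_self_nonneg (χ x))
  have hfe : fisher g F t x = F t x * q x := rfl
  have hcross' : F t x * (χ x ^ 2 * N + q x * gradSq (g t) χ x)
      = χ x * χ x * (F t x * N) + fisher g F t x * gradSq (g t) χ x := by rw [hfe]; ring
  rw [hcross'] at hcross
  linarith

open IsRenormFlow in
/-- The localised evolution of `h(F)`. -/
theorem IsSolution.weakRate_comp (hS : IsSolution T g V F) (hF : IsRenormFlow T g Z V)
    {h : ℝ → ℝ} {U : Set ℝ} (hU : IsOpen U) (hh : ContDiffOn ℝ ∞ h U)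
    (hFU : ∀ t ∈ timeSet T, ∀ x, F t x ∈ U) (ht : t ∈ timeSet T) (h0 : 0 < t) {χ : X → ℝ}
    (hχ : ContMDiff (𝓡 n) 𝓘(ℝ, ℝ) ∞ χ) {x : X} (hχ1 : |χ x| ≤ 1) :
    weakRate T g Z V (fun z => χ z * χ z) (fun s x => h (F s x)) t x
      ≤ -(1 / 2) * (χ x * χ x * (deriv (deriv h) (F t x) * gradSq (g t) (F t) x))
        + |deriv h (F t x)|
          * (Real.sqrt (gradSq (g t) (F t) x) * Real.sqrt (gradSq (g t) χ x))
        + |h (F t x)| * (Real.sqrt (gradSq (g t) χ x) *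
          Real.sqrt (gradSq (g t) (fun z => Real.log (Z t z) + V t z) x)) := by
  have hg := hF.isSmoothMetric ht
  have hFt := hS.smooth.slice ht
  have hd : DifferentiableAt ℝ h (F t x) :=
    (hh.contDiffAt (hU.mem_nhds (hFU t ht x))).differentiableAt (by simp)
  have hgr : ∀ d : X → ℝ, gradInner (g t) (fun z => χ z * χ z) d x
      = 2 * χ x * gradInner (g t) χ d x := fun d => by
    rw [gradInner_mul_left hχ hχ]; ring
  have hb : ∀ a : ℝ, ∀ c d : X → ℝ, a * (χ x * gradInner (g t) c d x)
      ≤ |a| * (Real.sqrt (gradSq (g t) c x) * Real.sqrt (gradSq (g t) d x)) := fun a c d => by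
    refine (le_abs_self _).trans ((abs_mul _ _).trans_le
      (mul_le_mul_of_nonneg_left ?_ (abs_nonneg _)))
    exact (abs_mul _ _).trans_le
      ((mul_le_of_le_one_left (abs_nonneg _) hχ1).trans (hg.abs_gradInner_le _ _ x))
  rw [weakRate, hgr, hg.gradInner_comm (fun z => h (F t z)), hgr, hg.gradInner_comm χ (fun z => h _),
    gradInner_comp_left hd hFt, hS.dtime_comp hF ht h0 hU hh hFU]
  have e1 := hb (-deriv h (F t x)) (F t) χ
  have e2 := hb (h (F t x)) χ (fun z => Real.log (Z t z) + V t z)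
  rw [abs_neg] at e1
  linarith

end Pointwise

/-! ### Gronwall's inequality with a merely integrable coefficient. -/

section Gronwall

/-- The exponential is Lipschitz on the bounded range of `f`. As `λ̇` is only integrable, the weight
`e^{2λ}` is absolutely continuous and no better. -/
theorem AbsolutelyContinuousOnInterval.exp_comp {f : ℝ → ℝ} {a b : ℝ}
    (hf : AbsolutelyContinuousOnInterval f a b) :
    AbsolutelyContinuousOnInterval (fun s => Real.exp (f s)) a b := by
  obtain ⟨C, hC⟩ := hf.exists_bound
  have hlip : ∀ x ∈ Icc (-C) C, ∀ y ∈ Icc (-C) C,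
      dist (Real.exp x) (Real.exp y) ≤ Real.exp C * dist x y := by
    intro x hx y hy
    have := (convex_Icc (-C) C).norm_image_sub_le_of_norm_deriv_le (f := Real.exp)
      (C := Real.exp C) (fun z _ => Real.differentiableAt_exp) (fun z hz => by
        rw [Real.deriv_exp, Real.norm_eq_abs, Real.abs_exp]; exact Real.exp_le_exp.2 hz.2) hy hx
    simpa [dist_eq_norm] using this
  have hmem : ∀ x ∈ uIcc a b, f x ∈ Icc (-C) C := fun x hx => abs_le.1 (hC x hx)
  rw [absolutelyContinuousOnInterval_iff] at hf ⊢
  intro ε hε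
  obtain ⟨δ, hδ, h⟩ := hf (ε / Real.exp C) (div_pos hε (Real.exp_pos _))
  refine ⟨δ, hδ, fun E hE hlen => ?_⟩
  have h1 := h E hE hlen
  rw [lt_div_iff₀ (Real.exp_pos _)] at h1
  refine lt_of_le_of_lt ?_ h1
  rw [Finset.sum_mul]
  refine Finset.sum_le_sum fun i hi => ?_
  rw [mul_comm]
  exact hlip _ (hmem _ (hE.1 i hi).1) _ (hmem _ (hE.1 i hi).2)

/-- The variation of constants formula, with a coefficient that is only integrable. -/
theorem exp_mul_sub_eq_integral {I r α : ℝ → ℝ} {t : ℝ} (ht : 0 ≤ t)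
    (hα : IntervalIntegrable α volume 0 t) (hI : ContinuousOn I (Icc 0 t))
    (hr : ∀ s ∈ Ioo 0 t, HasDerivAt I (r s) s) (hrint : IntervalIntegrable r volume 0 t) :
    Real.exp (2 * ∫ s in (0 : ℝ)..t, α s) * I t - I 0
      = ∫ s in (0 : ℝ)..t, Real.exp (2 * ∫ v in (0 : ℝ)..s, α v) * (r s + 2 * α s * I s) := by
  set A : ℝ → ℝ := fun s => ∫ v in (0 : ℝ)..s, α v with hA
  -- `I` is recovered from its derivative as a primitive, which is absolutely continuous; then
  -- integration by parts for absolutely continuous functions applies to `e^{2A} J`.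
  set J : ℝ → ℝ := fun s => I 0 + ∫ v in (0 : ℝ)..s, r v with hJ
  have hIJ : ∀ s ∈ Icc 0 t, I s = J s := fun s hs => by
    have h1 := intervalIntegral.integral_eq_sub_of_hasDerivAt_of_le (f := I) (f' := r) hs.1
      (hI.mono (Icc_subset_Icc_right hs.2))
      (fun x hx => hr x ⟨hx.1, hx.2.trans_le hs.2⟩)
      (hrint.mono_set (by rw [uIcc_of_le hs.1, uIcc_of_le ht]; exact Icc_subset_Icc_right hs.2))
    simp only [hJ, h1]; ring
  have hAac : AbsolutelyContinuousOnInterval A 0 t :=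
    hα.absolutelyContinuousOnInterval_intervalIntegral (by simp)
  have hw : AbsolutelyContinuousOnInterval (fun s => Real.exp (2 * A s)) 0 t :=
    AbsolutelyContinuousOnInterval.exp_comp (hAac.const_mul 2)
  have hconst : AbsolutelyContinuousOnInterval (fun _ : ℝ => I 0) 0 t :=
    (contDiff_const (𝕜 := ℝ) (n := 1)).contDiffOn.absolutelyContinuousOnInterval
  have hJac : AbsolutelyContinuousOnInterval J 0 t :=
    hconst.add (hrint.absolutelyContinuousOnInterval_intervalIntegral (by simp))
  have key := hw.integral_deriv_mul_eq_sub hJac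
  have h00 : Real.exp (2 * A 0) * J 0 = I 0 := by simp [hA, hJ]
  rw [h00, ← hIJ t ⟨ht, le_rfl⟩] at key
  rw [← key]
  refine intervalIntegral.integral_congr_ae ?_
  filter_upwards [hα.ae_hasDerivAt_integral, hrint.ae_hasDerivAt_integral] with s h1 h2 hs
  have hs' : s ∈ uIcc 0 t := uIoc_subset_uIcc hs
  have h1' : HasDerivAt A (α s) s := h1 hs' 0 (by simp)
  have h2' : HasDerivAt J (r s) s := (h2 hs' 0 (by simp)).const_add _
  rw [((h1'.const_mul 2).exp).deriv, h2'.deriv, hIJ s (by rwa [uIcc_of_le ht] at hs')]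
  ring

theorem exp_two_mul_integral_le {α : ℝ → ℝ} {t : ℝ} (ht : 0 ≤ t)
    (hα : IntervalIntegrable α volume 0 t) :
    ∃ C : ℝ, ∀ s ∈ Icc 0 t, Real.exp (2 * ∫ v in (0 : ℝ)..s, α v) ≤ C := by
  have hAac : AbsolutelyContinuousOnInterval (fun s => ∫ v in (0 : ℝ)..s, α v) 0 t :=
    hα.absolutelyContinuousOnInterval_intervalIntegral (by simp)
  obtain ⟨C, hC⟩ := (AbsolutelyContinuousOnInterval.exp_comp (hAac.const_mul 2)).exists_bound
  exact ⟨C, fun s hs => (le_abs_self _).trans (hC s (by rwa [uIcc_of_le ht]))⟩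

theorem ofReal_integral_le_lintegral {Y : Type*} [MeasurableSpace Y] {μ : Measure Y} {f : Y → ℝ}
    (hf : Integrable f μ) : ENNReal.ofReal (∫ x, f x ∂μ) ≤ ∫⁻ x, ENNReal.ofReal (f x) ∂μ := by
  have h1 : ∫ x, f x ∂μ ≤ ∫ x, max (f x) 0 ∂μ :=
    integral_mono hf hf.pos_part fun x => le_max_left _ _
  refine (ENNReal.ofReal_le_ofReal h1).trans ?_
  rw [ofReal_integral_eq_lintegral_ofReal hf.pos_part
    (Eventually.of_forall fun x => le_max_right _ _)]
  exact lintegral_mono fun x => by simp [ENNReal.ofReal_max]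

/-- Gronwall's inequality with a defect that is controlled in the lower integral. -/
theorem exp_mul_le_add {I r α β : ℝ → ℝ} {t C : ℝ} (ht : 0 ≤ t)
    (hα : IntervalIntegrable α volume 0 t) (hI : ContinuousOn I (Icc 0 t))
    (hr : ∀ s ∈ Ioo 0 t, HasDerivAt I (r s) s) (hrint : IntervalIntegrable r volume 0 t)
    (hβ : IntervalIntegrable β volume 0 t)
    (hC : ∀ s ∈ Icc 0 t, Real.exp (2 * ∫ v in (0 : ℝ)..s, α v) ≤ C)
    {e : ℝ → ℝ≥0∞} {M : ℝ} (hM : 0 ≤ M)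
    (he : ∀ s ∈ Ioo 0 t, ENNReal.ofReal (r s + 2 * α s * I s - β s) ≤ e s)
    (heM : ∫⁻ s in Icc 0 t, e s ≤ ENNReal.ofReal M) :
    Real.exp (2 * ∫ s in (0 : ℝ)..t, α s) * I t
      ≤ I 0 + (∫ s in (0 : ℝ)..t, Real.exp (2 * ∫ v in (0 : ℝ)..s, α v) * β s) + C * M := by
  set A : ℝ → ℝ := fun s => ∫ v in (0 : ℝ)..s, α v with hA
  have hAc : ContinuousOn (fun s => Real.exp (2 * A s)) (uIcc 0 t) :=
    (Real.continuous_exp.comp_continuousOn (continuousOn_const.mul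
      (hα.absolutelyContinuousOnInterval_intervalIntegral (by simp)).continuousOn))
  have hI' : ContinuousOn I (uIcc 0 t) := by rwa [uIcc_of_le ht]
  have hg : IntervalIntegrable (fun s => r s + 2 * α s * I s) volume 0 t :=
    hrint.add ((hα.const_mul 2).mul_continuousOn hI')
  have hg1 : IntervalIntegrable (fun s => r s + 2 * α s * I s - β s) volume 0 t := hg.sub hβ
  have h2 := hg1.continuousOn_mul hAc
  have h3 := hβ.continuousOn_mul hAc
  have h1 := exp_mul_sub_eq_integral ht hα hI hr hrint
  have h4 : ∫ s in (0 : ℝ)..t, Real.exp (2 * A s) * (r s + 2 * α s * I s)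
      = (∫ s in (0 : ℝ)..t, Real.exp (2 * A s) * (r s + 2 * α s * I s - β s))
        + ∫ s in (0 : ℝ)..t, Real.exp (2 * A s) * β s := by
    rw [← intervalIntegral.integral_add h2 h3]
    exact intervalIntegral.integral_congr fun s _ => by ring
  have hC0 : 0 ≤ C := (Real.exp_pos _).le.trans (hC 0 ⟨le_rfl, ht⟩)
  -- `e` is not assumed measurable. Its lower integral is still monotone and compatible with finite
  -- constants, which suffices.
  have h5 : ∫ s in (0 : ℝ)..t, Real.exp (2 * A s) * (r s + 2 * α s * I s - β s) ≤ C * M := by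
    rw [intervalIntegral.integral_of_le ht, integral_Ioc_eq_integral_Ioo]
    have h6 : IntegrableOn (fun s => Real.exp (2 * A s) * (r s + 2 * α s * I s - β s))
        (Ioo 0 t) volume :=
      ((intervalIntegrable_iff_integrableOn_Ioc_of_le ht).1 h2).mono_set Ioo_subset_Ioc_self
    have h7 := ofReal_integral_le_lintegral h6
    rw [← ENNReal.ofReal_le_ofReal_iff (mul_nonneg hC0 hM)]
    refine h7.trans ?_
    rw [ENNReal.ofReal_mul hC0]
    calc ∫⁻ s in Ioo 0 t, ENNReal.ofReal (Real.exp (2 * A s) * (r s + 2 * α s * I s - β s))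
        ≤ ∫⁻ s in Ioo 0 t, ENNReal.ofReal C * e s := by
          refine setLIntegral_mono' measurableSet_Ioo fun s hs => ?_
          rw [ENNReal.ofReal_mul (Real.exp_pos _).le]
          exact mul_le_mul' (ENNReal.ofReal_le_ofReal (hC s (Ioo_subset_Icc_self hs))) (he s hs)
      _ = ENNReal.ofReal C * ∫⁻ s in Ioo 0 t, e s := lintegral_const_mul' _ _ (by simp)
      _ ≤ ENNReal.ofReal C * ENNReal.ofReal M := by
          gcongr
          exact (lintegral_mono_set Ioo_subset_Icc_self).trans heM
  rw [h4] at h1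
  linarith

end Gronwall

/-! ### Cutoff functions from the proper function of the completeness assumption. -/

section Cutoff

variable {n : ℕ} {X : Type*} [TopologicalSpace X] [T2Space X] [SecondCountableTopology X]
  [ChartedSpace (Model n) X] [IsManifold (𝓡 n) ∞ X] [MeasurableSpace X] [BorelSpace X]

/-- A smooth step function: `1` on `(-∞, 1]` and `0` on `[2, ∞)`. -/
def stepDown (r : ℝ) : ℝ := Real.smoothTransition (2 - r)

theorem contDiff_stepDown : ContDiff ℝ ∞ stepDown :=
  Real.smoothTransition.contDiff.comp (contDiff_const.sub contDiff_id)

theorem exists_deriv_stepDown_le : ∃ C : ℝ, 0 ≤ C ∧ ∀ r, |deriv stepDown r| ≤ C := by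
  have hc : Continuous (deriv stepDown) := contDiff_stepDown.continuous_deriv (by simp)
  obtain ⟨C, hC⟩ := isCompact_Icc.exists_bound_of_continuousOn (s := Icc (1 : ℝ) 2) hc.continuousOn
  refine ⟨max C 0, le_max_right _ _, fun r => ?_⟩
  by_cases hr : r ∈ Icc (1 : ℝ) 2
  · exact (hC r hr).trans (le_max_left _ _)
  · have : deriv stepDown r = 0 := by
      rw [mem_Icc, not_and_or, not_le, not_le] at hr
      rcases hr with hr | hr
      · have h : stepDown =ᶠ[𝓝 r] fun _ => 1 := by
          filter_upwards [isOpen_Iio.mem_nhds hr] with s hs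
          exact Real.smoothTransition.one_of_one_le (by linarith [mem_Iio.1 hs])
        rw [h.deriv_eq, deriv_const]
      · have h : stepDown =ᶠ[𝓝 r] fun _ => 0 := by
          filter_upwards [isOpen_Ioi.mem_nhds hr] with s hs
          exact Real.smoothTransition.zero_of_nonpos (by linarith [mem_Ioi.1 hs])
        rw [h.deriv_eq, deriv_const]
    rw [this, abs_zero]
    exact le_max_right _ _

/-- A sequence of cutoff functions exhausting `X`, with gradients tending to zero uniformly in
`t ∈ [0, t₁]`. -/
structure IsCutoff (g : ℝ → RMetric n X) (t₁ : ℝ) (C : ℝ) (χ : ℕ → X → ℝ) : Prop where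
  smooth : ∀ k, ContMDiff (𝓡 n) 𝓘(ℝ, ℝ) ∞ (χ k)
  compact : ∀ k, HasCompactSupport (χ k)
  nonneg : ∀ k x, 0 ≤ χ k x
  le_one : ∀ k x, χ k x ≤ 1
  eventually_one : ∀ x, ∀ᶠ k in atTop, χ k x = 1
  const_nonneg : 0 ≤ C
  sqrt_gradSq_le : ∀ k, ∀ t ∈ Icc 0 t₁, ∀ x, Real.sqrt (gradSq (g t) (χ k) x) ≤ C / (k + 1)

variable {T : EReal} {g : ℝ → RMetric n X} {Z V : ℝ → X → ℝ} {t t₁ : ℝ}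

/-- Rescale the proper function: `χ_k = stepDown (ρ / (k + 1))` is compactly supported, eventually
one at each point, and the chain rule gives a gradient at most `sup |stepDown'| · sup |∇ρ| / (k +
1)`, uniformly in time. -/
theorem exists_isCutoff (hF : IsRenormFlow T g Z V) (htame : IsTameAtInfinity T g Z V)
    (ht₁ : t₁ ∈ timeSet T) : ∃ C χ, IsCutoff g t₁ C χ := by
  obtain ⟨ρ, hρ, hρt, R, hR⟩ := htame.complete t₁ ht₁
  obtain ⟨D, hD0, hD⟩ := exists_deriv_stepDown_le
  have hk : ∀ k : ℕ, (0 : ℝ) < k + 1 := fun k => by positivity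
  refine ⟨D * Real.sqrt R, fun k x => stepDown (ρ x / (k + 1)), ?_, ?_, ?_, ?_, ?_,
    mul_nonneg hD0 (Real.sqrt_nonneg _), ?_⟩
  · intro k
    exact (contDiff_stepDown.comp (contDiff_id.div_const _)).contMDiff.comp hρ
  · intro k
    have h1 : ∀ᶠ x in cocompact X, 2 * ((k : ℝ) + 1) ≤ ρ x := hρt.eventually_ge_atTop _
    obtain ⟨K, hK, hKs⟩ := mem_cocompact.1 h1
    refine HasCompactSupport.intro hK fun x hx => ?_
    refine Real.smoothTransition.zero_of_nonpos ?_
    have : 2 ≤ ρ x / (k + 1) := (le_div_iff₀ (hk k)).2 (hKs hx)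
    linarith
  · exact fun k x => Real.smoothTransition.nonneg _
  · exact fun k x => Real.smoothTransition.le_one _
  · intro x
    filter_upwards [eventually_ge_atTop ⌈ρ x⌉₊] with k hkx
    refine Real.smoothTransition.one_of_one_le ?_
    have h2 : ρ x ≤ k := (Nat.le_ceil _).trans (by exact_mod_cast hkx)
    have : ρ x / (k + 1) ≤ 1 := (div_le_one (hk k)).2 (by linarith)
    linarith
  · intro k t ht x
    have hg := hF.isSmoothMetric (Icc_subset_timeSet ht₁ ht)
    have hd : HasDerivAt (fun r => stepDown (r / ((k : ℝ) + 1)))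
        (deriv stepDown (ρ x / (k + 1)) * (1 / (k + 1))) (ρ x) :=
      ((contDiff_stepDown.differentiable (by simp)) _).hasDerivAt.comp (ρ x)
        ((hasDerivAt_id' (ρ x)).div_const _)
    have h3 : gradSq (g t) (fun z => stepDown (ρ z / (k + 1))) x
        = (deriv stepDown (ρ x / (k + 1)) * (1 / (k + 1))) ^ 2 * gradSq (g t) ρ x := by
      have e : ∀ d : X → ℝ, gradInner (g t) (fun z => stepDown (ρ z / (k + 1))) d x
          = deriv stepDown (ρ x / (k + 1)) * (1 / (k + 1)) * gradInner (g t) ρ d x := fun d => by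
        rw [gradInner_comp_left (φ := fun r => stepDown (r / ((k : ℝ) + 1)))
          hd.differentiableAt hρ, hd.deriv]
      rw [gradSq, e, hg.gradInner_comm, e, gradSq]
      ring
    rw [h3, Real.sqrt_mul (sq_nonneg _), Real.sqrt_sq_eq_abs, abs_mul,
      abs_of_pos (one_div_pos.2 (hk k))]
    calc |deriv stepDown (ρ x / (k + 1))| * (1 / (k + 1)) * Real.sqrt (gradSq (g t) ρ x)
        ≤ D * (1 / (k + 1)) * Real.sqrt R := by
          gcongr
          · exact hD _
          · exact hR t ht x
      _ = D * Real.sqrt R / (k + 1) := by ring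

end Cutoff

/-! ### Removing the cutoff: evolution of global integrals. -/

section Global

variable {n : ℕ} {X : Type*} [TopologicalSpace X] [T2Space X] [SecondCountableTopology X]
  [ChartedSpace (Model n) X] [IsManifold (𝓡 n) ∞ X] [MeasurableSpace X] [BorelSpace X]

variable {T : EReal} {g : ℝ → RMetric n X} {Z V : ℝ → X → ℝ} {t s : ℝ} {C : ℝ} {χ : ℕ → X → ℝ}

theorem IsCutoff.abs_le_one (hχ : IsCutoff g t C χ) (k : ℕ) (x : X) : |χ k x| ≤ 1 := by
  rw [abs_of_nonneg (hχ.nonneg k x)]; exact hχ.le_one k x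

theorem IsCutoff.smooth_sq (hχ : IsCutoff g t C χ) (k : ℕ) :
    ContMDiff (𝓡 n) 𝓘(ℝ, ℝ) ∞ fun x => χ k x * χ k x := (hχ.smooth k).mul (hχ.smooth k)

theorem IsCutoff.compact_sq (hχ : IsCutoff g t C χ) (k : ℕ) :
    HasCompactSupport fun x => χ k x * χ k x := (hχ.compact k).mul_right

theorem integrable_of_bounded {μ : Measure X} [IsFiniteMeasure μ] {f : X → ℝ} (hf : Continuous f)
    {B : ℝ} (hB : ∀ x, |f x| ≤ B) : Integrable f μ :=
  Integrable.of_bound hf.aestronglyMeasurable B (Eventually.of_forall hB)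

theorem IsCutoff.tendsto_integral (hχ : IsCutoff g t C χ) {μ : Measure X} [IsFiniteMeasure μ]
    {f : X → ℝ} (hf : Continuous f) {B : ℝ} (hB : ∀ x, |f x| ≤ B) :
    Tendsto (fun k => ∫ x, χ k x * χ k x * f x ∂μ) atTop (𝓝 (∫ x, f x ∂μ)) := by
  refine tendsto_integral_of_dominated_convergence (fun _ => B)
    (fun k => ((hχ.smooth_sq k).continuous.mul hf).aestronglyMeasurable) (integrable_const _)
    (fun k => Eventually.of_forall fun x => ?_) (Eventually.of_forall fun x => ?_)
  · have h1 : |χ k x * χ k x| ≤ 1 := by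
      rw [abs_mul]; exact mul_le_one₀ (hχ.abs_le_one k x) (abs_nonneg _) (hχ.abs_le_one k x)
    rw [Real.norm_eq_abs, abs_mul]
    exact (mul_le_of_le_one_left (abs_nonneg _) h1).trans (hB x)
  · refine tendsto_const_nhds.congr' ?_
    filter_upwards [hχ.eventually_one x] with k hk
    rw [hk]; ring

namespace IsRenormFlow

theorem integrable_weakRate (hF : IsRenormFlow T g Z V) (hT : 0 < T) {η : X → ℝ} {ψ : ℝ → X → ℝ}
    (hη : ContMDiff (𝓡 n) 𝓘(ℝ, ℝ) ∞ η) (hηc : HasCompactSupport η)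
    (hψ : SmoothT n (timeSet T) ψ) (hs : s ∈ timeSet T) :
    Integrable (weakRate T g Z V η ψ s) (weightedMeasure (g s) (Z s) (V s)) := by
  have := hF.isFiniteMeasure hs
  have hg := hF.isSmoothMetric hs
  have hψs := hψ.slice hs
  refine Continuous.integrable_of_hasCompactSupport ?_
    (HasCompactSupport.intro hηc.isCompact fun x hx => ?_)
  · exact ((hη.continuous.mul (((hψ.dtime (uniqueDiffOn_timeSet hT)).slice hs).continuous.sub
      ((continuous_const.mul (hg.contMDiff_laplaceBeltrami hψs).continuous).sub
        (hg.contMDiff_gradInner (hF.smoothT_V.slice hs) hψs).continuous))).sub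
      (continuous_const.mul (hg.contMDiff_gradInner hψs hη).continuous)).add
      ((continuous_const.mul hψs.continuous).mul (hg.contMDiff_gradInner hη
        ((hF.smoothT_logZ.add hF.smoothT_V).slice hs)).continuous)
  · have h0 := gradInner_eq_zero_of_eventually (g := g s) (notMem_tsupport_iff_eventuallyEq.1 hx)
    rw [weakRate, image_eq_zero_of_notMem_tsupport hx, hg.gradInner_comm (ψ s) η, h0, h0]
    ring

/-- Removal of the cutoff: a differential inequality for the localised integrals, with errors
that vanish in the limit, integrates to an inequality for the full integrals. -/
theorem exp_mul_integral_le (hF : IsRenormFlow T g Z V) (hT : 0 < T) (ht : t ∈ timeSet T)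
    (hχ : IsCutoff g t C χ) {ψ : ℝ → X → ℝ} (hψ : SmoothT n (timeSet T) ψ) {B : ℝ}
    (hB : ∀ s ∈ Icc 0 t, ∀ x, |ψ s x| ≤ B) {α β : ℝ → ℝ} (hα : IntervalIntegrable α volume 0 t)
    (hβ : IntervalIntegrable β volume 0 t) {e : ℝ → ℝ≥0∞} (he : ∫⁻ s in Icc 0 t, e s ≠ ⊤)
    (h : ∀ k, ∀ s ∈ Ioo 0 t, ENNReal.ofReal
      ((∫ x, weakRate T g Z V (fun x => χ k x * χ k x) ψ s x ∂(weightedMeasure (g s) (Z s) (V s)))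
        + 2 * α s * (∫ x, χ k x * χ k x * ψ s x ∂(weightedMeasure (g s) (Z s) (V s))) - β s)
      ≤ ENNReal.ofReal (1 / ((k : ℝ) + 1)) * e s) :
    Real.exp (2 * ∫ s in (0 : ℝ)..t, α s) * ∫ x, ψ t x ∂(weightedMeasure (g t) (Z t) (V t))
      ≤ (∫ x, ψ 0 x ∂(weightedMeasure (g 0) (Z 0) (V 0)))
        + ∫ s in (0 : ℝ)..t, Real.exp (2 * ∫ v in (0 : ℝ)..s, α v) * β s := by
  have h0 := zero_mem_timeSet hT
  have hsub := Icc_subset_timeSet ht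
  have := hF.isFiniteMeasure ht
  have := hF.isFiniteMeasure h0
  obtain ⟨K, hK⟩ := exp_two_mul_integral_le ht.1 hα
  have hfin : ∀ k : ℕ, Real.exp (2 * ∫ s in (0 : ℝ)..t, α s)
      * (∫ x, χ k x * χ k x * ψ t x ∂(weightedMeasure (g t) (Z t) (V t)))
      ≤ (∫ x, χ k x * χ k x * ψ 0 x ∂(weightedMeasure (g 0) (Z 0) (V 0)))
        + (∫ s in (0 : ℝ)..t, Real.exp (2 * ∫ v in (0 : ℝ)..s, α v) * β s)
        + K * (1 / ((k : ℝ) + 1) * (∫⁻ s in Icc 0 t, e s).toReal) := by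
    intro k
    have hη := hχ.smooth_sq k
    have hηc := hχ.compact_sq k
    have hpos : (0 : ℝ) ≤ 1 / ((k : ℝ) + 1) := by positivity
    -- The rate is supplied in its form over `μ_0`, whose continuity on `[0, t]` gives
    -- integrability; the hypothesis `h` is translated by `integral_weakRate`.
    refine exp_mul_le_add
      (I := fun s => ∫ x, χ k x * χ k x * ψ s x ∂(weightedMeasure (g s) (Z s) (V s)))
      (r := fun s => ∫ x, (χ k x * χ k x) * dtime (timeSet T)
        (fun t x => weightRatio g Z V t x * ψ t x) s x ∂(weightedMeasure (g 0) (Z 0) (V 0)))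
      ht.1 hα ((hF.continuousOn_integral hT hη hηc hψ).mono hsub) (fun s hs => ?_) ?_ hβ hK
      (mul_nonneg hpos ENNReal.toReal_nonneg)
      (e := fun s => ENNReal.ofReal (1 / ((k : ℝ) + 1)) * e s) (fun s hs => ?_) ?_
    · rw [← hF.integral_weakRate hT hη hηc hψ (hsub (Ioo_subset_Icc_self hs)) hs.1]
      exact hF.hasDerivAt_integral hT hη hηc hψ (hsub (Ioo_subset_Icc_self hs)) hs.1
    · refine ContinuousOn.intervalIntegrable ?_
      rw [uIcc_of_le ht.1]
      exact (hF.continuousOn_weakRate_reference hT hη hηc hψ).mono hsub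
    · rw [← hF.integral_weakRate hT hη hηc hψ (hsub (Ioo_subset_Icc_self hs)) hs.1]
      exact h k s hs
    · rw [lintegral_const_mul' _ _ (by simp), ENNReal.ofReal_mul hpos, ENNReal.ofReal_toReal he]
  have hcont : ∀ {s}, s ∈ timeSet T → Continuous (ψ s) := fun hs => (hψ.slice hs).continuous
  have l1 := (hχ.tendsto_integral (μ := weightedMeasure (g t) (Z t) (V t)) (hcont ht)
    (hB t ⟨ht.1, le_rfl⟩)).const_mul (Real.exp (2 * ∫ s in (0 : ℝ)..t, α s))
  have l2 := hχ.tendsto_integral (μ := weightedMeasure (g 0) (Z 0) (V 0)) (hcont h0)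
    (hB 0 ⟨le_rfl, ht.1⟩)
  have l3 : Tendsto (fun k : ℕ => K * (1 / ((k : ℝ) + 1) * (∫⁻ s in Icc 0 t, e s).toReal))
      atTop (𝓝 0) := by
    simpa using (tendsto_one_div_add_atTop_nhds_zero_nat.mul_const
      (∫⁻ s in Icc 0 t, e s).toReal).const_mul K
  -- As `k → ∞` the localised integrals converge by dominated convergence and the error is a fixed
  -- finite quantity divided by `k + 1`.
  have := le_of_tendsto_of_tendsto' l1 ((l2.add_const _).add l3) hfin
  simpa using this

/-- The total current at time `s`. -/
def current (g : ℝ → RMetric n X) (Z V : ℝ → X → ℝ) (s : ℝ) : ℝ≥0∞ :=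
  ∫⁻ x, ENNReal.ofReal (Real.sqrt (gradSq (g s) (fun y => Real.log (Z s y) + V s y) x))
    ∂(weightedMeasure (g s) (Z s) (V s))

/-- Every cutoff error has this shape: a small factor times a bounded part, integrated against the
finite mass, plus a part proportional to the density of the current. -/
theorem ofReal_integral_le_current {f : X → ℝ}
    (hf : Integrable f (weightedMeasure (g s) (Z s) (V s))) {c a b : ℝ} (hc : 0 ≤ c) (ha : 0 ≤ a)
    (hb : 0 ≤ b)
    (h : ∀ x, f x ≤ c * (a + b * Real.sqrt (gradSq (g s) (fun y => Real.log (Z s y) + V s y) x))) :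
    ENNReal.ofReal (∫ x, f x ∂(weightedMeasure (g s) (Z s) (V s)))
      ≤ ENNReal.ofReal c * (ENNReal.ofReal a * weightedMeasure (g s) (Z s) (V s) univ
        + ENNReal.ofReal b * current g Z V s) := by
  refine (ofReal_integral_le_lintegral hf).trans ?_
  calc ∫⁻ x, ENNReal.ofReal (f x) ∂(weightedMeasure (g s) (Z s) (V s))
      ≤ ∫⁻ x, ENNReal.ofReal c * (ENNReal.ofReal a + ENNReal.ofReal b * ENNReal.ofReal
          (Real.sqrt (gradSq (g s) (fun y => Real.log (Z s y) + V s y) x)))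
          ∂(weightedMeasure (g s) (Z s) (V s)) := by
        refine lintegral_mono fun x => (ENNReal.ofReal_le_ofReal (h x)).trans ?_
        rw [ENNReal.ofReal_mul hc, ENNReal.ofReal_add ha (mul_nonneg hb (Real.sqrt_nonneg _)),
          ENNReal.ofReal_mul hb]
    _ = _ := by
        rw [lintegral_const_mul' _ _ (by simp), lintegral_add_left measurable_const,
          lintegral_const, lintegral_const_mul' _ _ (by simp), current]

theorem lintegral_error_ne_top (htame : IsTameAtInfinity T g Z V) (ht : t ∈ timeSet T) (b : ℝ)
    {K : ℝ≥0∞} (hK : K ≠ ⊤) :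
    ∫⁻ s in Icc 0 t, (K + ENNReal.ofReal b * current g Z V s) ≠ ⊤ := by
  rw [lintegral_add_left measurable_const, lintegral_const_mul' _ _ ENNReal.ofReal_ne_top,
    lintegral_const]
  exact ENNReal.add_ne_top.2 ⟨ENNReal.mul_ne_top hK (by simp),
    ENNReal.mul_ne_top (by simp) (htame.integrable_current t ht)⟩

end IsRenormFlow

namespace IsSolution

open IsRenormFlow

variable {F : ℝ → X → ℝ}

theorem continuous_deriv_deriv_comp (hS : IsSolution T g V F) (hF : IsRenormFlow T g Z V)
    {h : ℝ → ℝ} {U : Set ℝ} (hU : IsOpen U) (hh : ContDiffOn ℝ ∞ h U)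
    (hFU : ∀ t ∈ timeSet T, ∀ x, F t x ∈ U) (hs : s ∈ timeSet T) :
    Continuous fun x => deriv (deriv h) (F s x) * gradSq (g s) (F s) x := by
  have h1 : ContDiffOn ℝ ∞ (deriv h) U := hh.deriv_of_isOpen hU (by simp)
  have h2 : ContinuousOn (deriv (deriv h)) U := h1.continuousOn_deriv_of_isOpen hU (by simp)
  have hFs := hS.smooth.slice hs
  exact (h2.comp_continuous hFs.continuous (hFU s hs)).mul
    ((hF.isSmoothMetric hs).contMDiff_gradInner hFs hFs).continuous

/-- The evolution of `∫ h(F_t) e^{-V_t} Z_t dm_{g_t}`. -/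
theorem integral_comp_le (hS : IsSolution T g V F) (hF : IsRenormFlow T g Z V) (hT : 0 < T)
    (htame : IsTameAtInfinity T g Z V) (ht : t ∈ timeSet T) (hχ : IsCutoff g t C χ)
    {h : ℝ → ℝ} {U : Set ℝ} (hU : IsOpen U) (hh : ContDiffOn ℝ ∞ h U)
    (hFU : ∀ t ∈ timeSet T, ∀ x, F t x ∈ U) {B H D : ℝ}
    (hB : ∀ s ∈ Icc 0 t, ∀ x, gradSq (g s) (F s) x ≤ B)
    (hH : ∀ s ∈ Icc 0 t, ∀ x, |h (F s x)| ≤ H) (hD : ∀ s ∈ Icc 0 t, ∀ x, |deriv h (F s x)| ≤ D)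
    (hH0 : 0 ≤ H) (hD0 : 0 ≤ D) {M : ℝ≥0∞} (hM : M ≠ ⊤)
    (hm : ∀ s ∈ Icc 0 t, ENNReal.ofReal D * weightedMeasure (g s) (Z s) (V s) univ
      ≤ ENNReal.ofReal D * M)
    {β : ℝ → ℝ} (hβ : IntervalIntegrable β volume 0 t)
    (hβle : ∀ k, ∀ s ∈ Ioo 0 t, -(1 / 2) * (∫ x, χ k x * χ k x *
      (deriv (deriv h) (F s x) * gradSq (g s) (F s) x) ∂(weightedMeasure (g s) (Z s) (V s))) ≤ β s) :
    ∫ x, h (F t x) ∂(weightedMeasure (g t) (Z t) (V t))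
      ≤ (∫ x, h (F 0 x) ∂(weightedMeasure (g 0) (Z 0) (V 0))) + ∫ s in (0 : ℝ)..t, β s := by
  have hψ : SmoothT n (timeSet T) fun t x => h (F t x) := hS.smooth.comp hh hFU
  have hC0 := hχ.const_nonneg
  have ha : 0 ≤ C * Real.sqrt B * D := mul_nonneg (mul_nonneg hC0 (Real.sqrt_nonneg _)) hD0
  have hb : 0 ≤ C * H := mul_nonneg hC0 hH0
  -- There is no exponential weight; the dissipation is put into `β`. The gradient of the cutoff, at
  -- most `C / (k + 1)`, meets `h'(F) ∇F`, bounded by `D √B`, and `h(F)` times the current, bounded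
  -- by `H` times its density.
  have main := hF.exp_mul_integral_le hT ht hχ hψ (α := fun _ => 0) hH
    (by simp) hβ (e := fun s => ENNReal.ofReal (C * Real.sqrt B * D) * M
      + ENNReal.ofReal (C * H) * current g Z V s)
    (lintegral_error_ne_top htame ht _ (ENNReal.mul_ne_top (by simp) hM)) (fun k s hs => ?_)
  · simpa using main
  have hsI := Ioo_subset_Icc_self hs
  have hsT := Icc_subset_timeSet ht hsI
  have hfin := hF.isFiniteMeasure hsT
  have hpos : (0 : ℝ) ≤ 1 / ((k : ℝ) + 1) := by positivity
  have i1 := hF.integrable_weakRate hT (hχ.smooth_sq k) (hχ.compact_sq k) hψ hsT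
  have i2 : Integrable (fun x => χ k x * χ k x * (deriv (deriv h) (F s x) * gradSq (g s) (F s) x))
      (weightedMeasure (g s) (Z s) (V s)) :=
    ((hχ.smooth_sq k).continuous.mul (hS.continuous_deriv_deriv_comp hF hU hh hFU hsT)
      ).integrable_of_hasCompactSupport (hχ.compact_sq k).mul_right
  have i3 := i1.add (i2.const_mul (1 / 2))
  have e3 : (∫ x, weakRate T g Z V (fun x => χ k x * χ k x) (fun t x => h (F t x)) s x
        ∂(weightedMeasure (g s) (Z s) (V s)))
      + 2 * 0 * (∫ x, χ k x * χ k x * h (F s x) ∂(weightedMeasure (g s) (Z s) (V s))) - β s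
      ≤ ∫ x, (weakRate T g Z V (fun x => χ k x * χ k x) (fun t x => h (F t x)) s x
        + (1 / 2) * (χ k x * χ k x * (deriv (deriv h) (F s x) * gradSq (g s) (F s) x)))
        ∂(weightedMeasure (g s) (Z s) (V s)) := by
    rw [integral_add i1 (i2.const_mul (1 / 2)), integral_const_mul]
    have := hβle k s hs
    linarith
  refine (ENNReal.ofReal_le_ofReal e3).trans ((ofReal_integral_le_current i3 hpos ha hb
    fun x => ?_).trans ?_)
  · have h1 := hS.weakRate_comp hF hU hh hFU hsT hs.1 (hχ.smooth k) (hχ.abs_le_one k x)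
    set J := Real.sqrt (gradSq (g s) (fun z => Real.log (Z s z) + V s z) x)
    have h2 := hχ.sqrt_gradSq_le k s hsI x
    have h3 : Real.sqrt (gradSq (g s) (F s) x) ≤ Real.sqrt B := Real.sqrt_le_sqrt (hB s hsI x)
    have h4 : |deriv h (F s x)| * (Real.sqrt (gradSq (g s) (F s) x)
        * Real.sqrt (gradSq (g s) (χ k) x)) ≤ D * (Real.sqrt B * (C / (k + 1))) := by
      gcongr
      exact hD s hsI x
    have h5 : |h (F s x)| * (Real.sqrt (gradSq (g s) (χ k) x) * J) ≤ H * (C / (k + 1) * J) := by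
      gcongr
      exact hH s hsI x
    have h6 : 1 / ((k : ℝ) + 1) * (C * Real.sqrt B * D + C * H * J)
        = D * (Real.sqrt B * (C / (k + 1))) + H * (C / (k + 1) * J) := by ring
    simp only [Pi.add_apply]
    rw [h6]
    linarith
  · gcongr ENNReal.ofReal _ * (?_ + _)
    rw [ENNReal.ofReal_mul (mul_nonneg hC0 (Real.sqrt_nonneg _)), mul_assoc, mul_assoc]
    gcongr ENNReal.ofReal _ * ?_
    exact hm s hsI

end IsSolution

end Global

/-! ### Conservation of mass, maximum principle, decay of Fisher information and entropy. -/

section Global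

variable {n : ℕ} {X : Type*} [TopologicalSpace X] [T2Space X] [SecondCountableTopology X]
  [ChartedSpace (Model n) X] [IsManifold (𝓡 n) ∞ X] [MeasurableSpace X] [BorelSpace X]

variable {T : EReal} {g : ℝ → RMetric n X} {Z V : ℝ → X → ℝ} {t s : ℝ} {C : ℝ} {χ : ℕ → X → ℝ}

/-- Provides a solution along which a constant `h` can be evaluated, so that conservation of mass
becomes a case of `integral_comp_le`. -/
theorem isSolution_zero (hF : IsRenormFlow T g Z V) : IsSolution T g V fun _ _ => 0 where
  smooth := smoothT_const 0
  evolution t ht _ x := by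
    have hz : ∀ d : X → ℝ, gradInner (g t) (fun _ => 0) d x = 0 := fun d =>
      gradInner_eq_zero_of_eventually (Eventually.of_forall fun _ => rfl) d
    have hm := (hF.isSmoothMetric ht).laplaceBeltrami_mul (a := fun _ => 0) (b := fun _ => 0)
      contMDiff_const contMDiff_const x
    rw [generator, (hF.isSmoothMetric ht).gradInner_comm, hz]
    simp only [mul_zero, zero_mul, hz, add_zero] at hm
    simp [hm]

/-- Conservation of mass. -/
theorem IsRenormFlow.real_univ_eq (hF : IsRenormFlow T g Z V) (hT : 0 < T)
    (htame : IsTameAtInfinity T g Z V) (ht : t ∈ timeSet T) :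
    (weightedMeasure (g t) (Z t) (V t)).real univ
      = (weightedMeasure (g 0) (Z 0) (V 0)).real univ := by
  obtain ⟨C, χ, hχ⟩ := exists_isCutoff hF htame ht
  have hgr : ∀ s ∈ Icc 0 t, ∀ x : X, gradSq (g s) (fun _ => (0 : ℝ)) x ≤ 0 := fun s _ x =>
    (gradInner_eq_zero_of_eventually (Eventually.of_forall fun _ => rfl) _).le
  have key : ∀ c : ℝ, |c| ≤ 1 → (weightedMeasure (g t) (Z t) (V t)).real univ * c
      ≤ (weightedMeasure (g 0) (Z 0) (V 0)).real univ * c := fun c hc => by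
    -- Since `h' = 0` one may take `D = 0`, and the mass bound required by `integral_comp_le` is
    -- empty; a bound on the masses at intermediate times is just what is not yet available. The
    -- values `c = ±1` give the two inequalities.
    have h := (isSolution_zero hF).integral_comp_le hF hT htame ht hχ (h := fun _ => c)
      isOpen_univ contDiffOn_const (fun _ _ _ => mem_univ _) hgr (H := 1) (D := 0)
      (fun _ _ _ => hc) (by simp) zero_le_one le_rfl (M := 0) (by simp) (by simp)
      (β := fun _ => 0) (by simp) (by simp)
    simpa using h
  have h1 := key 1 (by simp)
  have h2 := key (-1) (by simp)
  linarith

theorem IsRenormFlow.univ_eq (hF : IsRenormFlow T g Z V) (hT : 0 < T)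
    (htame : IsTameAtInfinity T g Z V) (ht : t ∈ timeSet T) :
    weightedMeasure (g t) (Z t) (V t) univ = weightedMeasure (g 0) (Z 0) (V 0) univ := by
  have h := hF.real_univ_eq hT htame ht
  rwa [Measure.real, Measure.real, ENNReal.toReal_eq_toReal_iff' (hF.finite_mass t ht)
    (hF.finite_mass 0 (zero_mem_timeSet hT))] at h

namespace IsSolution

open IsRenormFlow

variable {F : ℝ → X → ℝ}

/-- The maximum principle. -/
theorem abs_sub_le (hS : IsSolution T g V F) (hF : IsRenormFlow T g Z V) (hT : 0 < T)
    (htame : IsTameAtInfinity T g Z V) (ht : t ∈ timeSet T) {B : ℝ}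
    (hB : ∀ s ∈ Icc 0 t, ∀ x, |F s x| ≤ B ∧ gradSq (g s) (F s) x ≤ B) {a R : ℝ}
    (h0 : ∀ x, |F 0 x - a| ≤ R) (x : X) : |F t x - a| ≤ R := by
  obtain ⟨C, χ, hχ⟩ := exists_isCutoff hF htame ht
  have h00 := zero_mem_timeSet hT
  have := hF.isFiniteMeasure ht
  have := hF.isFiniteMeasure h00
  have hR : 0 ≤ R := (abs_nonneg _).trans (h0 x)
  have hcont : ∀ {s}, s ∈ timeSet T → Continuous (F s) := fun hs => (hS.smooth.slice hs).continuous
  -- Even moments do not increase, because `(r - a)^(2m)` is convex. Letting `m → ∞` turns this into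
  -- a bound on the supremum, with no need for extrema to be attained.
  have hmom : ∀ m : ℕ, ∫ x, (F t x - a) ^ (2 * m) ∂(weightedMeasure (g t) (Z t) (V t))
      ≤ R ^ (2 * m) * (weightedMeasure (g 0) (Z 0) (V 0)).real univ := by
    intro m
    set h : ℝ → ℝ := fun r => (r - a) ^ (2 * m) with hh
    have hhs : ContDiff ℝ ∞ h := (contDiff_id.sub contDiff_const).pow _
    obtain ⟨H, hH⟩ := isCompact_Icc.exists_bound_of_continuousOn (s := Icc (-B) B)
      hhs.continuous.continuousOn
    obtain ⟨D, hD⟩ := isCompact_Icc.exists_bound_of_continuousOn (s := Icc (-B) B)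
      (hhs.continuous_deriv (by simp)).continuousOn
    have hmem : ∀ s ∈ Icc 0 t, ∀ x, F s x ∈ Icc (-B) B := fun s hs x => abs_le.1 (hB s hs x).1
    have hconv : ∀ r, 0 ≤ deriv (deriv h) r := by
      have hd1 : deriv h = fun r => (2 * m : ℕ) * (r - a) ^ (2 * m - 1) := by
        funext r
        have := (((hasDerivAt_id' r).sub_const a).fun_pow (2 * m)).deriv
        rwa [mul_one] at this
      intro r
      have hd2 := ((((hasDerivAt_id' r).sub_const a).fun_pow (2 * m - 1)).const_mul
        ((2 * m : ℕ) : ℝ)).deriv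
      rw [hd1, hd2]
      -- Subtraction is truncated, so for `m = 0` both sides are `0`: the exponent is even in every
      -- case.
      have he : 2 * m - 1 - 1 = 2 * (m - 1) := by omega
      rw [he, pow_mul]
      positivity
    have h1 := hS.integral_comp_le hF hT htame ht hχ (h := h) isOpen_univ hhs.contDiffOn
      (fun _ _ _ => mem_univ _) (fun s hs x => (hB s hs x).2) (H := max H 0) (D := max D 0)
      (fun s hs x => (hH _ (hmem s hs x)).trans (le_max_left _ _))
      (fun s hs x => (hD _ (hmem s hs x)).trans (le_max_left _ _)) (le_max_right _ _)
      (le_max_right _ _) (hF.finite_mass 0 h00)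
      (fun s hs => by rw [hF.univ_eq hT htame (Icc_subset_timeSet ht hs)])
      (β := fun _ => 0) (by simp) (fun k s hs => by
        have hgs := hF.isSmoothMetric (Icc_subset_timeSet ht (Ioo_subset_Icc_self hs))
        have : 0 ≤ ∫ x, χ k x * χ k x * (deriv (deriv h) (F s x) * gradSq (g s) (F s) x)
            ∂(weightedMeasure (g s) (Z s) (V s)) :=
          integral_nonneg fun x => mul_nonneg (mul_self_nonneg _)
            (mul_nonneg (hconv _) (hgs.gradSq_nonneg _ _))
        linarith)
    refine h1.trans ?_
    have hle : ∀ x, h (F 0 x) ≤ R ^ (2 * m) := fun x => by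
      simp only [hh]
      rw [← (even_two_mul m).pow_abs]
      exact pow_le_pow_left₀ (abs_nonneg _) (h0 x) _
    have h2 : ∫ x, h (F 0 x) ∂(weightedMeasure (g 0) (Z 0) (V 0))
        ≤ ∫ _x, R ^ (2 * m) ∂(weightedMeasure (g 0) (Z 0) (V 0)) := by
      refine integral_mono (integrable_of_bounded (hhs.continuous.comp (hcont h00))
        (B := R ^ (2 * m)) fun x => ?_) (integrable_const _) hle
      rw [abs_of_nonneg ((even_two_mul m).pow_nonneg _)]
      exact hle x
    simp only [integral_const, smul_eq_mul] at h2
    simp only [intervalIntegral.integral_zero, add_zero]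
    rwa [mul_comm]
  by_contra! hx
  obtain ⟨R', hRR', hR'x⟩ := exists_between hx
  have hR'0 : 0 < R' := hR.trans_lt hRR'
  -- If the bound failed, `O` would be a nonempty open set, hence of positive mass. By Chebyshev's
  -- inequality its mass is at most `(R / R')^(2m)` times the total mass for every `m`, which tends
  -- to zero.
  set O : Set X := {z | R' < |F t z - a|} with hO
  have hOo : IsOpen O := isOpen_lt continuous_const ((hcont ht).sub continuous_const).abs
  have := isOpenPosMeasure_weightedMeasure (hF.isSmoothMetric ht)
    (hF.smoothT_Z.slice ht).continuous (hF.smoothT_V.slice ht).continuous (hF.Z_pos t ht)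
  have hOpos : 0 < (weightedMeasure (g t) (Z t) (V t)).real O :=
    ENNReal.toReal_pos (hOo.measure_pos _ ⟨x, hR'x⟩).ne' (measure_ne_top _ _)
  have hbd : ∀ m : ℕ, (weightedMeasure (g t) (Z t) (V t)).real O
      ≤ ((R / R') ^ 2) ^ m * (weightedMeasure (g 0) (Z 0) (V 0)).real univ := fun m => by
    have h3 : R' ^ (2 * m) * (weightedMeasure (g t) (Z t) (V t)).real O
        ≤ ∫ x, (F t x - a) ^ (2 * m) ∂(weightedMeasure (g t) (Z t) (V t)) := by
      have hi : Integrable (fun x => (F t x - a) ^ (2 * m))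
          (weightedMeasure (g t) (Z t) (V t)) :=
        integrable_of_bounded (((hcont ht).sub continuous_const).pow _) (B := (B + |a|) ^ (2 * m))
          fun x => by
            rw [abs_pow]
            refine pow_le_pow_left₀ (abs_nonneg _) ((abs_sub _ _).trans ?_) _
            have := (hB t ⟨ht.1, le_rfl⟩ x).1
            linarith
      have hset : ∫ x in O, R' ^ (2 * m) ∂(weightedMeasure (g t) (Z t) (V t))
          ≤ ∫ x in O, (F t x - a) ^ (2 * m) ∂(weightedMeasure (g t) (Z t) (V t)) := by
        refine setIntegral_mono_on (integrable_const _).integrableOn hi.integrableOn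
          hOo.measurableSet fun z hz => ?_
        rw [← (even_two_mul m).pow_abs (F t z - a)]
        exact pow_le_pow_left₀ hR'0.le (le_of_lt hz) _
      rw [setIntegral_const, smul_eq_mul, mul_comm] at hset
      exact hset.trans (setIntegral_le_integral hi
        (Eventually.of_forall fun z => (even_two_mul m).pow_nonneg _))
    have h4 := h3.trans (hmom m)
    have hp : 0 < R' ^ (2 * m) := by positivity
    rw [← pow_mul, div_pow, div_mul_eq_mul_div, le_div_iff₀ hp]
    linarith
  have hlim : Tendsto (fun m : ℕ => ((R / R') ^ 2) ^ m *
      (weightedMeasure (g 0) (Z 0) (V 0)).real univ) atTop (𝓝 0) := by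
    have hq : R / R' < 1 := (div_lt_one hR'0).2 hRR'
    have hq0 : 0 ≤ R / R' := div_nonneg hR hR'0.le
    simpa using (tendsto_pow_atTop_nhds_zero_of_lt_one (sq_nonneg _)
      (pow_lt_one₀ hq0 hq two_ne_zero)).mul_const _
  exact absurd (ge_of_tendsto' hlim hbd) (not_le.2 hOpos)

theorem fisher_eq (hF : IsRenormFlow T g Z V) (hS : IsSolution T g V F) (ht : t ∈ timeSet T)
    (hpos : ∀ t ∈ timeSet T, ∀ x, 0 < F t x) (x : X) :
    fisher g F t x = gradSq (g t) (F t) x / F t x := by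
  have h := (hpos t ht x).ne'
  rw [fisher, (hF.isSmoothMetric ht).gradSq_log (hS.smooth.slice ht) (hpos t ht x)]
  field_simp

theorem fisher_nonneg (hF : IsRenormFlow T g Z V) (ht : t ∈ timeSet T)
    (hpos : ∀ t ∈ timeSet T, ∀ x, 0 < F t x) (x : X) : 0 ≤ fisher g F t x :=
  mul_nonneg (hpos t ht x).le ((hF.isSmoothMetric ht).gradSq_nonneg _ _)

theorem fisher_le (hF : IsRenormFlow T g Z V) (hS : IsSolution T g V F) (ht : t ∈ timeSet T)
    {c B : ℝ} (hc : 0 < c) (hpos : ∀ t ∈ timeSet T, ∀ x, c ≤ F t x) {x : X}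
    (hB : gradSq (g t) (F t) x ≤ B) : fisher g F t x ≤ B / c := by
  rw [fisher_eq hF hS ht fun t ht x => hc.trans_le (hpos t ht x)]
  have := (hF.isSmoothMetric ht).gradSq_nonneg (F t) x
  exact div_le_div₀ (this.trans hB) hB hc (hpos t ht x)

/-- The exponential decay of the Fisher information. -/
theorem exp_mul_integral_fisher_le (hS : IsSolution T g V F) (hF : IsRenormFlow T g Z V)
    (hT : 0 < T) (htame : IsTameAtInfinity T g Z V) {lamDot : ℝ → ℝ}
    (hcond : MultiscaleCondition T g V lamDot) (ht : t ∈ timeSet T)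
    (hlam : IntervalIntegrable lamDot volume 0 t) {c B : ℝ} (hc : 0 < c)
    (hpos : ∀ t ∈ timeSet T, ∀ x, c ≤ F t x)
    (hB : ∀ s ∈ Icc 0 t, ∀ x, gradSq (g s) (F s) x ≤ B) (hB0 : 0 ≤ B) :
    Real.exp (2 * ∫ s in (0 : ℝ)..t, lamDot s)
        * ∫ x, fisher g F t x ∂(weightedMeasure (g t) (Z t) (V t))
      ≤ ∫ x, fisher g F 0 x ∂(weightedMeasure (g 0) (Z 0) (V 0)) := by
  obtain ⟨C, χ, hχ⟩ := exists_isCutoff hF htame ht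
  have h00 := zero_mem_timeSet hT
  have hpos' : ∀ t ∈ timeSet T, ∀ x, 0 < F t x := fun t ht x => hc.trans_le (hpos t ht x)
  have hC0 := hχ.const_nonneg
  have hfl : ∀ s ∈ Icc 0 t, ∀ x, fisher g F s x ≤ B / c := fun s hs x =>
    fisher_le hF hS (Icc_subset_timeSet ht hs) hc hpos (hB s hs x)
  have hBc : 0 ≤ B / c := div_nonneg hB0 hc.le
  -- `B / c` bounds the Fisher density and `B / c²` bounds `(∇ log F)²`. The error quadratic in
  -- `∇χ_k` is made linear in `1 / (k + 1)` through `C / (k + 1) ≤ C`.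
  set a : ℝ := B / c * C ^ 2 + B / c ^ 2 * (Real.sqrt B * C) with hadef
  have ha : 0 ≤ a := by positivity
  have hb : 0 ≤ B / c * C := by positivity
  have hψ := hS.smoothT_fisher hF hT hpos'
  have main := hF.exp_mul_integral_le hT ht hχ hψ (α := lamDot) (B := B / c)
    (fun s hs x => by
      rw [abs_of_nonneg (fisher_nonneg hF (Icc_subset_timeSet ht hs) hpos' x)]
      exact hfl s hs x)
    hlam (β := fun _ => 0) (by simp)
    (e := fun s => ENNReal.ofReal a * weightedMeasure (g 0) (Z 0) (V 0) univ
      + ENNReal.ofReal (B / c * C) * current g Z V s)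
    (lintegral_error_ne_top htame ht _ (ENNReal.mul_ne_top (by simp) (hF.finite_mass 0 h00)))
    (fun k s hs => ?_)
  · simpa using main
  have hsI := Ioo_subset_Icc_self hs
  have hsT := Icc_subset_timeSet ht hsI
  have hfin := hF.isFiniteMeasure hsT
  have hg := hF.isSmoothMetric hsT
  have hpk : (0 : ℝ) ≤ 1 / ((k : ℝ) + 1) := by positivity
  have i1 := hF.integrable_weakRate hT (hχ.smooth_sq k) (hχ.compact_sq k) hψ hsT
  have i2 : Integrable (fun x => χ k x * χ k x * fisher g F s x)
      (weightedMeasure (g s) (Z s) (V s)) :=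
    ((hχ.smooth_sq k).continuous.mul (hψ.slice hsT).continuous
      ).integrable_of_hasCompactSupport (hχ.compact_sq k).mul_right
  have i3 := i1.add (i2.const_mul (2 * lamDot s))
  rw [sub_zero, ← integral_const_mul, ← integral_add i1 (i2.const_mul (2 * lamDot s)),
    ← hF.univ_eq hT htame hsT]
  refine ofReal_integral_le_current i3 hpk ha hb fun x => ?_
  have h1 := hS.weakRate_fisher_le hF hT hcond hpos' hsT hs.1 (hχ.smooth k) (hχ.abs_le_one k x)
  have h2 := hχ.sqrt_gradSq_le k s hsI x
  have h3 : Real.sqrt (gradSq (g s) (F s) x) ≤ Real.sqrt B := Real.sqrt_le_sqrt (hB s hsI x)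
  have hf0 := fisher_nonneg hF hsT hpos' x
  have hgF := hg.gradSq_nonneg (F s) x
  have hk1 : C / ((k : ℝ) + 1) ≤ C := div_le_self hC0 (by linarith [(Nat.cast_nonneg k : (0 : ℝ) ≤ k)])
  have h4 : gradSq (g s) (χ k) x ≤ C * (C / (k + 1)) := by
    rw [← Real.mul_self_sqrt (hg.gradSq_nonneg (χ k) x)]
    exact mul_le_mul (h2.trans hk1) h2 (Real.sqrt_nonneg _) hC0
  have h5 : fisher g F s x * gradSq (g s) (χ k) x ≤ B / c * (C * (C / (k + 1))) :=
    mul_le_mul (hfl s hsI x) h4 (hg.gradSq_nonneg _ _) hBc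
  have h6 : gradSq (g s) (fun z => Real.log (F s z)) x ≤ B / c ^ 2 := by
    rw [hg.gradSq_log (hS.smooth.slice hsT) (hpos' s hsT x)]
    exact div_le_div₀ hB0 (hB s hsI x) (by positivity) (pow_le_pow_left₀ hc.le (hpos s hsT x) 2)
  have h7 : gradSq (g s) (fun z => Real.log (F s z)) x * (Real.sqrt (gradSq (g s) (F s) x)
      * Real.sqrt (gradSq (g s) (χ k) x)) ≤ B / c ^ 2 * (Real.sqrt B * (C / (k + 1))) := by
    gcongr
  set J := Real.sqrt (gradSq (g s) (fun z => Real.log (Z s z) + V s z) x)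
  have hJ : 0 ≤ J := Real.sqrt_nonneg _
  have h8 : fisher g F s x * (Real.sqrt (gradSq (g s) (χ k) x) * J)
      ≤ B / c * (C / (k + 1) * J) := by
    gcongr
    exact hfl s hsI x
  have h9 : 1 / ((k : ℝ) + 1) * (a + B / c * C * J)
      = B / c * (C * (C / (k + 1))) + B / c ^ 2 * (Real.sqrt B * (C / (k + 1)))
        + B / c * (C / (k + 1) * J) := by
    rw [hadef]; ring
  simp only [Pi.add_apply]
  rw [h9]
  linarith

/-- The decay of entropy is controlled by the initial Fisher information. -/
theorem integral_mul_log_sub_le (hS : IsSolution T g V F) (hF : IsRenormFlow T g Z V)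
    (hT : 0 < T) (htame : IsTameAtInfinity T g Z V) {lamDot : ℝ → ℝ}
    (hcond : MultiscaleCondition T g V lamDot) (ht : t ∈ timeSet T)
    (hlam : IntervalIntegrable lamDot volume 0 t) {c B : ℝ} (hc : 0 < c)
    (hpos : ∀ t ∈ timeSet T, ∀ x, c ≤ F t x)
    (hB : ∀ s ∈ Icc 0 t, ∀ x, |F s x| ≤ B ∧ gradSq (g s) (F s) x ≤ B) (hB0 : 0 ≤ B) :
    (∫ x, F 0 x * Real.log (F 0 x) ∂(weightedMeasure (g 0) (Z 0) (V 0)))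
        - ∫ x, F t x * Real.log (F t x) ∂(weightedMeasure (g t) (Z t) (V t))
      ≤ (1 / 2) * (∫ x, fisher g F 0 x ∂(weightedMeasure (g 0) (Z 0) (V 0)))
        * ∫ s in (0 : ℝ)..t, Real.exp (-2 * ∫ v in (0 : ℝ)..s, lamDot v) := by
  obtain ⟨C, χ, hχ⟩ := exists_isCutoff hF htame ht
  have h00 := zero_mem_timeSet hT
  have hpos' : ∀ t ∈ timeSet T, ∀ x, 0 < F t x := fun t ht x => hc.trans_le (hpos t ht x)
  -- The sign turns the upper bound of `integral_comp_le` into a lower bound for the entropy at time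
  -- `t`; then `-½ h''(F) (∇F)²` is half the Fisher density.
  set h : ℝ → ℝ := fun r => -(r * Real.log r) with hh
  have hhs : ContDiffOn ℝ ∞ h (Ioi 0) :=
    (contDiffOn_id.mul (Real.contDiffOn_log.mono fun _ hx => (ne_of_gt hx : _ ≠ (0 : ℝ)))).neg
  have hmem : ∀ s ∈ Icc 0 t, ∀ x, F s x ∈ Icc c B := fun s hs x =>
    ⟨hpos s (Icc_subset_timeSet ht hs) x, (le_abs_self _).trans (hB s hs x).1⟩
  have hsubI : Icc c B ⊆ Ioi 0 := fun r hr => hc.trans_le hr.1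
  obtain ⟨H, hH⟩ := isCompact_Icc.exists_bound_of_continuousOn (s := Icc c B)
    (hhs.continuousOn.mono hsubI)
  obtain ⟨D, hD⟩ := isCompact_Icc.exists_bound_of_continuousOn (s := Icc c B)
    ((hhs.continuousOn_deriv_of_isOpen isOpen_Ioi (by simp)).mono hsubI)
  have hd1 : ∀ r ∈ Ioi (0 : ℝ), deriv h r = -(Real.log r + 1) := fun r hr => by
    have := ((Real.hasDerivAt_mul_log (ne_of_gt hr)).fun_neg).deriv
    simpa [hh] using this
  have hd2 : ∀ r ∈ Ioi (0 : ℝ), deriv (deriv h) r = -r⁻¹ := fun r hr => by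
    have he : deriv h =ᶠ[𝓝 r] fun r => -(Real.log r + 1) := by
      filter_upwards [isOpen_Ioi.mem_nhds hr] with s hs using hd1 s hs
    rw [he.deriv_eq]
    exact (((Real.hasDerivAt_log (ne_of_gt hr)).add_const 1).fun_neg).deriv
  set D0 := ∫ x, fisher g F 0 x ∂(weightedMeasure (g 0) (Z 0) (V 0)) with hD0
  have hAc : ContinuousOn (fun s => Real.exp (-2 * ∫ v in (0 : ℝ)..s, lamDot v)) (uIcc 0 t) :=
    Real.continuous_exp.comp_continuousOn (continuousOn_const.mul
      (hlam.absolutelyContinuousOnInterval_intervalIntegral (by simp)).continuousOn)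
  have main := hS.integral_comp_le hF hT htame ht hχ (h := h) isOpen_Ioi hhs hpos'
    (fun s hs x => (hB s hs x).2) (H := max H 0) (D := max D 0)
    (fun s hs x => (hH _ (hmem s hs x)).trans (le_max_left _ _))
    (fun s hs x => (hD _ (hmem s hs x)).trans (le_max_left _ _)) (le_max_right _ _)
    (le_max_right _ _) (hF.finite_mass 0 h00)
    (fun s hs => by rw [hF.univ_eq hT htame (Icc_subset_timeSet ht hs)])
    (β := fun s => (1 / 2) * D0 * Real.exp (-2 * ∫ v in (0 : ℝ)..s, lamDot v))
    ((continuousOn_const.mul hAc).intervalIntegrable) (fun k s hs => ?_)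
  · rw [intervalIntegral.integral_const_mul] at main
    simp only [hh, integral_neg] at main
    linarith
  have hsI := Ioo_subset_Icc_self hs
  have hsT := Icc_subset_timeSet ht hsI
  have hfin := hF.isFiniteMeasure hsT
  have hψ := hS.smoothT_fisher hF hT hpos'
  have e1 : ∫ x, χ k x * χ k x * (deriv (deriv h) (F s x) * gradSq (g s) (F s) x)
      ∂(weightedMeasure (g s) (Z s) (V s))
      = -∫ x, χ k x * χ k x * fisher g F s x ∂(weightedMeasure (g s) (Z s) (V s)) := by
    rw [← integral_neg]
    refine integral_congr_ae (Eventually.of_forall fun x => ?_)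
    simp only [hd2 _ (hpos' s hsT x), fisher_eq hF hS hsT hpos', div_eq_mul_inv]
    ring
  have hf0 : ∀ x, 0 ≤ fisher g F s x := fisher_nonneg hF hsT hpos'
  have ifs : Integrable (fisher g F s) (weightedMeasure (g s) (Z s) (V s)) :=
    integrable_of_bounded (hψ.slice hsT).continuous fun x => by
      rw [abs_of_nonneg (hf0 x)]
      exact fisher_le hF hS hsT hc hpos (hB s hsI x).2
  have e2 : ∫ x, χ k x * χ k x * fisher g F s x ∂(weightedMeasure (g s) (Z s) (V s))
      ≤ ∫ x, fisher g F s x ∂(weightedMeasure (g s) (Z s) (V s)) := by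
    refine integral_mono (((hχ.smooth_sq k).continuous.mul (hψ.slice hsT).continuous
      ).integrable_of_hasCompactSupport (hχ.compact_sq k).mul_right) ifs fun x => ?_
    exact mul_le_of_le_one_left (hf0 x)
      (mul_le_one₀ (hχ.le_one k x) (hχ.nonneg k x) (hχ.le_one k x))
  -- The decay of the Fisher information up to the intermediate time `s` bounds the dissipation by
  -- the chosen `β`.
  have e3 := hS.exp_mul_integral_fisher_le hF hT htame hcond hsT
    (hlam.mono_set (by rw [uIcc_of_le hsI.1, uIcc_of_le ht.1]; exact Icc_subset_Icc_right hsI.2))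
    hc hpos (fun r hr x => (hB r ⟨hr.1, hr.2.trans hsI.2⟩ x).2) hB0
  have e4 : ∫ x, fisher g F s x ∂(weightedMeasure (g s) (Z s) (V s))
      ≤ D0 * Real.exp (-2 * ∫ v in (0 : ℝ)..s, lamDot v) := by
    rw [neg_mul, Real.exp_neg, ← div_eq_mul_inv, le_div_iff₀ (Real.exp_pos _)]
    linarith
  rw [e1]
  linarith

end IsSolution

end Global

/-! ### Passage to the limit `t → T` for positive test functions. -/

section Limit

variable {n : ℕ} {X : Type*} [TopologicalSpace X] [T2Space X] [SecondCountableTopology X]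
  [ChartedSpace (Model n) X] [IsManifold (𝓡 n) ∞ X] [MeasurableSpace X] [BorelSpace X]

variable {T : EReal} {g : ℝ → RMetric n X} {Z V : ℝ → X → ℝ} {t : ℝ}
  {P : ℝ → (X → ℝ) → X → ℝ} {lamDot : ℝ → ℝ} {γ : ℝ}

/-- Real times approaching `T` are taken as a filter pulled back from the extended reals, so finite
and infinite `T` are treated alike. -/
theorem comap_coe_nhdsLT_neBot (hT : 0 < T) :
    (comap ((↑) : ℝ → EReal) (𝓝[<] T)).NeBot := by
  refine comap_neBot fun s hs => ?_
  obtain ⟨l, hl, hls⟩ := (mem_nhdsLT_iff_exists_Ioo_subset' hT).1 hs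
  obtain ⟨r, h1, h2⟩ := EReal.lt_iff_exists_real_btwn.1 hl
  exact ⟨r, hls ⟨h1, h2⟩⟩

theorem eventually_mem_timeSet (hT : 0 < T) :
    ∀ᶠ t in comap ((↑) : ℝ → EReal) (𝓝[<] T), t ∈ timeSet T := by
  refine mem_comap.2 ⟨Ioo 0 T, Ioo_mem_nhdsLT hT, fun t ht => ⟨?_, ht.2⟩⟩
  exact_mod_cast ht.1.le

/-- A bounded smooth function that agrees with `r log r` on `[c, M]`. -/
theorem exists_smooth_mul_log {c M : ℝ} (hc : 0 < c) :
    ∃ h : ℝ → ℝ, ContDiff ℝ ∞ h ∧ (∃ C, ∀ r, |h r| ≤ C) ∧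
      ∀ r ∈ Icc c M, h r = r * Real.log r := by
  -- `b` is `1` on `[c, M]` and `0` outside `[c/2, M + 1]`: it removes both the singularity of the
  -- logarithm at `0` and the growth at infinity.
  set b : ℝ → ℝ := fun r => Real.smoothTransition ((r - c / 2) / (c / 2))
    * Real.smoothTransition (M + 1 - r) with hb
  have hc2 : 0 < c / 2 := half_pos hc
  have hbs : ContDiff ℝ ∞ b :=
    (Real.smoothTransition.contDiff.comp ((contDiff_id.sub contDiff_const).div_const _)).mul
      (Real.smoothTransition.contDiff.comp (contDiff_const.sub contDiff_id))
  have hbl : ∀ r ≤ c / 2, b r = 0 := fun r hr => by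
    have : Real.smoothTransition ((r - c / 2) / (c / 2)) = 0 :=
      Real.smoothTransition.zero_of_nonpos (div_nonpos_of_nonpos_of_nonneg (by linarith) hc2.le)
    simp only [hb, this, zero_mul]
  have hbr : ∀ r, M + 1 ≤ r → b r = 0 := fun r hr => by
    have : Real.smoothTransition (M + 1 - r) = 0 :=
      Real.smoothTransition.zero_of_nonpos (by linarith)
    simp only [hb, this, mul_zero]
  have hcont : Continuous fun r => b r * (r * Real.log r) :=
    hbs.continuous.mul Real.continuous_mul_log
  refine ⟨fun r => b r * (r * Real.log r), contDiff_iff_contDiffAt.2 fun r => ?_, ?_, ?_⟩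
  · rcases lt_or_ge r (c / 2) with hr | hr
    · refine (contDiffAt_const (c := (0 : ℝ))).congr_of_eventuallyEq ?_
      filter_upwards [isOpen_Iio.mem_nhds hr] with s hs
      rw [hbl s (le_of_lt hs), zero_mul]
    · exact hbs.contDiffAt.mul (contDiffAt_id.mul
        (Real.contDiffAt_log.2 (hc2.trans_le hr).ne'))
  · obtain ⟨C, hC⟩ := isCompact_Icc.exists_bound_of_continuousOn (s := Icc (c / 2) (M + 1))
      hcont.continuousOn
    refine ⟨max C 0, fun r => ?_⟩
    by_cases hr : r ∈ Icc (c / 2) (M + 1)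
    · exact (hC r hr).trans (le_max_left _ _)
    · have : b r = 0 := by
        rw [mem_Icc, not_and_or, not_le, not_le] at hr
        rcases hr with hr | hr
        · exact hbl r hr.le
        · exact hbr r hr.le
      simp only [this, zero_mul, abs_zero]
      exact le_max_right _ _
  · intro r hr
    have h1 : Real.smoothTransition ((r - c / 2) / (c / 2)) = 1 :=
      Real.smoothTransition.one_of_one_le ((one_le_div hc2).2 (by linarith [hr.1]))
    have h2 : Real.smoothTransition (M + 1 - r) = 1 :=
      Real.smoothTransition.one_of_one_le (by linarith [hr.2])
    simp only [hb, h1, h2, one_mul]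

theorem integral_renormMeasure (g : RMetric n X) (Z V : X → ℝ) (f : X → ℝ) :
    ∫ x, f x ∂(renormMeasure g Z V)
      = ((weightedMeasure g Z V).real univ)⁻¹ * ∫ x, f x ∂(weightedMeasure g Z V) := by
  rw [renormMeasure, integral_smul_measure, ENNReal.toReal_inv, smul_eq_mul, Measure.real]

theorem IsRenormFlow.isProbabilityMeasure_renormMeasure [Nonempty X] (hF : IsRenormFlow T g Z V)
    (ht : t ∈ timeSet T) : IsProbabilityMeasure (renormMeasure (g t) (Z t) (V t)) := by
  have := isOpenPosMeasure_weightedMeasure (hF.isSmoothMetric ht)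
    (hF.smoothT_Z.slice ht).continuous (hF.smoothT_V.slice ht).continuous (hF.Z_pos t ht)
  have h0 : weightedMeasure (g t) (Z t) (V t) univ ≠ 0 :=
    (isOpen_univ.measure_pos _ univ_nonempty).ne'
  exact ⟨by rw [renormMeasure, Measure.smul_apply, smul_eq_mul,
    ENNReal.inv_mul_cancel h0 (hF.finite_mass t ht)]⟩

theorem integral_exp_le (hγ : 0 < γ) (hlam : ∀ t ∈ timeSet T, IntervalIntegrable lamDot volume 0 t)
    (hγT : ENNReal.ofReal (1 / γ) = ∫⁻ t in timeSet T,
      ENNReal.ofReal (Real.exp (-2 * ∫ s in (0 : ℝ)..t, lamDot s))) (ht : t ∈ timeSet T) :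
    ∫ s in (0 : ℝ)..t, Real.exp (-2 * ∫ v in (0 : ℝ)..s, lamDot v) ≤ 1 / γ := by
  have hAc : ContinuousOn (fun s => Real.exp (-2 * ∫ v in (0 : ℝ)..s, lamDot v)) (uIcc 0 t) :=
    Real.continuous_exp.comp_continuousOn (continuousOn_const.mul
      ((hlam t ht).absolutelyContinuousOnInterval_intervalIntegral (by simp)).continuousOn)
  rw [intervalIntegral.integral_of_le ht.1, ← ENNReal.ofReal_le_ofReal_iff (by positivity), hγT]
  refine (ofReal_integral_le_lintegral
    ((intervalIntegrable_iff_integrableOn_Ioc_of_le ht.1).1 hAc.intervalIntegrable)).trans ?_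
  exact lintegral_mono_set (Ioc_subset_Icc_self.trans (Icc_subset_timeSet ht))

/-- The log-Sobolev inequality for test functions that are bounded below. -/
theorem entropy_le_of_isTestFunction [Nonempty X] (hT : 0 < T) (hflow : IsRenormFlow T g Z V)
    (htame : IsTameAtInfinity T g Z V) (hP : IsPolchinskiSemigroup T g V P)
    (hcont : ContinuityAssumption T g Z V P)
    (hlam : ∀ t ∈ timeSet T, IntervalIntegrable lamDot volume 0 t)
    (hcond : MultiscaleCondition T g V lamDot) (hγ : 0 < γ)
    (hγT : ENNReal.ofReal (1 / γ) = ∫⁻ t in timeSet T,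
      ENNReal.ofReal (Real.exp (-2 * ∫ s in (0 : ℝ)..t, lamDot s)))
    {F : X → ℝ} (hF : IsTestFunction n F) {c : ℝ} (hc : 0 < c) (hcF : ∀ x, c ≤ F x) :
    entropy (renormMeasure (g 0) (Z 0) (V 0)) F
      ≤ 1 / (2 * γ) * ∫ x, gradSq (g 0) F x / F x ∂(renormMeasure (g 0) (Z 0) (V 0)) := by
  have h00 := zero_mem_timeSet hT
  have hS : IsSolution T g V fun t => P t F := ⟨(hP.smooth F hF).smoothT, hP.evolution F hF⟩
  have hP0 := hP.initial F hF
  obtain ⟨M, hM⟩ := hP.bounded F hF 0 h00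
  have hFM : ∀ x, F x ≤ M := fun x => by
    have := (hM 0 ⟨le_rfl, le_rfl⟩ x).1
    rw [hP0] at this
    exact (le_abs_self _).trans this
  have hrange : ∀ t ∈ timeSet T, ∀ x, P t F x ∈ Icc c M := by
    intro t ht x
    obtain ⟨B, hB⟩ := hP.bounded F hF t ht
    -- Centring the maximum principle at the midpoint of `[c, M]` preserves both bounds at once.
    have h := hS.abs_sub_le hflow hT htame ht hB (a := (c + M) / 2) (R := (M - c) / 2)
      (fun z => by
        rw [hP0, abs_le]
        constructor <;> linarith [hcF z, hFM z]) x
    rw [abs_le] at h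
    constructor <;> linarith [h.1, h.2]
  -- The continuity assumption concerns bounded smooth functions only. All values of `F_t`, and the
  -- mean of `F`, lie in `[c, M]`, where `h` is `r log r`.
  obtain ⟨h, hh, hhb, hheq⟩ := exists_smooth_mul_log (M := M) hc
  have hprob := hflow.isProbabilityMeasure_renormMeasure h00
  have hfin := hflow.isFiniteMeasure h00
  have hFc : Continuous F := hF.1.continuous
  have hFi : Integrable F (renormMeasure (g 0) (Z 0) (V 0)) :=
    integrable_of_bounded hFc (B := M) fun x => by
      rw [abs_of_nonneg (hc.le.trans (hcF x))]; exact hFM x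
  have hmean : ∫ x, F x ∂(renormMeasure (g 0) (Z 0) (V 0)) ∈ Icc c M := by
    constructor
    · have := integral_mono (μ := renormMeasure (g 0) (Z 0) (V 0)) (integrable_const c) hFi hcF
      simpa using this
    · have := integral_mono (μ := renormMeasure (g 0) (Z 0) (V 0)) hFi (integrable_const M) hFM
      simpa using this
  have hlim := hcont F hF h hh hhb
  rw [hheq _ hmean] at hlim
  set D := ∫ x, gradSq (g 0) F x / F x ∂(renormMeasure (g 0) (Z 0) (V 0)) with hD
  have hbound : ∀ t ∈ timeSet T, (∫ x, F x * Real.log (F x) ∂(renormMeasure (g 0) (Z 0) (V 0)))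
      - 1 / (2 * γ) * D ≤ ∫ x, h (P t F x) ∂(renormMeasure (g t) (Z t) (V t)) := by
    intro t ht
    obtain ⟨B, hB⟩ := hP.bounded F hF t ht
    have hB0 : 0 ≤ B := by
      obtain ⟨x⟩ := ‹Nonempty X›
      exact (abs_nonneg _).trans (hB 0 ⟨le_rfl, ht.1⟩ x).1
    have hpos : ∀ t ∈ timeSet T, ∀ x, c ≤ P t F x := fun t ht x => (hrange t ht x).1
    have key := hS.integral_mul_log_sub_le hflow hT htame hcond ht (hlam t ht) hc hpos hB hB0
    have hfe : ∀ x, fisher g (fun t => P t F) 0 x = gradSq (g 0) F x / F x := fun x => by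
      rw [IsSolution.fisher_eq hflow hS h00 (fun t ht x => hc.trans_le (hpos t ht x))]
      simp only [hP0]
    simp only [hfe, hP0] at key
    have hE := integral_exp_le hγ hlam hγT ht
    have hfn : 0 ≤ ∫ x, gradSq (g 0) F x / F x ∂(weightedMeasure (g 0) (Z 0) (V 0)) :=
      integral_nonneg fun x => div_nonneg ((hflow.isSmoothMetric h00).gradSq_nonneg _ _)
        (hc.le.trans (hcF x))
    have key2 := key.trans (mul_le_mul_of_nonneg_left hE (mul_nonneg (by norm_num) hfn))
    have hm0 : 0 ≤ ((weightedMeasure (g 0) (Z 0) (V 0)).real univ)⁻¹ :=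
      inv_nonneg.2 measureReal_nonneg
    have key3 := mul_le_mul_of_nonneg_left key2 hm0
    have hht : ∫ x, h (P t F x) ∂(weightedMeasure (g t) (Z t) (V t))
        = ∫ x, P t F x * Real.log (P t F x) ∂(weightedMeasure (g t) (Z t) (V t)) :=
      integral_congr_ae (Eventually.of_forall fun x => hheq _ (hrange t ht x))
    -- By conservation of mass `ν_t` and `ν_0` have the same normalising constant, so the
    -- unnormalised estimate can simply be scaled.
    rw [hD, integral_renormMeasure, integral_renormMeasure, integral_renormMeasure,
      hflow.real_univ_eq hT htame ht, hht]
    have e : ((weightedMeasure (g 0) (Z 0) (V 0)).real univ)⁻¹ * (1 / 2 *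
        (∫ x, gradSq (g 0) F x / F x ∂(weightedMeasure (g 0) (Z 0) (V 0))) * (1 / γ))
        = 1 / (2 * γ) * (((weightedMeasure (g 0) (Z 0) (V 0)).real univ)⁻¹
          * ∫ x, gradSq (g 0) F x / F x ∂(weightedMeasure (g 0) (Z 0) (V 0))) := by
      field_simp
    rw [e] at key3
    linarith
  have := comap_coe_nhdsLT_neBot hT
  have hfinal := ge_of_tendsto hlim
    ((eventually_mem_timeSet hT).mono fun t ht => hbound t ht)
  rw [entropy]
  linarith

end Limit

/-! ### From positive test functions to all bounded smooth nonnegative functions. -/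

section Extension

variable {n : ℕ} {X : Type*} [TopologicalSpace X] [T2Space X] [SecondCountableTopology X]
  [ChartedSpace (Model n) X] [IsManifold (𝓡 n) ∞ X] [MeasurableSpace X] [BorelSpace X]

theorem IsSmoothMetric.gradSq_comp {g : RMetric n X} (hg : IsSmoothMetric g) {φ : ℝ → ℝ}
    {a : X → ℝ} {x : X} (hφ : DifferentiableAt ℝ φ (a x)) (ha : ContMDiff (𝓡 n) 𝓘(ℝ, ℝ) ∞ a) :
    gradSq g (fun z => φ (a z)) x = deriv φ (a x) ^ 2 * gradSq g a x := by
  rw [gradSq, gradInner_comp_left hφ ha, hg.gradInner_comm, gradInner_comp_left hφ ha, gradSq]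
  ring

/-- A zero of a nonnegative function is a minimum, so its differential vanishes there. This handles
the points where `√F` may fail to be differentiable. -/
theorem gradInner_eq_zero_of_min {g : RMetric n X} {F : X → ℝ} {x : X} (h0 : ∀ z, 0 ≤ F z)
    (hx : F x = 0) (d : X → ℝ) : gradInner g F d x = 0 := by
  have hmin : IsLocalMin (inChart (n := n) x F) (extChartAt (𝓡 n) x x) :=
    Eventually.of_forall fun z => by
      simp only [inChart, extChartAt_to_inv, hx]
      exact h0 _
  simp only [gradInner, pd, hmin.fderiv_eq_zero, _root_.zero_apply, mul_zero, zero_mul,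
    Finset.sum_const_zero]

theorem contMDiff_sqrt_add {F : X → ℝ} (hF : ContMDiff (𝓡 n) 𝓘(ℝ, ℝ) ∞ F) (h0 : ∀ x, 0 ≤ F x)
    {ε : ℝ} (hε : 0 < ε) : ContMDiff (𝓡 n) 𝓘(ℝ, ℝ) ∞ fun x => Real.sqrt (F x + ε) := fun x =>
  ((contDiffAt_id.add contDiffAt_const).sqrt (by
    simpa using (add_pos_of_nonneg_of_pos (h0 x) hε).ne') : ContDiffAt ℝ ∞
    (fun r : ℝ => Real.sqrt (r + ε)) (F x)).contMDiffAt.comp x (hF x)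

theorem hasDerivAt_sqrt_add {r ε : ℝ} (h : 0 < r + ε) :
    HasDerivAt (fun r : ℝ => Real.sqrt (r + ε)) (1 / (2 * Real.sqrt (r + ε))) r := by
  simpa using ((hasDerivAt_id' r).add_const ε).sqrt h.ne'

/-- The left-hand side is `(∇F)² / (4 (F + ε))`. Where `F > 0` this increases as `ε` decreases to
`0`; where `F = 0` it vanishes, and the right-hand side is nonnegative whatever value the derivative
of `√F` takes. -/
theorem IsSmoothMetric.gradSq_sqrt_add_le {g : RMetric n X} (hg : IsSmoothMetric g) {F : X → ℝ}
    (hF : ContMDiff (𝓡 n) 𝓘(ℝ, ℝ) ∞ F) (h0 : ∀ x, 0 ≤ F x) {ε : ℝ} (hε : 0 < ε) (x : X) :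
    gradSq g (fun z => Real.sqrt (F z + ε)) x ≤ gradSq g (fun z => Real.sqrt (F z)) x := by
  have hpos : 0 < F x + ε := add_pos_of_nonneg_of_pos (h0 x) hε
  have hd := hasDerivAt_sqrt_add hpos
  have hG := hg.gradSq_nonneg F x
  have e1 : gradSq g (fun z => Real.sqrt (F z + ε)) x = gradSq g F x / (4 * (F x + ε)) := by
    rw [hg.gradSq_comp (φ := fun r => Real.sqrt (r + ε)) hd.differentiableAt hF, hd.deriv, div_pow,
      mul_pow, Real.sq_sqrt hpos.le]
    ring
  rcases (h0 x).eq_or_lt with hx | hx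
  · have hz : gradSq g F x = 0 := gradInner_eq_zero_of_min h0 hx.symm F
    rw [e1, hz, zero_div]
    exact hg.gradSq_nonneg _ _
  · have hd' := Real.hasDerivAt_sqrt hx.ne'
    have e2 : gradSq g (fun z => Real.sqrt (F z)) x = gradSq g F x / (4 * F x) := by
      rw [hg.gradSq_comp hd'.differentiableAt hF, hd'.deriv, div_pow, mul_pow, Real.sq_sqrt hx.le]
      ring
    rw [e1, e2]
    exact div_le_div_of_nonneg_left hG (by positivity) (by linarith)

/-- Young's inequality with a parameter: the constant on the main term can be brought to `1`, so the
sharp constant survives the cutoff. -/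
theorem IsSmoothMetric.gradSq_mul_le {g : RMetric n X} (hg : IsSmoothMetric g) {a b : X → ℝ}
    (ha : ContMDiff (𝓡 n) 𝓘(ℝ, ℝ) ∞ a) (hb : ContMDiff (𝓡 n) 𝓘(ℝ, ℝ) ∞ b) {δ : ℝ} (hδ : 0 < δ)
    (x : X) :
    gradSq g (fun z => a z * b z) x
      ≤ (1 + δ) * (a x ^ 2 * gradSq g b x) + (1 + 1 / δ) * (b x ^ 2 * gradSq g a x) := by
  have e : gradSq g (fun z => a z * b z) x
      = b x ^ 2 * gradSq g a x + 2 * (a x * b x * gradInner g a b x) + a x ^ 2 * gradSq g b x := by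
    rw [gradSq, gradInner_mul_left ha hb, hg.gradInner_comm a, hg.gradInner_comm b,
      gradInner_mul_left ha hb, gradInner_mul_left ha hb, hg.gradInner_comm b a, gradSq, gradSq]
    ring
  have h1 := hg.abs_gradInner_le a b x
  set p := Real.sqrt (gradSq g a x) with hp
  set q := Real.sqrt (gradSq g b x) with hq
  have hp2 : gradSq g a x = p ^ 2 := (Real.sq_sqrt (hg.gradSq_nonneg a x)).symm
  have hq2 : gradSq g b x = q ^ 2 := (Real.sq_sqrt (hg.gradSq_nonneg b x)).symm
  have h2 : a x * b x * gradInner g a b x ≤ (|b x| * p) * (|a x| * q) := by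
    calc a x * b x * gradInner g a b x ≤ |a x * b x * gradInner g a b x| := le_abs_self _
      _ = |a x| * |b x| * |gradInner g a b x| := by rw [abs_mul, abs_mul]
      _ ≤ |a x| * |b x| * (p * q) := by gcongr
      _ = _ := by ring
  rw [e, hp2, hq2, ← sq_abs (a x), ← sq_abs (b x), ← mul_pow, ← mul_pow]
  set u := |b x| * p
  set w := |a x| * q
  have h3 : 2 * (u * w) ≤ δ * w ^ 2 + 1 / δ * u ^ 2 := by
    have h4 : 0 ≤ (δ * w - u) ^ 2 / δ := by positivity
    have h5 : (δ * w - u) ^ 2 / δ = δ * w ^ 2 + 1 / δ * u ^ 2 - 2 * (u * w) := by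
      field_simp
      ring
    linarith
  linarith

/-- The approximation of `F` by squares of test functions. -/
def approxSqrt (F χ : X → ℝ) (ε : ℝ) (x : X) : ℝ :=
  Real.sqrt ε + χ x * (Real.sqrt (F x + ε) - Real.sqrt ε)

section Approx

variable {F χ : X → ℝ} {ε : ℝ}

theorem contMDiff_approxSqrt (hF : ContMDiff (𝓡 n) 𝓘(ℝ, ℝ) ∞ F) (h0 : ∀ x, 0 ≤ F x)
    (hχ : ContMDiff (𝓡 n) 𝓘(ℝ, ℝ) ∞ χ) (hε : 0 < ε) :
    ContMDiff (𝓡 n) 𝓘(ℝ, ℝ) ∞ (approxSqrt F χ ε) :=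
  contMDiff_const.add (hχ.mul ((contMDiff_sqrt_add hF h0 hε).sub contMDiff_const))

theorem sqrt_le_approxSqrt (h0 : ∀ x, 0 ≤ F x) (hχ0 : ∀ x, 0 ≤ χ x) (x : X) :
    Real.sqrt ε ≤ approxSqrt F χ ε x :=
  le_add_of_nonneg_right (mul_nonneg (hχ0 x)
    (sub_nonneg.2 (Real.sqrt_le_sqrt (by linarith [h0 x]))))

theorem approxSqrt_le (h0 : ∀ x, 0 ≤ F x) (hχ1 : ∀ x, χ x ≤ 1) (x : X) :
    approxSqrt F χ ε x ≤ Real.sqrt (F x + ε) := by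
  have h : 0 ≤ Real.sqrt (F x + ε) - Real.sqrt ε :=
    sub_nonneg.2 (Real.sqrt_le_sqrt (by linarith [h0 x]))
  have := mul_le_of_le_one_left h (hχ1 x)
  rw [approxSqrt]
  linarith

theorem isTestFunction_approxSqrt_sq (hF : ContMDiff (𝓡 n) 𝓘(ℝ, ℝ) ∞ F) (h0 : ∀ x, 0 ≤ F x)
    (hχ : ContMDiff (𝓡 n) 𝓘(ℝ, ℝ) ∞ χ) (hχc : HasCompactSupport χ) (hε : 0 < ε) :
    IsTestFunction n fun x => approxSqrt F χ ε x ^ 2 := by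
  refine ⟨(contMDiff_approxSqrt hF h0 hχ hε).pow 2, ε, HasCompactSupport.intro hχc.isCompact
    fun x hx => ?_⟩
  simp only [approxSqrt, image_eq_zero_of_notMem_tsupport hx, zero_mul, add_zero,
    Real.sq_sqrt hε.le, sub_self]

/-- Up to a constant the approximation is `χ (√(F + ε) - √ε)`. The factor in brackets has square at
most `F`, hence at most `M`, which multiplies the gradient of the cutoff. -/
theorem IsSmoothMetric.gradSq_approxSqrt_le {g : RMetric n X} (hg : IsSmoothMetric g)
    (hF : ContMDiff (𝓡 n) 𝓘(ℝ, ℝ) ∞ F) (h0 : ∀ x, 0 ≤ F x)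
    (hχ : ContMDiff (𝓡 n) 𝓘(ℝ, ℝ) ∞ χ) (hχ0 : ∀ x, 0 ≤ χ x) (hχ1 : ∀ x, χ x ≤ 1) (hε : 0 < ε)
    {M κ : ℝ} (hM : ∀ x, F x ≤ M) {x : X} (hκ : gradSq g χ x ≤ κ) {δ : ℝ} (hδ : 0 < δ) :
    gradSq g (approxSqrt F χ ε) x
      ≤ (1 + δ) * gradSq g (fun z => Real.sqrt (F z)) x + (1 + 1 / δ) * (M * κ) := by
  have hs := contMDiff_sqrt_add hF h0 hε
  have hd : ContMDiff (𝓡 n) 𝓘(ℝ, ℝ) ∞ fun z => Real.sqrt (F z + ε) - Real.sqrt ε :=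
    hs.sub contMDiff_const
  have hshift : ∀ (a : X → ℝ), ContMDiff (𝓡 n) 𝓘(ℝ, ℝ) ∞ a → ∀ c : ℝ,
      gradSq g (fun z => a z + c) x = gradSq g a x := fun a ha c => by
    have hdc : HasDerivAt (fun r : ℝ => r + c) 1 (a x) := (hasDerivAt_id' _).add_const c
    rw [hg.gradSq_comp (φ := fun r => r + c) hdc.differentiableAt ha, hdc.deriv, one_pow, one_mul]
  have e1 : gradSq g (approxSqrt F χ ε) x
      = gradSq g (fun z => χ z * (Real.sqrt (F z + ε) - Real.sqrt ε)) x := by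
    rw [← hshift (fun z => χ z * (Real.sqrt (F z + ε) - Real.sqrt ε)) (hχ.mul hd) (Real.sqrt ε)]
    congr 1
    funext z
    rw [approxSqrt, add_comm]
  have e2 : gradSq g (fun z => Real.sqrt (F z + ε) - Real.sqrt ε) x
      = gradSq g (fun z => Real.sqrt (F z + ε)) x := by
    simp_rw [sub_eq_add_neg]
    exact hshift _ hs _
  have h1 := hg.gradSq_mul_le hχ hd hδ x
  rw [e2] at h1
  rw [e1]
  have h2 := hg.gradSq_sqrt_add_le hF h0 hε x
  have h3 : χ x ^ 2 * gradSq g (fun z => Real.sqrt (F z + ε)) x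
      ≤ gradSq g (fun z => Real.sqrt (F z)) x :=
    (mul_le_of_le_one_left (hg.gradSq_nonneg _ _) (pow_le_one₀ (hχ0 x) (hχ1 x))).trans h2
  have h4 : (Real.sqrt (F x + ε) - Real.sqrt ε) ^ 2 ≤ M := by
    have hsq1 := Real.sq_sqrt (add_nonneg (h0 x) hε.le)
    have hsq2 := Real.sq_sqrt hε.le
    have hle : Real.sqrt ε ≤ Real.sqrt (F x + ε) := Real.sqrt_le_sqrt (by linarith [h0 x])
    nlinarith [mul_le_mul_of_nonneg_left hle (Real.sqrt_nonneg ε), hM x]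
  have h5 : (Real.sqrt (F x + ε) - Real.sqrt ε) ^ 2 * gradSq g χ x ≤ M * κ :=
    mul_le_mul h4 hκ (hg.gradSq_nonneg _ _) ((sq_nonneg _).trans h4)
  have hδ1 : 0 ≤ 1 + δ := by positivity
  have hδ2 : 0 ≤ 1 + 1 / δ := by positivity
  exact h1.trans (add_le_add (mul_le_mul_of_nonneg_left h3 hδ1) (mul_le_mul_of_nonneg_left h5 hδ2))

end Approx

/-- Dominated convergence; `r log r` is continuous also at `0`, so no lower bound is needed here. -/
theorem tendsto_entropy {ν : Measure X} [IsFiniteMeasure ν] {Fk : ℕ → X → ℝ} {F : X → ℝ}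
    (hc : ∀ k, Continuous (Fk k)) {M : ℝ} (h0 : ∀ k x, 0 ≤ Fk k x) (hM : ∀ k x, Fk k x ≤ M)
    (hlim : ∀ x, Tendsto (fun k => Fk k x) atTop (𝓝 (F x))) :
    Tendsto (fun k => entropy ν (Fk k)) atTop (𝓝 (entropy ν F)) := by
  obtain ⟨H, hH⟩ := isCompact_Icc.exists_bound_of_continuousOn (s := Icc 0 M)
    Real.continuous_mul_log.continuousOn
  have l1 : Tendsto (fun k => ∫ x, Fk k x * Real.log (Fk k x) ∂ν) atTop
      (𝓝 (∫ x, F x * Real.log (F x) ∂ν)) := by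
    refine tendsto_integral_of_dominated_convergence (fun _ => H)
      (fun k => (Real.continuous_mul_log.comp (hc k)).aestronglyMeasurable) (integrable_const _)
      (fun k => Eventually.of_forall fun x => hH _ ⟨h0 k x, hM k x⟩)
      (Eventually.of_forall fun x => ?_)
    exact (Real.continuous_mul_log.tendsto (F x)).comp (hlim x)
  have l2 : Tendsto (fun k => ∫ x, Fk k x ∂ν) atTop (𝓝 (∫ x, F x ∂ν)) := by
    refine tendsto_integral_of_dominated_convergence (fun _ => M)
      (fun k => (hc k).aestronglyMeasurable) (integrable_const _)
      (fun k => Eventually.of_forall fun x => ?_) (Eventually.of_forall hlim)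
    rw [Real.norm_eq_abs, abs_of_nonneg (h0 k x)]
    exact hM k x
  exact l1.sub ((Real.continuous_mul_log.tendsto _).comp l2)

/-- A log-Sobolev inequality for test functions bounded below extends to all bounded smooth
nonnegative functions. -/
theorem logSobolev_of_isTestFunction {g : RMetric n X} (hg : IsSmoothMetric g) {ν : Measure X}
    [IsProbabilityMeasure ν] {γ : ℝ} (hγ : 0 < γ) {C : ℝ} {χ : ℕ → X → ℝ}
    (hχ : IsCutoff (fun _ => g) 0 C χ)
    (h : ∀ F : X → ℝ, IsTestFunction n F → ∀ c : ℝ, 0 < c → (∀ x, c ≤ F x) →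
      entropy ν F ≤ 1 / (2 * γ) * ∫ x, gradSq g F x / F x ∂ν) : LogSobolev g ν γ := by
  intro F hF h0 ⟨M₀, hM₀⟩
  set G := ∫⁻ x, ENNReal.ofReal (gradSq g (fun y => Real.sqrt (F y)) x) ∂ν with hG
  by_cases hGtop : G = ⊤
  · rw [hGtop, ENNReal.mul_top (by simpa using hγ)]
    exact le_top
  set M := max M₀ 0 with hMdef
  have hM : ∀ x, F x ≤ M := fun x => (hM₀ x).trans (le_max_left _ _)
  have hM0 : 0 ≤ M := le_max_right _ _
  -- The same sequence serves as shift under the root and as parameter in Young's inequality: the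
  -- error `(1 + 1 / ε_k) M C² / (k + 1)²` still tends to zero.
  set ε : ℕ → ℝ := fun k => 1 / ((k : ℝ) + 1) with hε
  have hε0 : ∀ k, 0 < ε k := fun k => by simp only [hε]; positivity
  have hε1 : ∀ k, ε k ≤ 1 := fun k => by
    simp only [hε]
    exact (div_le_one (by positivity)).2 (by linarith [(Nat.cast_nonneg k : (0 : ℝ) ≤ k)])
  set f : ℕ → X → ℝ := fun k => approxSqrt F (χ k) (ε k) with hf
  have hfs : ∀ k, ContMDiff (𝓡 n) 𝓘(ℝ, ℝ) ∞ (f k) := fun k =>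
    contMDiff_approxSqrt hF h0 (hχ.smooth k) (hε0 k)
  have hfpos : ∀ k x, 0 < f k x := fun k x =>
    (Real.sqrt_pos.2 (hε0 k)).trans_le (sqrt_le_approxSqrt h0 (hχ.nonneg k) x)
  have hfsq : ∀ k x, ε k ≤ f k x ^ 2 := fun k x => by
    have := pow_le_pow_left₀ (Real.sqrt_nonneg _) (sqrt_le_approxSqrt (ε := ε k) h0 (hχ.nonneg k) x) 2
    rwa [Real.sq_sqrt (hε0 k).le] at this
  have hfle : ∀ k x, f k x ^ 2 ≤ F x + ε k := fun k x => by
    have := pow_le_pow_left₀ (hfpos k x).le (approxSqrt_le (ε := ε k) h0 (hχ.le_one k) x) 2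
    rwa [Real.sq_sqrt (add_nonneg (h0 x) (hε0 k).le)] at this
  -- The factor `4` converts `1 / (2γ)` into `2 / γ`.
  have hquot : ∀ k x, gradSq g (fun z => f k z ^ 2) x / f k x ^ 2 = 4 * gradSq g (f k) x :=
    fun k x => by
      have hd : HasDerivAt (fun r : ℝ => r ^ 2) (2 * f k x) (f k x) := by
        simpa using hasDerivAt_pow 2 (f k x)
      rw [hg.gradSq_comp (φ := fun r => r ^ 2) hd.differentiableAt (hfs k), hd.deriv]
      have := (hfpos k x).ne'
      field_simp
      ring
  have hbound : ∀ k, entropy ν (fun x => f k x ^ 2)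
      ≤ 2 / γ * ((1 + ε k) * G.toReal + (1 + 1 / ε k) * (M * (C / ((k : ℝ) + 1)) ^ 2)) := by
    intro k
    have h1 := h _ (isTestFunction_approxSqrt_sq hF h0 (hχ.smooth k) (hχ.compact k) (hε0 k))
      (ε k) (hε0 k) (hfsq k)
    have hε' := hε0 k
    have herr0 : 0 ≤ (1 + 1 / ε k) * (M * (C / ((k : ℝ) + 1)) ^ 2) := by positivity
    have h2 : ∫ x, gradSq g (f k) x ∂ν
        ≤ (1 + ε k) * G.toReal + (1 + 1 / ε k) * (M * (C / ((k : ℝ) + 1)) ^ 2) := by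
      by_cases hi : Integrable (gradSq g (f k)) ν
      · rw [← ENNReal.ofReal_le_ofReal_iff (by positivity)]
        refine (ofReal_integral_le_lintegral hi).trans ?_
        rw [ENNReal.ofReal_add (by positivity) herr0, ENNReal.ofReal_mul (by positivity),
          ENNReal.ofReal_toReal hGtop]
        calc ∫⁻ x, ENNReal.ofReal (gradSq g (f k) x) ∂ν
            ≤ ∫⁻ x, (ENNReal.ofReal ((1 + 1 / ε k) * (M * (C / ((k : ℝ) + 1)) ^ 2))
              + ENNReal.ofReal (1 + ε k)
                * ENNReal.ofReal (gradSq g (fun y => Real.sqrt (F y)) x)) ∂ν := by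
              refine lintegral_mono fun x => ?_
              have hκ : gradSq g (χ k) x ≤ (C / ((k : ℝ) + 1)) ^ 2 := by
                rw [← Real.sq_sqrt (hg.gradSq_nonneg (χ k) x)]
                exact pow_le_pow_left₀ (Real.sqrt_nonneg _)
                  (hχ.sqrt_gradSq_le k 0 ⟨le_rfl, le_rfl⟩ x) 2
              have h3 := hg.gradSq_approxSqrt_le hF h0 (hχ.smooth k) (hχ.nonneg k) (hχ.le_one k)
                hε' hM hκ hε'
              rw [← ENNReal.ofReal_mul (by positivity), ← ENNReal.ofReal_add herr0
                (mul_nonneg (by positivity) (hg.gradSq_nonneg _ _)), add_comm]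
              exact ENNReal.ofReal_le_ofReal h3
          _ = _ := by
              rw [lintegral_add_left measurable_const, lintegral_const, measure_univ, mul_one,
                lintegral_const_mul' _ _ ENNReal.ofReal_ne_top, add_comm]
      -- In this case the integral has its default value `0`, and the bound is trivial.
      · rw [integral_undef hi]
        positivity
    have e : ∫ x, gradSq g (fun z => f k z ^ 2) x / f k x ^ 2 ∂ν
        = 4 * ∫ x, gradSq g (f k) x ∂ν := by
      rw [← integral_const_mul]
      exact integral_congr_ae (Eventually.of_forall (hquot k))
    have h4 : entropy ν (fun x => f k x ^ 2) ≤ 2 / γ * ∫ x, gradSq g (f k) x ∂ν := by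
      refine h1.trans (le_of_eq ?_)
      refine (congrArg (1 / (2 * γ) * ·) e).trans ?_
      field_simp
      ring
    exact h4.trans (mul_le_mul_of_nonneg_left h2 (by positivity))
  have hεlim : Tendsto ε atTop (𝓝 0) := tendsto_one_div_add_atTop_nhds_zero_nat
  have hent : Tendsto (fun k => entropy ν fun x => f k x ^ 2) atTop (𝓝 (entropy ν F)) := by
    refine tendsto_entropy (fun k => (hfs k).continuous.pow 2) (M := M + 1)
      (fun k x => sq_nonneg _) (fun k x => (hfle k x).trans (add_le_add (hM x) (hε1 k)))
      (fun x => ?_)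
    have h5 : Tendsto (fun k => F x + ε k) atTop (𝓝 (F x)) := by
      simpa using hεlim.const_add (F x)
    refine h5.congr' ?_
    filter_upwards [hχ.eventually_one x] with k hk
    simp only [hf, approxSqrt, hk, one_mul, add_sub_cancel]
    rw [Real.sq_sqrt (add_nonneg (h0 x) (hε0 k).le)]
  have hrhs : Tendsto (fun k => 2 / γ * ((1 + ε k) * G.toReal
      + (1 + 1 / ε k) * (M * (C / ((k : ℝ) + 1)) ^ 2))) atTop (𝓝 (2 / γ * G.toReal)) := by
    have h6 : ∀ k, (1 + 1 / ε k) * (M * (C / ((k : ℝ) + 1)) ^ 2)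
        = M * C ^ 2 * (ε k * ε k) + M * C ^ 2 * ε k := fun k => by
      have : (k : ℝ) + 1 ≠ 0 := by positivity
      simp only [hε]
      field_simp
    simp_rw [h6]
    have := (((hεlim.const_add 1).mul_const G.toReal).add
      (((hεlim.mul hεlim).const_mul (M * C ^ 2)).add (hεlim.const_mul (M * C ^ 2)))).const_mul (2 / γ)
    simpa using this
  have hfinal := le_of_tendsto_of_tendsto' hent hrhs hbound
  rw [← ENNReal.ofReal_toReal hGtop, ← ENNReal.ofReal_mul (by positivity)]
  exact ENNReal.ofReal_le_ofReal hfinal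

end Extension

end MultiscaleLSI

end

open MultiscaleLSI in
theorem mainTheorem9 {n : ℕ} {X : Type*} [TopologicalSpace X] [T2Space X]
    [SecondCountableTopology X] [ChartedSpace (Model n) X] [IsManifold (𝓡 n) ∞ X]
    [MeasurableSpace X] [BorelSpace X]
    (T : EReal) (hT : 0 < T) (g : ℝ → RMetric n X) (Z V : ℝ → X → ℝ)
    (hflow : IsRenormFlow T g Z V) (htame : IsTameAtInfinity T g Z V)
    (P : ℝ → (X → ℝ) → X → ℝ) (hP : IsPolchinskiSemigroup T g V P)
    (hcont : ContinuityAssumption T g Z V P)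
    (lamDot : ℝ → ℝ) (hlam : ∀ t ∈ timeSet T, IntervalIntegrable lamDot volume 0 t)
    (hcond : MultiscaleCondition T g V lamDot)
    (γ : ℝ) (hγ : 0 < γ)
    (hγT : ENNReal.ofReal (1 / γ) = ∫⁻ t in timeSet T,
      ENNReal.ofReal (Real.exp (-2 * ∫ s in (0 : ℝ)..t, lamDot s))) :
    LogSobolev (g 0) (renormMeasure (g 0) (Z 0) (V 0)) γ := by
  -- On the empty manifold all integrals vanish, hence so does the entropy. Otherwise `ν_0` is a
  -- probability measure.
  rcases isEmpty_or_nonempty X with hX | hX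
  · intro F _ _ _
    simp [entropy, integral_of_isEmpty]
  have h00 := zero_mem_timeSet hT
  obtain ⟨C, χ, hχ⟩ := exists_isCutoff hflow htame h00
  have hχ' : IsCutoff (fun _ => g 0) 0 C χ :=
    ⟨hχ.smooth, hχ.compact, hχ.nonneg, hχ.le_one, hχ.eventually_one, hχ.const_nonneg,
      fun k _ _ x => hχ.sqrt_gradSq_le k 0 ⟨le_rfl, le_rfl⟩ x⟩
  have := hflow.isProbabilityMeasure_renormMeasure h00
  exact logSobolev_of_isTestFunction (hflow.isSmoothMetric h00) hγ hχ' fun F hF c hc hcF =>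
    entropy_le_of_isTestFunction hT hflow htame hP hcont hlam hcond hγ hγT hF hc hcF
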